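/- A closed set $Y\subset\mathbb R$ is called $\nu$-porous on scales $\alpha_0$ to $\alpha_1$ if every interval $I$ of length $|I|\in[\alpha_0,\alpha_1]$ contains a subinterval $J$ with $|J|=\nu|I|$ and $J\cap Y=\emptyset$. Write $\widehat f(\xi)=\int_{\mathbb R}e^{-ix\xi}f(x)\,dx$. Lemma. Let $\nu\in(0,1)$. There exist constants $c_1>0$ and $\delta<1$, depending only on $\nu$, such that for every $h\in(0,1]$ and every closed set $Y\subset[0,1]$ which is $\nu$-porous on scales $h$ to $1$ there exists a function $\psi\in L^2(\mathbb R)$ such that, with $\theta(\xi):=(\log(10+|\xi|))^{-\delta}$, 1. $\operatorname{supp}\psi\subset[-\nu/10,\nu/10]$; 2. $\|\widehat\psi\|_{L^2(-1/2,1/2)}\ge c_1$; 3. $|\widehat\psi(\xi)|\le(1+|\xi|)^{-10}\exp(-c_1|\xi|\theta(\xi))$ for all $\xi\in h^{-1}\cdot Y+[-2,2]$; 4. $|\widehat\psi(\xi)|\le(1+|\xi|)^{-10}$ for all $\xi\in\mathbb R$. -/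

import Mathlib

open MeasureTheory Set
open scoped FourierTransform Pointwise ENNReal

/-- A closed set `Ω ⊆ ℝ` is `ν`-porous on scales `α₀` to `α₁` if every interval `I` of length
`|I| ∈ [α₀, α₁]` contains a subinterval `J` of length `ν |I|` that is disjoint from `Ω`.
Here `a`, `b` are the endpoints of `I` and `c`, `d` those of `J`. The subinterval is taken open;
this is the weakest requirement among all kinds of intervals with given endpoints. -/
structure IsPorous (ν α₀ α₁ : ℝ) (Ω : Set ℝ) : Prop where
  isClosed : IsClosed Ω
  exists_hole : ∀ a b : ℝ, α₀ ≤ b - a → b - a ≤ α₁ →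
    ∃ c d : ℝ, a ≤ c ∧ d ≤ b ∧ d - c = ν * (b - a) ∧ Disjoint (Ioo c d) Ω

/-- The Fourier transform `ξ ↦ ∫ e^{-ixξ} f(x) dx` of an integrable function, written through
Mathlib's `𝓕`, whose kernel is `e^{-2πixξ}`; see `fourierHat_eq_integral`. -/
noncomputable def fourierHat (f : ℝ → ℂ) (ξ : ℝ) : ℂ :=
  𝓕 f (ξ / (2 * Real.pi))

theorem fourierHat_eq_integral (f : ℝ → ℂ) (ξ : ℝ) :
    fourierHat f ξ = ∫ x : ℝ, Complex.exp (-(Complex.I * x * ξ)) * f x := by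
  have hpi : (Real.pi : ℂ) ≠ 0 := by exact_mod_cast Real.pi_ne_zero
  unfold fourierHat
  rw [Real.fourier_real_eq_integral_exp_smul]
  congr 1
  ext x
  rw [smul_eq_mul]
  congr 2
  push_cast
  field_simp

/-- The function `θ(ξ) = (log (10 + |ξ|))^{-δ}`. -/
noncomputable def logWeight (δ ξ : ℝ) : ℝ :=
  Real.log (10 + |ξ|) ^ (-δ)

/-! ### Contour shifts and holomorphic test functions on the upper half-plane. -/

section FourierMultipliers

open Complex Filter Topology
open scoped ContDiff

/-! The thickened set is covered by intervals of length at least a multiple of |ξ|θ(ξ), and these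
are so sparse that one function of small exponential type can be exponentially small on all of them.

Covering. Porosity empties one child of every cell in an M-adic subdivision, so at depth j the block
[2^k, 2^(k+1)] keeps at most (M-1)^j of its M^j cells, each of length ℓ = 2^k / M^j
(`IsPorous.exists_hole_thickened`, `exists_cover_of_holes`). The cost of a block, seen from far
away, is the sum of the quadratic tails 1 / (1 + ((x-ξ)/ℓ)²) of its cells, of order ((M-1)/M²)^j.
With M^j comparable to k^δ this is summable in k for some δ < 1, because (M-1)/M² < 1/M
(`exists_subdivision_depth`). Keeping all M^j cells would require δ > 1. The same choice makes ℓ at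
least a multiple of |ξ|θ(ξ).

Weight. Let W be the sum over the cells of c ℓ Γ((z-ξ)/ℓ), where Γ = `gaussProfile` is entire, has
nonnegative real part in the upper half-plane, and has real part bounded below just above its own
cell. Then exp(-W) has the desired decay, but it is not the transform of a compactly supported
function.

Correction. `exists_multiplier` repairs this by a Toeplitz-kernel argument in the spirit of Beurling
and Malliavin. Put W^#(z) = conj (W (conj z)) and Θ = exp(2isz + W - W^#), which is unimodular on ℝ.
If g lies in the Hardy space H² and is orthogonal to Θ H², then exp(-W) g has spectrum bounded on
both sides. To produce g, take an explicit U in H² and subtract its projection onto the closed span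
of conj H² and Θ H². If Re (W - W^#) ≤ sη/2 on Im z = η, then exp(isz + W - W^#) is at most
exp(-sη/2) there. Shifting contours to that line shows that the two subspaces are almost orthogonal
and that U is almost orthogonal to both, so g is close to U (`exists_hardySpan_orthogonal`). The
growth condition is invariant under scaling: each cell contributes at most a multiple of η / (1 +
((x-ξ)/ℓ)²), which is exactly the tail that the covering makes summable.

All bounds are read on Im z = η, where L² closeness of g to U becomes pointwise closeness of Poisson
extensions. Passing to that line multiplies the function by exp(ηt) and keeps its support. H² enters
only through the test class `UpperDecay`: ∫ g p = 0 for all such p plays the role of g ∈ H². -/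

theorem integrable_of_norm_le_div_one_add_sq {f : ℝ → ℂ} (hf : Continuous f) {C : ℝ}
    (hb : ∀ x, ‖f x‖ ≤ C / (1 + x ^ 2)) : Integrable f := by
  refine (integrable_inv_one_add_sq.const_mul C).mono' hf.aestronglyMeasurable ?_
  exact Eventually.of_forall fun x => by simpa [div_eq_mul_inv] using hb x

theorem memLp_two_of_integrable_of_bound {f : ℝ → ℂ} (hf : Integrable f) (C : ℝ)
    (hC : ∀ x, ‖f x‖ ≤ C) : MemLp f 2 := by
  refine (memLp_two_iff_integrable_sq_norm hf.1).2
    ((hf.norm.const_mul C).mono' (hf.1.norm.pow 2) (Eventually.of_forall fun x => ?_))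
  rw [Real.norm_of_nonneg (by positivity), sq]
  exact mul_le_mul_of_nonneg_right (hC x) (norm_nonneg _)

theorem continuous_comp_add_mul_I {f : ℂ → ℂ} {y : ℝ}
    (hd : ∀ x : ℝ, DifferentiableAt ℂ f (x + y * I)) : Continuous fun x : ℝ => f (x + y * I) :=
  continuous_iff_continuousAt.2 fun x =>
    ContinuousAt.comp (g := f) (hd x).continuousAt (by fun_prop)

theorem tendsto_div_one_add_sq_atTop (C : ℝ) :
    Tendsto (fun T : ℝ => C / (1 + T ^ 2)) atTop (𝓝 0) :=
  tendsto_const_nhds.div_atTop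
    (tendsto_atTop_add_const_left _ _ (tendsto_pow_atTop two_ne_zero))

/-- The integral over a horizontal line of a function that is holomorphic on a closed strip and
decays quadratically there does not depend on the line. -/
theorem integral_eq_integral_add_mul_I {f : ℂ → ℂ} {y C : ℝ} (hy : 0 ≤ y)
    (hd : ∀ z : ℂ, 0 ≤ z.im → z.im ≤ y → DifferentiableAt ℂ f z)
    (hb : ∀ z : ℂ, 0 ≤ z.im → z.im ≤ y → ‖f z‖ ≤ C / (1 + z.re ^ 2)) :
    ∫ x : ℝ, f x = ∫ x : ℝ, f (x + y * I) := by
  have hi0 : Integrable fun x : ℝ => f x := by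
    refine integrable_of_norm_le_div_one_add_sq (C := C) ?_ fun x => ?_
    · simpa using continuous_comp_add_mul_I (f := f) (y := 0) fun x => hd _ (by simp) (by simpa)
    · simpa using hb x (by simp) (by simpa)
  have hiy : Integrable fun x : ℝ => f (x + y * I) := by
    refine integrable_of_norm_le_div_one_add_sq (C := C)
      (continuous_comp_add_mul_I fun x => hd _ (by simpa) (by simp)) fun x => ?_
    simpa using hb (x + y * I) (by simpa) (by simp)
  have hrect : ∀ T : ℝ, (∫ x in (-T)..T, f x) - ∫ x in (-T)..T, f (x + y * I) =
      -(I * ∫ s in (0 : ℝ)..y, f (T + s * I)) + I * ∫ s in (0 : ℝ)..y, f (-T + s * I) := by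
    intro T
    have h := integral_boundary_rect_eq_zero_of_differentiableOn f (-T : ℂ) (T + y * I) (by
      intro z hz
      have hz2 := hz.2
      simp only [neg_im, ofReal_im, neg_zero, add_im, mul_im, ofReal_re, I_im, mul_one, I_re,
        mul_zero, add_zero, zero_add, mem_preimage, uIcc_of_le hy] at hz2
      exact (hd z hz2.1 hz2.2).differentiableWithinAt)
    simp only [neg_re, ofReal_re, add_re, mul_re, I_re, mul_zero, ofReal_im, I_im, mul_one,
      sub_self, add_zero, neg_im, neg_zero, add_im, mul_im, zero_add, ofReal_zero, zero_mul,
      smul_eq_mul, ofReal_neg] at h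
    linear_combination h
  -- The sign e = ±1 handles both vertical sides: their length y is fixed while the integrand decays
  -- in T.
  have hvert : ∀ e : ℝ, e ^ 2 = 1 → Tendsto (fun T : ℝ => ∫ s in (0 : ℝ)..y, f (((e * T : ℝ) : ℂ) + s * I))
      atTop (𝓝 0) := by
    intro e he
    rw [tendsto_zero_iff_norm_tendsto_zero]
    refine squeeze_zero (fun _ => norm_nonneg _) (fun T => ?_)
      (tendsto_div_one_add_sq_atTop (C * y))
    have := intervalIntegral.norm_integral_le_of_norm_le_const
      (f := fun s : ℝ => f (((e * T : ℝ) : ℂ) + s * I)) (a := 0) (b := y) (C := C / (1 + T ^ 2)) ?_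
    · rw [sub_zero, abs_of_nonneg hy] at this
      rwa [mul_div_right_comm]
    · intro s hs
      rw [uIoc_of_le hy] at hs
      have := hb (((e * T : ℝ) : ℂ) + s * I) (by simpa using hs.1.le) (by simpa using hs.2)
      simpa [mul_pow, he] using this
  have hlim := (hvert 1 (by norm_num)).const_mul I |>.neg.add
    ((hvert (-1) (by norm_num)).const_mul I)
  have h0 := intervalIntegral_tendsto_integral hi0 tendsto_neg_atTop_atBot tendsto_id
  have h1 := intervalIntegral_tendsto_integral hiy tendsto_neg_atTop_atBot tendsto_id
  have h2 := tendsto_nhds_unique (h0.sub h1) (by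
    simp only [id, hrect]
    simpa using hlim)
  simpa [sub_eq_zero] using h2

/-- Functions holomorphic at every point of the closed upper half-plane with quadratic decay. -/
structure UpperDecay (p : ℂ → ℂ) : Prop where
  diff : ∀ z : ℂ, 0 ≤ z.im → DifferentiableAt ℂ p z
  bound : ∃ C : ℝ, ∀ z : ℂ, 0 ≤ z.im → ‖p z‖ ≤ C / (1 + ‖z‖ ^ 2)

/-- Bounded functions holomorphic at every point of the closed upper half-plane. -/
structure UpperBounded (φ : ℂ → ℂ) : Prop where
  diff : ∀ z : ℂ, 0 ≤ z.im → DifferentiableAt ℂ φ z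
  bound : ∃ C : ℝ, ∀ z : ℂ, 0 ≤ z.im → ‖φ z‖ ≤ C

theorem isCompact_upper_inter_closedBall (R : ℝ) :
    IsCompact ({z : ℂ | 0 ≤ z.im} ∩ Metric.closedBall 0 R) :=
  (isCompact_closedBall 0 R).inter_left (isClosed_le continuous_const continuous_im)

theorem exists_norm_le_of_upper_diff {p : ℂ → ℂ}
    (hd : ∀ z : ℂ, 0 ≤ z.im → DifferentiableAt ℂ p z) (R : ℝ) :
    ∃ C : ℝ, 0 ≤ C ∧ ∀ z : ℂ, 0 ≤ z.im → ‖z‖ ≤ R → ‖p z‖ ≤ C := by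
  obtain ⟨C, hC⟩ := (isCompact_upper_inter_closedBall R).exists_bound_of_continuousOn
    (f := p) fun z hz => (hd z hz.1).continuousAt.continuousWithinAt
  exact ⟨max C 0, le_max_right _ _, fun z hz hR =>
    (hC z ⟨hz, by simpa using hR⟩).trans (le_max_left _ _)⟩

namespace UpperBounded

theorem of_norm_le {φ : ℂ → ℂ} (hd : ∀ z : ℂ, 0 ≤ z.im → DifferentiableAt ℂ φ z) (R C : ℝ)
    (hb : ∀ z : ℂ, 0 ≤ z.im → R ≤ ‖z‖ → ‖φ z‖ ≤ C) : UpperBounded φ := by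
  obtain ⟨C', -, hC'⟩ := exists_norm_le_of_upper_diff hd R
  refine ⟨hd, max C C', fun z hz => ?_⟩
  rcases le_total R ‖z‖ with h | h
  · exact (hb z hz h).trans (le_max_left _ _)
  · exact (hC' z hz h).trans (le_max_right _ _)

theorem const (c : ℂ) : UpperBounded fun _ => c :=
  ⟨fun _ _ => differentiableAt_const c, ‖c‖, fun _ _ => le_rfl⟩

theorem mul {φ χ : ℂ → ℂ} (hφ : UpperBounded φ) (hχ : UpperBounded χ) :
    UpperBounded fun z => φ z * χ z := by
  obtain ⟨C, hC⟩ := hφ.bound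
  obtain ⟨D, hD⟩ := hχ.bound
  refine ⟨fun z hz => (hφ.diff z hz).mul (hχ.diff z hz), C * D, fun z hz => ?_⟩
  rw [norm_mul]
  exact mul_le_mul (hC z hz) (hD z hz) (norm_nonneg _) ((norm_nonneg _).trans (hC z hz))

theorem pow {φ : ℂ → ℂ} (hφ : UpperBounded φ) (n : ℕ) : UpperBounded fun z => φ z ^ n := by
  induction n with
  | zero => simpa using const 1
  | succ n ih => simpa [pow_succ] using ih.mul hφ

theorem exp_I_mul {s : ℝ} (hs : 0 ≤ s) : UpperBounded fun z => cexp (I * s * z) := by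
  refine ⟨fun z _ => by fun_prop, 1, fun z hz => ?_⟩
  rw [norm_exp]
  simpa using mul_nonneg hs hz

end UpperBounded

namespace UpperDecay

theorem of_norm_le {p : ℂ → ℂ} (hd : ∀ z : ℂ, 0 ≤ z.im → DifferentiableAt ℂ p z) (R C : ℝ)
    (hb : ∀ z : ℂ, 0 ≤ z.im → R ≤ ‖z‖ → ‖p z‖ * ‖z‖ ^ 2 ≤ C) : UpperDecay p := by
  obtain ⟨C₁, hC₁, hC₁'⟩ := exists_norm_le_of_upper_diff hd (max R 1)
  refine ⟨hd, max (2 * C) (C₁ * (1 + max R 1 ^ 2)), fun z hz => ?_⟩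
  rw [le_div_iff₀ (by positivity)]
  rcases le_total (max R 1) ‖z‖ with h | h
  · have h1 : 1 ≤ ‖z‖ := (le_max_right _ _).trans h
    have h2 := hb z hz ((le_max_left _ _).trans h)
    refine le_trans ?_ (le_max_left _ _)
    have : ‖p z‖ ≤ ‖p z‖ * ‖z‖ ^ 2 :=
      le_mul_of_one_le_right (norm_nonneg _) (one_le_pow₀ h1)
    linarith
  · refine le_trans ?_ (le_max_right _ _)
    have := hC₁' z hz h
    gcongr

theorem upperBounded {p : ℂ → ℂ} (hp : UpperDecay p) : UpperBounded p := by
  obtain ⟨C, hC⟩ := hp.bound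
  refine ⟨hp.diff, C, fun z hz => (hC z hz).trans ?_⟩
  have hC0 : 0 ≤ C := by
    have := (norm_nonneg _).trans (hC 0 le_rfl)
    simpa using this
  exact div_le_self hC0 (by nlinarith [sq_nonneg ‖z‖])

theorem bounded_mul {φ p : ℂ → ℂ} (hφ : UpperBounded φ) (hp : UpperDecay p) :
    UpperDecay fun z => φ z * p z := by
  obtain ⟨C, hC⟩ := hφ.bound
  obtain ⟨D, hD⟩ := hp.bound
  refine ⟨fun z hz => (hφ.diff z hz).mul (hp.diff z hz), C * D, fun z hz => ?_⟩
  rw [norm_mul, mul_div_assoc]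
  exact mul_le_mul (hC z hz) (hD z hz) (norm_nonneg _) ((norm_nonneg _).trans (hC z hz))

theorem zero : UpperDecay fun _ => 0 :=
  ⟨fun _ _ => differentiableAt_const 0, 0, fun _ _ => by simp⟩

theorem add {p q : ℂ → ℂ} (hp : UpperDecay p) (hq : UpperDecay q) :
    UpperDecay fun z => p z + q z := by
  obtain ⟨C, hC⟩ := hp.bound
  obtain ⟨D, hD⟩ := hq.bound
  refine ⟨fun z hz => (hp.diff z hz).add (hq.diff z hz), C + D, fun z hz => ?_⟩
  rw [add_div]
  exact (norm_add_le _ _).trans (add_le_add (hC z hz) (hD z hz))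

theorem const_mul {p : ℂ → ℂ} (hp : UpperDecay p) (c : ℂ) : UpperDecay fun z => c * p z :=
  bounded_mul (UpperBounded.const c) hp

theorem continuous_line {p : ℂ → ℂ} (hp : UpperDecay p) {y : ℝ} (hy : 0 ≤ y) :
    Continuous fun x : ℝ => p (x + y * I) :=
  continuous_comp_add_mul_I fun x => hp.diff _ (by simpa)

theorem continuous_real {p : ℂ → ℂ} (hp : UpperDecay p) : Continuous fun x : ℝ => p x := by
  simpa using hp.continuous_line le_rfl

theorem exists_bound_re {p : ℂ → ℂ} (hp : UpperDecay p) :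
    ∃ C : ℝ, 0 ≤ C ∧ ∀ z : ℂ, 0 ≤ z.im → ‖p z‖ ≤ C / (1 + z.re ^ 2) := by
  obtain ⟨C, hC⟩ := hp.bound
  have hC0 : 0 ≤ C := by
    have := (norm_nonneg _).trans (hC 0 le_rfl)
    simpa using this
  refine ⟨C, hC0, fun z hz => (hC z hz).trans ?_⟩
  have : z.re ^ 2 ≤ ‖z‖ ^ 2 := by
    rw [← sq_abs]
    exact pow_le_pow_left₀ (abs_nonneg _) (abs_re_le_norm z) 2
  gcongr

theorem integrable_line {p : ℂ → ℂ} (hp : UpperDecay p) {y : ℝ} (hy : 0 ≤ y) :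
    Integrable fun x : ℝ => p (x + y * I) := by
  obtain ⟨C, -, hC⟩ := hp.exists_bound_re
  refine integrable_of_norm_le_div_one_add_sq (C := C) (hp.continuous_line hy) fun x => ?_
  simpa using hC (x + y * I) (by simpa)

theorem memLp_line {p : ℂ → ℂ} (hp : UpperDecay p) {y : ℝ} (hy : 0 ≤ y) :
    MemLp (fun x : ℝ => p (x + y * I)) 2 := by
  obtain ⟨C, hC⟩ := hp.upperBounded.bound
  exact memLp_two_of_integrable_of_bound (hp.integrable_line hy) C fun x => hC _ (by simpa)

theorem memLp_real {p : ℂ → ℂ} (hp : UpperDecay p) : MemLp (fun x : ℝ => p x) 2 := by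
  simpa using hp.memLp_line le_rfl

/-- On the line at height y the integrand is at most C / (x² + y²), whose integral Cπ / y vanishes
as the line moves up. -/
theorem integral_real_eq_zero {p : ℂ → ℂ} (hp : UpperDecay p) : ∫ x : ℝ, p x = 0 := by
  obtain ⟨C, hC⟩ := hp.bound
  obtain ⟨D, -, hD⟩ := hp.exists_bound_re
  have hC0 : 0 ≤ C := by
    have := (norm_nonneg _).trans (hC 0 le_rfl)
    simpa using this
  have key : ∀ y : ℝ, 1 ≤ y → ‖∫ x : ℝ, p x‖ ≤ C * Real.pi / y := by
    intro y hy
    have hy0 : 0 < y := by linarith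
    rw [integral_eq_integral_add_mul_I hy0.le (fun z h _ => hp.diff z h) (fun z h _ => hD z h)]
    have hi : Integrable fun x : ℝ => C / y ^ 2 * (1 + (x / y) ^ 2)⁻¹ :=
      (integrable_inv_one_add_sq.comp_div hy0.ne').const_mul _
    refine (norm_integral_le_of_norm_le hi (Eventually.of_forall fun x => ?_)).trans ?_
    · refine (hC _ (by simpa using hy0.le)).trans ?_
      have h1 : ‖(x : ℂ) + y * I‖ ^ 2 = x ^ 2 + y ^ 2 := by
        rw [← normSq_eq_norm_sq, normSq_add_mul_I]
      rw [h1, div_mul_eq_mul_div, ← div_eq_mul_inv, div_div]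
      gcongr
      have : (1 + (x / y) ^ 2) * y ^ 2 = y ^ 2 + x ^ 2 := by field_simp
      rw [this]; linarith
    · rw [integral_const_mul, Measure.integral_comp_div (fun x : ℝ => (1 + x ^ 2)⁻¹),
        integral_univ_inv_one_add_sq, abs_of_pos hy0, smul_eq_mul]
      apply le_of_eq
      field_simp
  have hlim : Tendsto (fun y : ℝ => C * Real.pi / y) atTop (𝓝 0) :=
    tendsto_const_nhds.div_atTop tendsto_id
  have := ge_of_tendsto hlim ((eventually_ge_atTop 1).mono key)
  exact norm_le_zero_iff.1 this

end UpperDecay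

/-! ### The Poisson kernel and multiplicativity of Poisson extension. -/

/-- The Poisson kernel of the upper half-plane. -/
noncomputable def poissonKer (z : ℂ) (t : ℝ) : ℝ :=
  z.im / Real.pi * (‖(t : ℂ) - z‖ ^ 2)⁻¹

theorem norm_ofReal_sub_sq (z : ℂ) (t : ℝ) : ‖(t : ℂ) - z‖ ^ 2 = (t - z.re) ^ 2 + z.im ^ 2 := by
  rw [← normSq_eq_norm_sq, normSq_apply]
  simp
  ring

theorem poissonKer_nonneg {z : ℂ} (hz : 0 < z.im) (t : ℝ) : 0 ≤ poissonKer z t := by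
  unfold poissonKer; positivity

theorem poissonKer_eq {z : ℂ} (hz : 0 < z.im) (t : ℝ) :
    poissonKer z t = (Real.pi * z.im)⁻¹ * (1 + ((t - z.re) / z.im) ^ 2)⁻¹ := by
  have := Real.pi_pos
  rw [poissonKer, norm_ofReal_sub_sq]
  have : 0 < (t - z.re) ^ 2 + z.im ^ 2 := by positivity
  field_simp
  ring

theorem poissonKer_le {z : ℂ} (hz : 0 < z.im) (t : ℝ) : poissonKer z t ≤ (Real.pi * z.im)⁻¹ := by
  rw [poissonKer_eq hz]
  have := Real.pi_pos
  refine mul_le_of_le_one_right (by positivity) (inv_le_one_of_one_le₀ ?_)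
  nlinarith [sq_nonneg ((t - z.re) / z.im)]

theorem continuous_poissonKer {z : ℂ} (hz : 0 < z.im) : Continuous (poissonKer z) := by
  have : poissonKer z = fun t => (Real.pi * z.im)⁻¹ * (1 + ((t - z.re) / z.im) ^ 2)⁻¹ :=
    funext (poissonKer_eq hz)
  rw [this]
  refine continuous_const.mul (Continuous.inv₀ (by fun_prop) fun t => by positivity)

theorem integrable_poissonKer {z : ℂ} (hz : 0 < z.im) : Integrable (poissonKer z) := by
  have : poissonKer z = fun t => (Real.pi * z.im)⁻¹ * (1 + ((t - z.re) / z.im) ^ 2)⁻¹ :=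
    funext (poissonKer_eq hz)
  rw [this]
  exact ((integrable_inv_one_add_sq.comp_div hz.ne').comp_sub_right z.re).const_mul _

theorem integral_poissonKer {z : ℂ} (hz : 0 < z.im) : ∫ t, poissonKer z t = 1 := by
  have : poissonKer z = fun t => (Real.pi * z.im)⁻¹ * (1 + ((t - z.re) / z.im) ^ 2)⁻¹ :=
    funext (poissonKer_eq hz)
  rw [this, integral_const_mul,
    integral_sub_right_eq_self (fun t : ℝ => (1 + (t / z.im) ^ 2)⁻¹) z.re,
    Measure.integral_comp_div (fun x : ℝ => (1 + x ^ 2)⁻¹), integral_univ_inv_one_add_sq,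
    abs_of_pos hz, smul_eq_mul]
  have := Real.pi_pos
  field_simp

theorem memLp_poissonKer {z : ℂ} (hz : 0 < z.im) :
    MemLp (fun t => (poissonKer z t : ℂ)) 2 := by
  refine memLp_two_of_integrable_of_bound (integrable_poissonKer hz).ofReal (Real.pi * z.im)⁻¹
    fun t => ?_
  rw [norm_real, Real.norm_of_nonneg (poissonKer_nonneg hz t)]
  exact poissonKer_le hz t

theorem differentiableAt_dslope {φ : ℂ → ℂ} {z t : ℂ} (hz : ∀ᶠ s in 𝓝 z, DifferentiableAt ℂ φ s)
    (ht : DifferentiableAt ℂ φ t) : DifferentiableAt ℂ (dslope φ z) t := by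
  rcases eq_or_ne t z with rfl | h
  · have : DifferentiableOn ℂ φ {s | DifferentiableAt ℂ φ s} := fun s hs =>
      DifferentiableAt.differentiableWithinAt hs
    exact ((Complex.differentiableOn_dslope hz).2 this).differentiableAt hz
  · exact (differentiableAt_dslope_of_ne h).2 ht

/-- Up to a constant this continues P_z(t) (φ(t) - φ(z)) holomorphically in t. The zero of φ - φ(z)
cancels the pole at z, the other pole conj z lies in the lower half-plane, and the two linear
denominators give quadratic decay. -/
theorem upperDecay_dslope_mul_inv {φ : ℂ → ℂ} (hφ : UpperBounded φ) {z : ℂ} (hz : 0 < z.im) :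
    UpperDecay fun t => dslope φ z t * (t - (starRingEnd ℂ) z)⁻¹ := by
  obtain ⟨C, hC⟩ := hφ.bound
  have hne : ∀ t : ℂ, 0 ≤ t.im → t - (starRingEnd ℂ) z ≠ 0 := by
    intro t ht h
    have := congrArg Complex.im h
    simp at this
    linarith
  refine UpperDecay.of_norm_le (R := 2 * ‖z‖) (C := 8 * C) (fun t ht => ?_) fun t ht hR => ?_
  · refine (differentiableAt_dslope ?_ (hφ.diff t ht)).mul
      ((differentiableAt_id.sub_const _).inv (hne t ht))
    filter_upwards [(isOpen_lt continuous_const continuous_im).mem_nhds hz] with s hs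
    exact hφ.diff s (le_of_lt hs)
  · have hz0 : 0 < ‖z‖ := norm_pos_iff.2 fun h => by simp [h] at hz
    have h1 : ‖t‖ / 2 ≤ ‖t - z‖ := by
      have := norm_sub_norm_le t z
      linarith
    have h2 : ‖t‖ / 2 ≤ ‖t - (starRingEnd ℂ) z‖ := by
      have := norm_sub_norm_le t ((starRingEnd ℂ) z)
      rw [RCLike.norm_conj] at this
      linarith
    have ht0 : 0 < ‖t‖ := by linarith
    have hne' : t ≠ z := fun h => by simp [h] at h1; linarith
    have hsub : ‖φ t - φ z‖ ≤ 2 * C := by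
      have := norm_sub_le (φ t) (φ z)
      have := hC t ht
      have := hC z hz.le
      linarith
    rw [dslope_of_ne _ hne', slope_def_field, norm_mul, norm_div, norm_inv, ← div_eq_mul_inv,
      div_div, div_mul_eq_mul_div, div_le_iff₀ (by
        have := h1.trans_lt' (by linarith : (0:ℝ) < ‖t‖/2)
        have := h2.trans_lt' (by linarith : (0:ℝ) < ‖t‖/2)
        positivity)]
    have hC0 : 0 ≤ C := (norm_nonneg _).trans (hC z hz.le)
    calc ‖φ t - φ z‖ * ‖t‖ ^ 2 ≤ 2 * C * ‖t‖ ^ 2 := by gcongr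
      _ = 8 * C * (‖t‖ / 2 * (‖t‖ / 2)) := by ring
      _ ≤ _ := by gcongr

/-- For real t the denominator factors as |t - z|² = (t - z)(t - conj z). -/
theorem poissonKer_mul_sub_eq (φ : ℂ → ℂ) {z : ℂ} (hz : 0 < z.im) (t : ℝ) :
    (poissonKer z t : ℂ) * (φ t - φ z) =
      (z.im / Real.pi : ℝ) * (dslope φ z t * ((t : ℂ) - (starRingEnd ℂ) z)⁻¹) := by
  have hne : (t : ℂ) ≠ z := fun h => by
    have := congrArg Complex.im h
    simp at this
    linarith
  have h1 : (t : ℂ) - z ≠ 0 := sub_ne_zero.2 hne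
  have h2 : (((‖(t : ℂ) - z‖ ^ 2 : ℝ)) : ℂ) = ((t : ℂ) - z) * ((t : ℂ) - (starRingEnd ℂ) z) := by
    rw [← normSq_eq_norm_sq, ← mul_conj]
    simp
  rw [dslope_of_ne _ hne, slope_def_field, poissonKer, ofReal_mul, ofReal_inv, h2, mul_inv]
  ring

/-- If `g` annihilates all quadratically decaying holomorphic functions, then multiplication by a
bounded holomorphic function commutes with the Poisson extension of `g`. -/
theorem integral_poissonKer_mul {φ : ℂ → ℂ} (hφ : UpperBounded φ) {g : ℝ → ℂ}
    (hi : ∀ p, UpperDecay p → Integrable fun x : ℝ => g x * p x)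
    (hg : ∀ p, UpperDecay p → ∫ x : ℝ, g x * p x = 0) {z : ℂ} (hz : 0 < z.im)
    (hP : Integrable fun t => (poissonKer z t : ℂ) * g t) :
    ∫ t : ℝ, (poissonKer z t : ℂ) * (φ t * g t) = φ z * ∫ t : ℝ, (poissonKer z t : ℂ) * g t := by
  have hq := (upperDecay_dslope_mul_inv hφ hz).const_mul ((z.im / Real.pi : ℝ) : ℂ)
  have h0 := hg _ hq
  have hi0 := hi _ hq
  have heq : ∀ t : ℝ, (poissonKer z t : ℂ) * (φ t * g t) =
      g t * ((z.im / Real.pi : ℝ) * (dslope φ z t * ((t : ℂ) - (starRingEnd ℂ) z)⁻¹)) +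
      φ z * ((poissonKer z t : ℂ) * g t) := by
    intro t
    rw [← poissonKer_mul_sub_eq φ hz]
    ring
  simp_rw [heq]
  rw [integral_add hi0 (hP.const_mul _), h0, zero_add, integral_const_mul]

/-- This is the case g = 1, which annihilates the test class by `UpperDecay.integral_real_eq_zero`.
-/
theorem integral_poissonKer_mul_upperBounded {φ : ℂ → ℂ} (hφ : UpperBounded φ) {z : ℂ}
    (hz : 0 < z.im) : ∫ t : ℝ, (poissonKer z t : ℂ) * φ t = φ z := by
  have h := integral_poissonKer_mul hφ (g := fun _ => 1)
    (fun p hp => by simpa using hp.integrable_line le_rfl)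
    (fun p hp => by simpa using hp.integral_real_eq_zero) hz
    (by simp only [mul_one]; exact (integrable_poissonKer hz).ofReal)
  simp only [mul_one] at h
  rw [h, integral_complex_ofReal, integral_poissonKer hz]
  simp

/-! ### L² pairings and L² bounds on horizontal lines. -/

theorem MeasureTheory.MemLp.norm_toLp_sq {f : ℝ → ℂ} (hf : MemLp f 2) :
    ‖hf.toLp f‖ ^ 2 = ∫ x, ‖f x‖ ^ 2 := by
  have h := inner_self_eq_norm_sq_to_K (𝕜 := ℂ) (hf.toLp f)
  rw [L2.inner_def] at h
  have h2 : ∫ x, inner ℂ (hf.toLp f x) (hf.toLp f x) = ∫ x, ((‖f x‖ ^ 2 : ℝ) : ℂ) := by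
    refine integral_congr_ae ?_
    filter_upwards [hf.coeFn_toLp] with x hx
    rw [hx, inner_self_eq_norm_sq_to_K]
    norm_cast
  rw [h2, integral_complex_ofReal] at h
  apply Complex.ofReal_injective
  rw [h]
  push_cast
  rfl

theorem MeasureTheory.MemLp.inner_toLp {f g : ℝ → ℂ} (hf : MemLp f 2) (hg : MemLp g 2) :
    inner ℂ (hf.toLp f) (hg.toLp g) = ∫ x, (starRingEnd ℂ) (f x) * g x := by
  rw [L2.inner_def]
  refine integral_congr_ae ?_
  filter_upwards [hf.coeFn_toLp, hg.coeFn_toLp] with x hx hy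
  rw [hx, hy, RCLike.inner_apply, mul_comm]

theorem MeasureTheory.MemLp.conj {f : ℝ → ℂ} (hf : MemLp f 2) :
    MemLp (fun x => (starRingEnd ℂ) (f x)) 2 := hf.star

theorem MeasureTheory.MemLp.integrable_mul_two {f g : ℝ → ℂ} (hf : MemLp f 2) (hg : MemLp g 2) :
    Integrable fun x => f x * g x := hf.integrable_mul hg

theorem norm_integral_mul_le {f g : ℝ → ℂ} (hf : MemLp f 2) (hg : MemLp g 2) :
    ‖∫ x, f x * g x‖ ≤ √(∫ x, ‖f x‖ ^ 2) * √(∫ x, ‖g x‖ ^ 2) := by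
  have h := norm_inner_le_norm (𝕜 := ℂ) (hf.conj.toLp _) (hg.toLp g)
  rw [hf.conj.inner_toLp hg] at h
  rw [← hg.norm_toLp_sq, Real.sqrt_sq (norm_nonneg _)]
  have h2 := hf.conj.norm_toLp_sq
  simp only [RCLike.norm_conj] at h2
  rw [← h2, Real.sqrt_sq (norm_nonneg _)]
  simpa using h

theorem MeasureTheory.MemLp.integrable_poissonKer_mul {g : ℝ → ℂ} (hg : MemLp g 2) {z : ℂ}
    (hz : 0 < z.im) : Integrable fun t => (poissonKer z t : ℂ) * g t :=
  (memLp_poissonKer hz).integrable_mul_two hg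

theorem integrable_poissonKer_mul_norm_sq {g : ℝ → ℂ} (hg : MemLp g 2) {z : ℂ} (hz : 0 < z.im) :
    Integrable fun t => poissonKer z t * ‖g t‖ ^ 2 := by
  refine ((hg.integrable_norm_pow two_ne_zero).const_mul (Real.pi * z.im)⁻¹).mono'
    ((continuous_poissonKer hz).aestronglyMeasurable.mul (hg.1.norm.pow 2))
    (Eventually.of_forall fun t => ?_)
  rw [Real.norm_of_nonneg (mul_nonneg (poissonKer_nonneg hz t) (by positivity))]
  exact mul_le_mul_of_nonneg_right (poissonKer_le hz t) (by positivity)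

/-- Cauchy–Schwarz with the kernel split as √P · √P; the first factor has L² norm 1. -/
theorem norm_integral_poissonKer_mul_sq_le {g : ℝ → ℂ} (hg : MemLp g 2) {z : ℂ}
    (hz : 0 < z.im) :
    ‖∫ t, (poissonKer z t : ℂ) * g t‖ ^ 2 ≤ ∫ t, poissonKer z t * ‖g t‖ ^ 2 := by
  have hcont : Continuous fun t => ((√(poissonKer z t) : ℝ) : ℂ) :=
    continuous_ofReal.comp (continuous_poissonKer hz).sqrt
  have hsq : ∀ t, √(poissonKer z t) ^ 2 = poissonKer z t :=
    fun t => Real.sq_sqrt (poissonKer_nonneg hz t)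
  have hn : ∀ t, ‖((√(poissonKer z t) : ℝ) : ℂ)‖ ^ 2 = poissonKer z t := fun t => by
    rw [norm_real, Real.norm_of_nonneg (Real.sqrt_nonneg _), hsq]
  have h1 : MemLp (fun t => ((√(poissonKer z t) : ℝ) : ℂ)) 2 := by
    refine (memLp_two_iff_integrable_sq_norm hcont.aestronglyMeasurable).2 ?_
    simp only [hn]
    exact integrable_poissonKer hz
  have h2 : MemLp (fun t => ((√(poissonKer z t) : ℝ) : ℂ) * g t) 2 := by
    refine (memLp_two_iff_integrable_sq_norm (hcont.aestronglyMeasurable.mul hg.1)).2 ?_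
    simp only [Pi.mul_apply, norm_mul, mul_pow, hn]
    exact integrable_poissonKer_mul_norm_sq hg hz
  have h := norm_integral_mul_le h1 h2
  simp only [norm_mul, mul_pow, hn, integral_poissonKer hz, Real.sqrt_one, one_mul,
    ← mul_assoc] at h
  have heq : ∀ t, ((√(poissonKer z t) : ℝ) : ℂ) * ((√(poissonKer z t) : ℝ) : ℂ) =
      (poissonKer z t : ℂ) := fun t => by
    rw [← ofReal_mul, ← sq, hsq]
  simp only [heq] at h
  refine (pow_le_pow_left₀ (norm_nonneg _) h 2).trans_eq (Real.sq_sqrt ?_)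
  exact integral_nonneg fun t => mul_nonneg (poissonKer_nonneg hz t) (by positivity)

theorem norm_integral_poissonKer_mul_le {g : ℝ → ℂ} (hg : MemLp g 2) {z : ℂ} (hz : 0 < z.im) :
    ‖∫ t, (poissonKer z t : ℂ) * g t‖ ≤ √((Real.pi * z.im)⁻¹) * √(∫ t, ‖g t‖ ^ 2) := by
  rw [← Real.sqrt_mul (by have := Real.pi_pos; positivity)]
  refine Real.le_sqrt_of_sq_le ((norm_integral_poissonKer_mul_sq_le hg hz).trans ?_)
  rw [← integral_const_mul]
  refine integral_mono (integrable_poissonKer_mul_norm_sq hg hz)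
    ((hg.integrable_norm_pow two_ne_zero).const_mul _) fun t => ?_
  exact mul_le_mul_of_nonneg_right (poissonKer_le hz t) (by positivity)

/-- The symmetry lets Fubini integrate the kernel to 1 in the other variable, so Poisson extension
does not increase L² norms. -/
theorem poissonKer_swap (x t y : ℝ) :
    poissonKer (x + y * I) t = poissonKer (t + y * I) x := by
  rw [poissonKer, poissonKer, norm_ofReal_sub_sq, norm_ofReal_sub_sq]
  simp only [add_im, ofReal_im, mul_im, ofReal_re, I_im, mul_one, I_re, mul_zero, add_zero,
    zero_add, add_re, mul_re, sub_self]
  ring_nf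

/-- The `L²` norms of a holomorphic function on horizontal lines are at most the one on `ℝ`. -/
theorem UpperDecay.integral_norm_sq_line_le {p : ℂ → ℂ} (hp : UpperDecay p) {y : ℝ} (hy : 0 < y) :
    ∫ x : ℝ, ‖p (x + y * I)‖ ^ 2 ≤ ∫ x : ℝ, ‖p x‖ ^ 2 := by
  have him : ∀ x : ℝ, 0 < ((x : ℂ) + y * I).im := fun x => by simpa
  have hint : Integrable (fun q : ℝ × ℝ => poissonKer (q.1 + y * I) q.2 * ‖p q.2‖ ^ 2)
      (volume.prod volume) := by
    have hc : Continuous fun q : ℝ × ℝ => poissonKer (q.1 + y * I) q.2 * ‖p q.2‖ ^ 2 := by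
      refine Continuous.mul ?_ ((hp.continuous_real.comp continuous_snd).norm.pow 2)
      simp only [poissonKer]
      refine Continuous.mul (by fun_prop) (Continuous.inv₀ (by fun_prop) fun q => ?_)
      rw [norm_ofReal_sub_sq]
      have := him q.1
      positivity
    rw [integrable_prod_iff' hc.aestronglyMeasurable]
    have hn : ∀ (x t : ℝ), ‖poissonKer (x + y * I) t * ‖p t‖ ^ 2‖ =
        poissonKer (t + y * I) x * ‖p t‖ ^ 2 := fun x t => by
      rw [Real.norm_of_nonneg (mul_nonneg (poissonKer_nonneg (him x) t) (by positivity)),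
        poissonKer_swap]
    constructor
    · refine Eventually.of_forall fun t => ?_
      simp only [poissonKer_swap _ t]
      exact (integrable_poissonKer (him t)).mul_const _
    · simp only [hn]
      have : ∀ t : ℝ, ∫ x : ℝ, poissonKer (t + y * I) x * ‖p t‖ ^ 2 = ‖p t‖ ^ 2 := fun t => by
        rw [integral_mul_const, integral_poissonKer (him t), one_mul]
      simp only [this]
      exact hp.memLp_real.integrable_norm_pow two_ne_zero
  calc ∫ x : ℝ, ‖p (x + y * I)‖ ^ 2
      ≤ ∫ x : ℝ, ∫ t : ℝ, poissonKer (x + y * I) t * ‖p t‖ ^ 2 := by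
        refine integral_mono ((hp.memLp_line hy.le).integrable_norm_pow two_ne_zero)
          hint.integral_prod_left fun x => ?_
        have := norm_integral_poissonKer_mul_sq_le hp.memLp_real (him x)
        rwa [integral_poissonKer_mul_upperBounded hp.upperBounded (him x)] at this
    _ = ∫ t : ℝ, ∫ x : ℝ, poissonKer (x + y * I) t * ‖p t‖ ^ 2 := integral_integral_swap hint
    _ = ∫ t : ℝ, ‖p t‖ ^ 2 := by
        refine integral_congr_ae (Eventually.of_forall fun t => ?_)
        simp only [poissonKer_swap _ t]
        rw [integral_mul_const, integral_poissonKer (him t), one_mul]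

/-- A bounded multiplier that is small on a higher line makes the pairing of two holomorphic
functions small. -/
theorem norm_integral_mul_mul_le {p q H : ℂ → ℂ} (hp : UpperDecay p) (hq : UpperDecay q)
    {η ε B : ℝ} (hη : 0 < η) (hε : 0 ≤ ε)
    (hd : ∀ z : ℂ, 0 ≤ z.im → z.im ≤ η → DifferentiableAt ℂ H z)
    (hB : ∀ z : ℂ, 0 ≤ z.im → z.im ≤ η → ‖H z‖ ≤ B)
    (hH : ∀ x : ℝ, ‖H (x + η * I)‖ ≤ ε) :
    ‖∫ x : ℝ, p x * q x * H x‖ ≤ ε * (√(∫ x : ℝ, ‖p x‖ ^ 2) * √(∫ x : ℝ, ‖q x‖ ^ 2)) := by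
  have hpq : UpperDecay fun z => p z * q z := UpperDecay.bounded_mul hp.upperBounded hq
  obtain ⟨C, hC, hC'⟩ := hpq.exists_bound_re
  have hB0 : 0 ≤ B := (norm_nonneg _).trans (hB 0 le_rfl hη.le)
  rw [integral_eq_integral_add_mul_I (f := fun z => p z * q z * H z) (C := C * B) hη.le
    (fun z h0 h1 => (hpq.diff z h0).mul (hd z h0 h1)) fun z h0 h1 => by
      rw [norm_mul, mul_div_right_comm]
      exact mul_le_mul (hC' z h0) (hB z h0 h1) (norm_nonneg _) (by positivity)]
  have hp' := (hp.memLp_line hη.le).norm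
  have hq' := (hq.memLp_line hη.le).norm
  have hpqi : Integrable fun x : ℝ => ‖p (x + η * I)‖ * ‖q (x + η * I)‖ := by
    simpa [norm_mul] using (hpq.integrable_line hη.le).norm
  have h1 : ‖∫ x : ℝ, p (x + η * I) * q (x + η * I) * H (x + η * I)‖ ≤
      ε * ∫ x : ℝ, ‖p (x + η * I)‖ * ‖q (x + η * I)‖ := by
    rw [← integral_const_mul]
    refine norm_integral_le_of_norm_le (hpqi.const_mul ε) (Eventually.of_forall fun x => ?_)
    rw [norm_mul, norm_mul, mul_comm ε]
    exact mul_le_mul_of_nonneg_left (hH x) (by positivity)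
  refine h1.trans (mul_le_mul_of_nonneg_left ?_ hε)
  have h2 := norm_integral_mul_le (f := fun x : ℝ => ((‖p (x + η * I)‖ : ℝ) : ℂ))
    (g := fun x : ℝ => ((‖q (x + η * I)‖ : ℝ) : ℂ)) hp'.ofReal hq'.ofReal
  simp only [norm_real, norm_norm, ← ofReal_mul] at h2
  rw [integral_complex_ofReal, norm_real] at h2
  refine (le_abs_self _).trans (h2.trans ?_)
  exact mul_le_mul (Real.sqrt_le_sqrt (hp.integral_norm_sq_line_le hη))
    (Real.sqrt_le_sqrt (hq.integral_norm_sq_line_le hη)) (Real.sqrt_nonneg _) (Real.sqrt_nonneg _)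

/-! ### Almost orthogonality of conj H² and Θ H². -/

theorem norm_cexp_I_mul_real (s x : ℝ) : ‖cexp (I * s * x)‖ = 1 := by
  rw [norm_exp]
  simp

theorem continuous_cexp_I_mul_real (s : ℝ) : Continuous fun x : ℝ => cexp (I * s * x) := by
  fun_prop

theorem UpperDecay.memLp_unimodular_mul {q : ℂ → ℂ} (hq : UpperDecay q) {Θ : ℝ → ℂ}
    (hΘ : Continuous Θ) (hn : ∀ x, ‖Θ x‖ = 1) : MemLp (fun x : ℝ => Θ x * q x) 2 :=
  hq.memLp_real.of_le (hΘ.mul hq.continuous_real).aestronglyMeasurable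
    (Eventually.of_forall fun x => by simp [hn])

/-- The span in `L²(ℝ)` of the conjugates of decaying holomorphic functions and of `Θ` times such
functions. -/
def hardySpan (Θ : ℝ → ℂ) : Submodule ℂ (Lp ℂ 2 (volume : Measure ℝ)) where
  carrier := {f | ∃ p q, UpperDecay p ∧ UpperDecay q ∧
    f =ᵐ[volume] fun x : ℝ => (starRingEnd ℂ) (p x) + Θ x * q x}
  zero_mem' := ⟨_, _, UpperDecay.zero, UpperDecay.zero, by
    filter_upwards [Lp.coeFn_zero ℂ 2 (volume : Measure ℝ)] with x hx
    rw [hx]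
    simp⟩
  add_mem' := by
    rintro f g ⟨p, q, hp, hq, hf⟩ ⟨p', q', hp', hq', hg⟩
    refine ⟨_, _, hp.add hp', hq.add hq', ?_⟩
    filter_upwards [Lp.coeFn_add f g, hf, hg] with x h1 h2 h3
    rw [h1, Pi.add_apply, h2, h3, map_add]
    ring
  smul_mem' := by
    rintro c f ⟨p, q, hp, hq, hf⟩
    refine ⟨_, _, hp.const_mul ((starRingEnd ℂ) c), hq.const_mul c, ?_⟩
    filter_upwards [Lp.coeFn_smul c f, hf] with x h1 h2
    rw [h1, Pi.smul_apply, h2, map_mul, conj_conj, smul_eq_mul]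
    ring

section Correction

variable {H U : ℂ → ℂ} {s η ε B : ℝ}

theorem continuous_real_of_strip (hη : 0 < η)
    (hd : ∀ z : ℂ, 0 ≤ z.im → z.im ≤ η → DifferentiableAt ℂ H z) :
    Continuous fun x : ℝ => H x := by
  simpa using continuous_comp_add_mul_I (f := H) (y := 0)
    fun x => hd _ (by simp) (by simpa using hη.le)

/-- The conj p component contributes ∫ U p = 0. For the other component, `hUc` lets U absorb
exp(isx), so the pairing is the conjugate of ∫ q U H, which is O(ε) by moving to the line where H is
small. -/
theorem norm_inner_hardySpan_le (hU : UpperDecay U) (hs : 0 ≤ s) (hη : 0 < η) (hε0 : 0 ≤ ε)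
    (hε : ε ≤ 1 / 2) (hd : ∀ z : ℂ, 0 ≤ z.im → z.im ≤ η → DifferentiableAt ℂ H z)
    (hB : ∀ z : ℂ, 0 ≤ z.im → z.im ≤ η → ‖H z‖ ≤ B) (hH : ∀ x : ℝ, ‖H (x + η * I)‖ ≤ ε)
    (hHr : ∀ x : ℝ, ‖H x‖ = 1)
    (hUc : ∀ x : ℝ, (starRingEnd ℂ) (U x) * cexp (I * s * x) = U x)
    {f : Lp ℂ 2 (volume : Measure ℝ)}
    (hf : f ∈ hardySpan fun x : ℝ => cexp (I * s * x) * H x) :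
    ‖inner ℂ f (hU.memLp_real.toLp _)‖ ≤ 2 * ε * √(∫ x : ℝ, ‖U x‖ ^ 2) * ‖f‖ := by
  obtain ⟨p, q, hp, hq, hfe⟩ := hf
  have hHc := continuous_real_of_strip hη hd
  have hΘc : Continuous fun x : ℝ => cexp (I * s * x) * H x :=
    (continuous_cexp_I_mul_real s).mul hHc
  have hΘn : ∀ x : ℝ, ‖cexp (I * s * x) * H x‖ = 1 := fun x => by
    rw [norm_mul, norm_cexp_I_mul_real, hHr, one_mul]
  have hΘq := hq.memLp_unimodular_mul hΘc hΘn
  have hn : MemLp (fun x : ℝ => (starRingEnd ℂ) (p x) + cexp (I * s * x) * H x * q x) 2 :=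
    hp.memLp_real.conj.add hΘq
  have hfn : f = hn.toLp _ := Lp.ext (hfe.trans hn.coeFn_toLp.symm)
  have hep : UpperDecay fun z => cexp (I * s * z) * p z :=
    UpperDecay.bounded_mul (UpperBounded.exp_I_mul hs) hp
  have hepn : ∀ x : ℝ, ‖cexp (I * s * x) * p x‖ = ‖p x‖ := fun x => by
    rw [norm_mul, norm_cexp_I_mul_real, one_mul]
  set P := √(∫ x : ℝ, ‖p x‖ ^ 2) with hP
  set Q := √(∫ x : ℝ, ‖q x‖ ^ 2) with hQ
  set N := √(∫ x : ℝ, ‖U x‖ ^ 2) with hN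
  have hP0 : 0 ≤ P := Real.sqrt_nonneg _
  have hQ0 : 0 ≤ Q := Real.sqrt_nonneg _
  have hN0 : 0 ≤ N := Real.sqrt_nonneg _
  have hPs : P ^ 2 = ∫ x : ℝ, ‖p x‖ ^ 2 := Real.sq_sqrt (integral_nonneg fun _ => by positivity)
  have hQs : Q ^ 2 = ∫ x : ℝ, ‖q x‖ ^ 2 := Real.sq_sqrt (integral_nonneg fun _ => by positivity)
  have hcross : ‖∫ x : ℝ, cexp (I * s * x) * p x * q x * H x‖ ≤ ε * (P * Q) := by
    have := norm_integral_mul_mul_le hep hq hη hε0 hd hB hH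
    simpa only [hepn] using this
  have hinner : inner ℂ f (hU.memLp_real.toLp _) =
      (starRingEnd ℂ) (∫ x : ℝ, q x * U x * H x) := by
    rw [hfn, hn.inner_toLp, ← integral_conj]
    have h1 : ∀ x : ℝ, (starRingEnd ℂ) ((starRingEnd ℂ) (p x) + cexp (I * s * x) * H x * q x) * U x =
        U x * p x + (starRingEnd ℂ) (q x * U x * H x) := fun x => by
      conv_rhs => rw [← hUc x]
      simp only [map_add, map_mul, conj_conj]
      ring_nf
      have h2 := hUc x
      have h3 := congrArg (starRingEnd ℂ) h2
      simp only [map_mul, conj_conj] at h3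
      linear_combination (p x) * (h2.symm)
    simp only [h1]
    have hUp : UpperDecay fun z => U z * p z := UpperDecay.bounded_mul hU.upperBounded hp
    have hi : Integrable fun x : ℝ => (starRingEnd ℂ) (q x * U x * H x) := by
      have h2 : Integrable fun x : ℝ => q x * U x :=
        hq.memLp_real.integrable_mul_two hU.memLp_real
      have h3 : Integrable fun x : ℝ => q x * U x * H x :=
        h2.mono ((hq.continuous_real.mul hU.continuous_real).mul hHc).aestronglyMeasurable
          (Eventually.of_forall fun x => by simp [hHr])
      exact (LinearIsometryEquiv.integrable_comp_iff conjLIE).2 h3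
    rw [integral_add (by simpa using hUp.integrable_line le_rfl) hi, hUp.integral_real_eq_zero,
      zero_add]
  have hnorm : ‖f‖ ^ 2 = P ^ 2 + Q ^ 2 + 2 * (∫ x : ℝ, cexp (I * s * x) * p x * q x * H x).re := by
    rw [hfn, hn.norm_toLp_sq, hPs, hQs]
    have hpi := hp.memLp_real.integrable_norm_pow (p := 2) two_ne_zero
    have hqi := hq.memLp_real.integrable_norm_pow (p := 2) two_ne_zero
    have hci : Integrable fun x : ℝ => cexp (I * s * x) * p x * q x * H x := by
      have h2 : Integrable fun x : ℝ => p x * q x :=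
        hp.memLp_real.integrable_mul_two hq.memLp_real
      refine h2.mono ?_ (Eventually.of_forall fun x => by simp [hHr, norm_cexp_I_mul_real])
      exact ((((continuous_cexp_I_mul_real s).mul hp.continuous_real).mul
        hq.continuous_real).mul hHc).aestronglyMeasurable
    have h2 : ∀ x : ℝ, ‖(starRingEnd ℂ) (p x) + cexp (I * s * x) * H x * q x‖ ^ 2 =
        ‖p x‖ ^ 2 + ‖q x‖ ^ 2 + 2 * (cexp (I * s * x) * p x * q x * H x).re := fun x => by
      have h3 := norm_add_sq (𝕜 := ℂ) ((starRingEnd ℂ) (p x)) (cexp (I * s * x) * H x * q x)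
      rw [RCLike.norm_conj, norm_mul _ (q x), hΘn, one_mul, RCLike.inner_apply, conj_conj] at h3
      rw [h3]
      have : cexp (I * s * x) * H x * q x * p x = cexp (I * s * x) * p x * q x * H x := by ring
      rw [this]
      simp only [RCLike.re_to_complex]
      ring
    simp only [h2]
    have h4 : Integrable fun x : ℝ => ‖p x‖ ^ 2 + ‖q x‖ ^ 2 := hpi.add hqi
    have h5 : Integrable fun x : ℝ => 2 * (cexp (I * s * x) * p x * q x * H x).re :=
      hci.re.const_mul 2
    rw [integral_add h4 h5, integral_add hpi hqi, integral_const_mul]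
    congr 2
    exact integral_re hci
  have hre := (neg_abs_le _).trans' (neg_le_neg ((abs_re_le_norm _).trans hcross))
  -- The cross term is at most PQ/2, so ‖f‖² ≥ P² + Q² - PQ = (P - Q/2)² + 3Q²/4.
  have hQf : Q ≤ 2 * ‖f‖ := by
    refine abs_le_of_sq_le_sq' ?_ (by positivity) |>.2
    have : ε * (P * Q) ≤ 1 / 2 * (P * Q) := by gcongr
    nlinarith [sq_nonneg (P - Q / 2)]
  rw [hinner, RCLike.norm_conj]
  refine (norm_integral_mul_mul_le hq hU hη hε0 hd hB hH).trans ?_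
  calc ε * (Q * N) ≤ ε * (2 * ‖f‖ * N) := by gcongr
    _ = _ := by ring

/-- If `H` is unimodular on `ℝ` and small on a higher line, then `U` is close in `L²` to a function
orthogonal to `hardySpan`. -/
theorem exists_hardySpan_orthogonal (hU : UpperDecay U) (hs : 0 ≤ s) (hη : 0 < η) (hε0 : 0 ≤ ε)
    (hε : ε ≤ 1 / 2) (hd : ∀ z : ℂ, 0 ≤ z.im → z.im ≤ η → DifferentiableAt ℂ H z)
    (hB : ∀ z : ℂ, 0 ≤ z.im → z.im ≤ η → ‖H z‖ ≤ B) (hH : ∀ x : ℝ, ‖H (x + η * I)‖ ≤ ε)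
    (hHr : ∀ x : ℝ, ‖H x‖ = 1)
    (hUc : ∀ x : ℝ, (starRingEnd ℂ) (U x) * cexp (I * s * x) = U x) :
    ∃ g : ℝ → ℂ, MemLp g 2 ∧ (∀ p, UpperDecay p → ∫ x : ℝ, g x * p x = 0) ∧
      (∀ q, UpperDecay q →
        ∫ x : ℝ, g x * (starRingEnd ℂ) (cexp (I * s * x) * H x * q x) = 0) ∧
      √(∫ x : ℝ, ‖U x - g x‖ ^ 2) ≤ 2 * ε * √(∫ x : ℝ, ‖U x‖ ^ 2) := by
  set V := hardySpan fun x : ℝ => cexp (I * s * x) * H x with hV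
  set K := V.topologicalClosure
  have : CompleteSpace K := V.isClosed_topologicalClosure.completeSpace_coe
  set u := hU.memLp_real.toLp _ with hu
  set v := K.starProjection u with hv
  have hHc := continuous_real_of_strip hη hd
  have hΘc : Continuous fun x : ℝ => cexp (I * s * x) * H x :=
    (continuous_cexp_I_mul_real s).mul hHc
  have hΘn : ∀ x : ℝ, ‖cexp (I * s * x) * H x‖ = 1 := fun x => by
    rw [norm_mul, norm_cexp_I_mul_real, hHr, one_mul]
  have hvK : v ∈ K := K.starProjection_apply_mem u
  have horth : ∀ w ∈ V, inner ℂ w (u - v) = 0 := fun w hw =>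
    (K.mem_orthogonal _).1 (K.sub_starProjection_mem_orthogonal u) w
      (V.le_topologicalClosure hw)
  have hbound : ∀ w ∈ K, ‖inner ℂ w u‖ ≤ 2 * ε * √(∫ x : ℝ, ‖U x‖ ^ 2) * ‖w‖ := by
    intro w hw
    have hcl : IsClosed {w : Lp ℂ 2 (volume : Measure ℝ) |
        ‖inner ℂ w u‖ ≤ 2 * ε * √(∫ x : ℝ, ‖U x‖ ^ 2) * ‖w‖} :=
      isClosed_le (by fun_prop) (by fun_prop)
    have hsub : (V : Set (Lp ℂ 2 (volume : Measure ℝ))) ⊆ {w | ‖inner ℂ w u‖ ≤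
        2 * ε * √(∫ x : ℝ, ‖U x‖ ^ 2) * ‖w‖} := fun w hw =>
      norm_inner_hardySpan_le hU hs hη hε0 hε hd hB hH hHr hUc hw
    exact closure_minimal hsub hcl hw
  -- For the projection v of u, ‖v‖² = ⟨v, u⟩, and the right side is bounded by the estimate
  -- extended to the closure.
  have hvnorm : ‖v‖ ≤ 2 * ε * √(∫ x : ℝ, ‖U x‖ ^ 2) := by
    have h1 : inner ℂ v u = inner ℂ v v := by
      have h2 := (K.mem_orthogonal _).1 (K.sub_starProjection_mem_orthogonal u) v hvK
      rw [inner_sub_right, sub_eq_zero] at h2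
      exact h2
    have h3 := hbound v hvK
    rw [h1, inner_self_eq_norm_sq_to_K] at h3
    have h4 : ‖v‖ * ‖v‖ ≤ 2 * ε * √(∫ x : ℝ, ‖U x‖ ^ 2) * ‖v‖ := by
      have : ‖((‖v‖ : ℂ)) ^ 2‖ = ‖v‖ * ‖v‖ := by simp [sq]
      rw [← this]; exact h3
    rcases (norm_nonneg v).eq_or_lt with h | h
    · rw [← h]; positivity
    · exact le_of_mul_le_mul_right h4 h
  have hvL : MemLp v 2 := Lp.memLp v
  have hgL : MemLp (fun x : ℝ => U x - v x) 2 := hU.memLp_real.sub hvL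
  have hgeq : hgL.toLp _ = u - v := by
    refine Lp.ext (hgL.coeFn_toLp.trans ?_)
    filter_upwards [Lp.coeFn_sub u v, hU.memLp_real.coeFn_toLp] with x h1 h2
    rw [h1, Pi.sub_apply, hu, h2]
  refine ⟨fun x : ℝ => U x - v x, hgL, fun p hp => ?_, fun q hq => ?_, ?_⟩
  · have h := horth (hp.memLp_real.conj.toLp _) ⟨p, _, hp, UpperDecay.zero, by
      simpa using hp.memLp_real.conj.coeFn_toLp⟩
    rw [← hgeq, hp.memLp_real.conj.inner_toLp] at h
    rw [← h]
    exact integral_congr_ae (Eventually.of_forall fun x => by simp [mul_comm])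
  · have hΘq := hq.memLp_unimodular_mul hΘc hΘn
    have h := horth (hΘq.toLp _) ⟨_, q, UpperDecay.zero, hq, by simpa using hΘq.coeFn_toLp⟩
    rw [← hgeq, hΘq.inner_toLp] at h
    rw [← h]
    exact integral_congr_ae (Eventually.of_forall fun x => by simp only [mul_comm])
  · have : ∫ x : ℝ, ‖U x - (U x - v x)‖ ^ 2 = ‖v‖ ^ 2 := by
      have h1 := hvL.norm_toLp_sq
      rw [Lp.toLp_coeFn] at h1
      simpa using h1.symm
    rw [this, Real.sqrt_sq (norm_nonneg _)]
    exact hvnorm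

end Correction

/-! ### Transforms of test functions and a Paley–Wiener criterion in L². -/

/-- The Laplace-type transform of a function that is integrable against all exponentials is
entire. -/
theorem differentiable_integral_mul_cexp {f : ℝ → ℂ} (hf : AEStronglyMeasurable f)
    (hi : ∀ R : ℝ, Integrable fun t => ‖f t‖ * Real.exp (R * |t|)) :
    Differentiable ℂ fun z : ℂ => ∫ t : ℝ, f t * cexp (I * t * z) := by
  intro z₀
  have hexp : ∀ (z : ℂ) (t : ℝ), ‖cexp (I * t * z)‖ ≤ Real.exp (‖z‖ * |t|) := by
    intro z t
    rw [norm_exp]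
    refine Real.exp_le_exp.2 ?_
    refine (re_le_norm _).trans ?_
    simp [mul_comm]
  have hm : ∀ z : ℂ, AEStronglyMeasurable fun t : ℝ => f t * cexp (I * t * z) := fun z =>
    hf.mul (Continuous.aestronglyMeasurable (by fun_prop))
  refine (hasDerivAt_integral_of_dominated_loc_of_deriv_le (𝕜 := ℂ)
    (F := fun z t => f t * cexp (I * t * z)) (F' := fun z t => f t * (cexp (I * t * z) * (I * t)))
    (bound := fun t => ‖f t‖ * Real.exp ((‖z₀‖ + 2) * |t|)) (Metric.ball_mem_nhds z₀ one_pos)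
    (Eventually.of_forall hm) ?_ ?_ ?_ (hi _) ?_).2.differentiableAt
  · refine (hi ‖z₀‖).mono' (hm z₀) (Eventually.of_forall fun t => ?_)
    rw [norm_mul]
    exact mul_le_mul_of_nonneg_left (hexp z₀ t) (norm_nonneg _)
  · exact hf.mul (Continuous.aestronglyMeasurable (by fun_prop))
  · refine Eventually.of_forall fun t z hz => ?_
    rw [norm_mul]
    refine mul_le_mul_of_nonneg_left ?_ (norm_nonneg _)
    have hz' : ‖z‖ ≤ ‖z₀‖ + 1 := by
      have h1 := norm_sub_norm_le z z₀
      have h2 : ‖z - z₀‖ < 1 := by simpa [dist_eq_norm] using hz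
      linarith
    have h3 : |t| ≤ Real.exp |t| := by linarith [Real.add_one_le_exp |t|]
    calc ‖cexp (I * t * z) * (I * t)‖ = ‖cexp (I * t * z)‖ * |t| := by simp
      _ ≤ Real.exp (‖z‖ * |t|) * Real.exp |t| := by gcongr; exact hexp z t
      _ = Real.exp ((‖z‖ + 1) * |t|) := by rw [← Real.exp_add]; ring_nf
      _ ≤ _ := by
        refine Real.exp_le_exp.2 (mul_le_mul_of_nonneg_right (by linarith) (abs_nonneg _))
  · refine Eventually.of_forall fun t z _ => ?_
    have h1 : HasDerivAt (fun z : ℂ => I * t * z) (I * t) z := by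
      simpa using (hasDerivAt_id z).const_mul (I * t)
    exact (h1.cexp).const_mul (f t)

theorem integrable_ofReal_mul_of_hasCompactSupport {β : ℝ → ℝ} (hβ : Continuous β)
    (hc : HasCompactSupport β) {e : ℝ → ℂ} (he : Continuous e) :
    Integrable fun t => (β t : ℂ) * e t := by
  refine Continuous.integrable_of_hasCompactSupport (by fun_prop) ?_
  exact HasCompactSupport.mul_right (hc.comp_left (g := fun x : ℝ => (x : ℂ)) (by simp))

theorem integral_deriv_mul_cexp {β : ℝ → ℝ} (hβ : ContDiff ℝ ∞ β) (hc : HasCompactSupport β)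
    (z : ℂ) : ∫ t : ℝ, ((deriv β t : ℝ) : ℂ) * cexp (I * t * z) =
      -(I * z) * ∫ t : ℝ, (β t : ℂ) * cexp (I * t * z) := by
  have hβ' : Continuous (deriv β) := hβ.continuous_deriv (by simp)
  have he : Continuous fun t : ℝ => cexp (I * t * z) := by fun_prop
  have he' : Continuous fun t : ℝ => cexp (I * t * z) * (I * z) := by fun_prop
  have h := integral_mul_deriv_eq_deriv_mul_of_integrable (u := fun t : ℝ => (β t : ℂ))
    (u' := fun t => ((deriv β t : ℝ) : ℂ)) (v := fun t : ℝ => cexp (I * t * z))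
    (v' := fun t : ℝ => cexp (I * t * z) * (I * z))
    (fun t _ => ((hβ.differentiable (by simp)) t).hasDerivAt.ofReal_comp)
    (fun t _ => by
      have h1 : HasDerivAt (fun t : ℝ => I * (t : ℂ) * z) (I * z) t := by
        simpa using ((hasDerivAt_id t).ofReal_comp.const_mul I).mul_const z
      exact h1.cexp)
    (integrable_ofReal_mul_of_hasCompactSupport hβ.continuous hc he')
    (integrable_ofReal_mul_of_hasCompactSupport hβ' hc.deriv he)
    (integrable_ofReal_mul_of_hasCompactSupport hβ.continuous hc he)
  rw [← integral_const_mul]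
  rw [← neg_eq_iff_eq_neg] at h
  rw [← h, ← integral_neg]
  exact integral_congr_ae (Eventually.of_forall fun t => by simp only; ring)

theorem norm_integral_mul_cexp_le {β : ℝ → ℝ} (hβ : Continuous β) (hc : HasCompactSupport β)
    (h0 : ∀ t < 0, β t = 0) {z : ℂ} (hz : 0 ≤ z.im) :
    ‖∫ t : ℝ, (β t : ℂ) * cexp (I * t * z)‖ ≤ ∫ t, |β t| := by
  refine norm_integral_le_of_norm_le ((hβ.integrable_of_hasCompactSupport hc).abs)
    (Eventually.of_forall fun t => ?_)
  rcases lt_or_ge t 0 with h | h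
  · simp [h0 t h]
  · rw [norm_mul, norm_real, Real.norm_eq_abs, norm_exp]
    refine mul_le_of_le_one_right (abs_nonneg _) ?_
    rw [Real.exp_le_one_iff]
    simpa using mul_nonneg h hz

/-- Two integrations by parts gain |z|², and support in t > 0 keeps exp(itz) bounded on the upper
half-plane. -/
theorem upperDecay_integral_mul_cexp {β : ℝ → ℝ} (hβ : ContDiff ℝ ∞ β) (hc : HasCompactSupport β)
    (h0 : tsupport β ⊆ Ioi 0) : UpperDecay fun z => ∫ t : ℝ, (β t : ℂ) * cexp (I * t * z) := by
  have hβ1 : ContDiff ℝ ∞ (deriv β) := (contDiff_infty_iff_deriv.1 hβ).2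
  have hβ2 : Continuous (deriv (deriv β)) := hβ1.continuous_deriv (by simp)
  have hz2 : ∀ t < 0, deriv (deriv β) t = 0 := fun t ht => by
    by_contra h
    have h1 : t ∈ tsupport (deriv (deriv β)) := subset_closure h
    have h2 := h0 (tsupport_deriv_subset (𝕜 := ℝ) (tsupport_deriv_subset (𝕜 := ℝ) h1))
    exact absurd h2 (by simpa using ht.le)
  refine UpperDecay.of_norm_le (R := 0) (C := ∫ t, |deriv (deriv β) t|) (fun z _ => ?_)
    fun z hz _ => ?_
  · refine differentiable_integral_mul_cexp (by have := hβ.continuous; fun_prop) (fun R => ?_) z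
    have := hβ.continuous
    refine Continuous.integrable_of_hasCompactSupport (by fun_prop) ?_
    exact HasCompactSupport.mul_right (hc.comp_left (g := fun x : ℝ => ‖(x : ℂ)‖) (by simp))
  · have h1 := norm_integral_mul_cexp_le hβ2 hc.deriv.deriv hz2 hz
    rw [integral_deriv_mul_cexp hβ1 hc.deriv, integral_deriv_mul_cexp hβ hc] at h1
    simp only [norm_mul, norm_neg, norm_I, one_mul] at h1
    calc _ = ‖z‖ * (‖z‖ * ‖∫ t : ℝ, (β t : ℂ) * cexp (I * t * z)‖) := by ring
      _ ≤ _ := h1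

theorem quasiMeasurePreserving_const_mul {a : ℝ} (ha : a ≠ 0) :
    Measure.QuasiMeasurePreserving (fun x : ℝ => a * x) volume volume :=
  ⟨measurable_const_mul a, by
    rw [Real.map_volume_mul_left ha]
    exact Measure.smul_absolutelyContinuous⟩

theorem MeasureTheory.MemLp.comp_const_mul {F : ℝ → ℂ} (hF : MemLp F 2) {a : ℝ} (ha : a ≠ 0) :
    MemLp (fun x => F (a * x)) 2 := by
  have hm : AEStronglyMeasurable (fun x => F (a * x)) :=
    hF.1.comp_quasiMeasurePreserving (quasiMeasurePreserving_const_mul ha)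
  refine (memLp_two_iff_integrable_sq_norm hm).2 ?_
  exact (hF.integrable_norm_pow two_ne_zero).comp_mul_left' ha

/-- A complex Schwartz function from a real test function. -/
noncomputable def testSchwartz {α : ℝ → ℝ} (hα : ContDiff ℝ ∞ α) (hc : HasCompactSupport α) :
    SchwartzMap ℝ ℂ :=
  (hc.comp_left (g := fun x : ℝ => (x : ℂ)) (by simp)).toSchwartzMap
    (ofRealCLM.contDiff.comp hα)

theorem testSchwartz_apply {α : ℝ → ℝ} (hα : ContDiff ℝ ∞ α) (hc : HasCompactSupport α) (t : ℝ) :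
    testSchwartz hα hc t = α t := rfl

theorem fourierInv_testSchwartz {α : ℝ → ℝ} (hα : ContDiff ℝ ∞ α) (hc : HasCompactSupport α)
    (y : ℝ) : (𝓕⁻ (testSchwartz hα hc)) y =
      ∫ t : ℝ, (α t : ℂ) * cexp (I * t * ((2 * Real.pi * y : ℝ) : ℂ)) := by
  rw [SchwartzMap.fourierInv_coe, Real.fourierInv_eq']
  refine integral_congr_ae (Eventually.of_forall fun t => ?_)
  simp only [testSchwartz_apply, smul_eq_mul]
  rw [mul_comm]
  congr 2
  simp
  ring

theorem integral_testSchwartz_smul_fourierInv (G : Lp ℂ 2 (volume : Measure ℝ)) {α : ℝ → ℝ}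
    (hα : ContDiff ℝ ∞ α) (hc : HasCompactSupport α) :
    ∫ t, α t • (𝓕⁻ G : Lp ℂ 2 (volume : Measure ℝ)) t =
      ∫ y, (∫ t : ℝ, (α t : ℂ) * cexp (I * t * ((2 * Real.pi * y : ℝ) : ℂ))) * G y := by
  have h := congrArg (fun T => T (testSchwartz hα hc)) (Lp.fourierInv_toTemperedDistribution_eq G)
  simp only [TemperedDistribution.fourierInv_apply, Lp.toTemperedDistribution_apply,
    fourierInv_testSchwartz, testSchwartz_apply, smul_eq_mul] at h
  rw [h]
  exact integral_congr_ae (Eventually.of_forall fun t => by simp)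

/-- If the Fourier transform of `G ∈ L²` against test functions outside `[a, b]` vanishes, then `G`
is the transform of a function supported in `[a, b]`. -/
theorem exists_fourierHat_eq_of_integral_eq_zero {F : ℝ → ℂ} (hF : MemLp F 2) {a b : ℝ}
    (hb : ∀ α : ℝ → ℝ, ContDiff ℝ ∞ α → HasCompactSupport α → tsupport α ⊆ Ioi b →
      ∫ x : ℝ, F x * ∫ t : ℝ, (α t : ℂ) * cexp (I * t * x) = 0)
    (ha : ∀ α : ℝ → ℝ, ContDiff ℝ ∞ α → HasCompactSupport α → tsupport α ⊆ Iio a →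
      ∫ x : ℝ, F x * ∫ t : ℝ, (α t : ℂ) * cexp (I * t * x) = 0) :
    ∃ ψ : ℝ → ℂ, MemLp ψ 2 ∧ Integrable ψ ∧ (∀ t ∉ Icc a b, ψ t = 0) ∧
      ∀ᵐ x, fourierHat ψ x = F x := by
  have hpi : (2 * Real.pi) ≠ 0 := by have := Real.pi_pos; positivity
  have hG := hF.comp_const_mul hpi
  set G : Lp ℂ 2 (volume : Measure ℝ) := hG.toLp _ with hGdef
  set f : Lp ℂ 2 (volume : Measure ℝ) := 𝓕⁻ G with hf
  have hfL : MemLp f 2 := Lp.memLp f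
  have hfl : LocallyIntegrable f := hfL.locallyIntegrable (by norm_num)
  have htest : ∀ α : ℝ → ℝ, ContDiff ℝ ∞ α → HasCompactSupport α →
      ∫ x : ℝ, F x * ∫ t : ℝ, (α t : ℂ) * cexp (I * t * x) = 0 → ∫ t, α t • f t = 0 := by
    intro α hα hc h0
    rw [integral_testSchwartz_smul_fourierInv G hα hc]
    have h1 : ∫ y, (∫ t : ℝ, (α t : ℂ) * cexp (I * t * ((2 * Real.pi * y : ℝ) : ℂ))) * G y =
        ∫ y : ℝ, (fun x : ℝ => F x * ∫ t : ℝ, (α t : ℂ) * cexp (I * t * x)) (2 * Real.pi * y) := by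
      refine integral_congr_ae ?_
      filter_upwards [hG.coeFn_toLp] with y hy
      rw [hGdef, hy, mul_comm]
    rw [h1]
    exact (Measure.integral_comp_mul_left (fun x : ℝ =>
      F x * ∫ t : ℝ, (α t : ℂ) * cexp (I * t * x)) (2 * Real.pi)).trans (by rw [h0, smul_zero])
  have hout : ∀ᵐ t, t ∉ Icc a b → f t = 0 := by
    have h1 := isOpen_Ioi.ae_eq_zero_of_integral_contDiff_smul_eq_zero (U := Ioi b)
      (hfl.locallyIntegrableOn _) fun α h h' h'' => htest α h h' (hb α h h' h'')
    have h2 := isOpen_Iio.ae_eq_zero_of_integral_contDiff_smul_eq_zero (U := Iio a)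
      (hfl.locallyIntegrableOn _) fun α h h' h'' => htest α h h' (ha α h h' h'')
    filter_upwards [h1, h2] with t h1 h2 ht
    rw [mem_Icc, not_and_or, not_le, not_le] at ht
    exact ht.elim h2 h1
  set ψ : ℝ → ℂ := (Icc a b).indicator f with hψ
  have hψf : ψ =ᵐ[volume] f := by
    filter_upwards [hout] with t ht
    by_cases h : t ∈ Icc a b
    · simp [hψ, h]
    · simp [hψ, h, ht h]
  have hψi : Integrable ψ := by
    rw [hψ, integrable_indicator_iff measurableSet_Icc]
    exact (hfL.restrict (Icc a b)).integrable (by norm_num)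
  have hcont : Continuous (𝓕 ψ) :=
    VectorFourier.fourierIntegral_continuous Real.continuous_fourierChar (by fun_prop) hψi
  -- The L² transform is known only as a distribution. Testing it against smooth functions
  -- identifies it with the continuous function given by the Fourier integral.
  have hae : ∀ᵐ y, 𝓕 ψ y = F (2 * Real.pi * y) := by
    refine ae_eq_of_integral_contDiff_smul_eq hcont.locallyIntegrable
      (hG.locallyIntegrable (by norm_num)) fun α hα hc => ?_
    have h := congrArg (fun T => T (testSchwartz hα hc)) (Lp.fourier_toTemperedDistribution_eq f)
    simp only [TemperedDistribution.fourier_apply, Lp.toTemperedDistribution_apply,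
      testSchwartz_apply, smul_eq_mul] at h
    have h2 : (𝓕 f : Lp ℂ 2 (volume : Measure ℝ)) = G := FourierTransform.fourier_fourierInv_eq G
    rw [h2] at h
    have hflip : ∫ ξ, 𝓕 (testSchwartz hα hc : ℝ → ℂ) ξ • ψ ξ =
        ∫ x, (testSchwartz hα hc) x • 𝓕 ψ x := by
      simpa using! VectorFourier.integral_fourierIntegral_smul_eq_flip (L := innerₗ ℝ)
        Real.continuous_fourierChar continuous_inner (testSchwartz hα hc).integrable hψi
    calc ∫ x, α x • 𝓕 ψ x = ∫ x, (testSchwartz hα hc) x • 𝓕 ψ x :=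
          integral_congr_ae (Eventually.of_forall fun t => by simp [testSchwartz_apply])
      _ = ∫ ξ, 𝓕 (testSchwartz hα hc : ℝ → ℂ) ξ • ψ ξ := hflip.symm
      _ = ∫ ξ, (𝓕 (testSchwartz hα hc)) ξ * f ξ := by
          refine integral_congr_ae ?_
          filter_upwards [hψf] with ξ hξ
          rw [hξ, SchwartzMap.fourier_coe, smul_eq_mul]
      _ = ∫ x, (α x : ℂ) * G x := h
      _ = _ := by
          refine integral_congr_ae ?_
          filter_upwards [hG.coeFn_toLp] with y hy
          rw [hGdef, hy, real_smul]
  refine ⟨ψ, (memLp_congr_ae hψf).2 hfL, hψi, fun t ht => by simp [hψ, ht], ?_⟩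
  filter_upwards [(quasiMeasurePreserving_const_mul (inv_ne_zero hpi)).ae hae] with x hx
  rw [fourierHat, div_eq_inv_mul, hx, mul_inv_cancel_left₀ hpi]

/-! ### Building blocks of exponential type with polynomial decay. -/

/-- The entire function `(e^{iaz} - 1) / (iaz)`. -/
noncomputable def expQuot (a : ℝ) (z : ℂ) : ℂ := dslope cexp 0 (I * a * z)

theorem differentiable_expQuot (a : ℝ) : Differentiable ℂ (expQuot a) := by
  have h : Differentiable ℂ (dslope cexp 0) := by
    rw [← differentiableOn_univ, Complex.differentiableOn_dslope univ_mem]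
    exact differentiable_exp.differentiableOn
  exact h.comp (by fun_prop : Differentiable ℂ fun z : ℂ => I * a * z)

theorem mul_expQuot (a : ℝ) (z : ℂ) : I * a * z * expQuot a z = cexp (I * a * z) - 1 := by
  have := sub_smul_dslope cexp 0 (I * a * z)
  simpa [expQuot] using this

theorem norm_expQuot_mul_le {a : ℝ} (ha : 0 < a) {z : ℂ} (hz : 0 ≤ z.im) :
    ‖expQuot a z‖ * (a * ‖z‖) ≤ 2 := by
  have h := congrArg norm (mul_expQuot a z)
  rw [norm_mul, norm_mul, norm_mul, norm_I, one_mul, norm_real, Real.norm_of_nonneg ha.le] at h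
  rw [mul_comm, h]
  refine (norm_sub_le _ _).trans ?_
  have : ‖cexp (I * a * z)‖ ≤ 1 := by
    rw [norm_exp, Real.exp_le_one_iff]
    simpa using mul_nonneg ha.le hz
  rw [norm_one]
  linarith

/-- The reverse triangle inequality: above the real axis |exp(iaz)| < 1, so the function has no
zeros there. -/
theorem le_norm_expQuot_mul {a : ℝ} (ha : 0 < a) (z : ℂ) :
    1 - Real.exp (-(a * z.im)) ≤ ‖expQuot a z‖ * (a * ‖z‖) := by
  have h := congrArg norm (mul_expQuot a z)
  rw [norm_mul, norm_mul, norm_mul, norm_I, one_mul, norm_real, Real.norm_of_nonneg ha.le] at h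
  rw [mul_comm ‖expQuot a z‖, h, norm_sub_rev]
  have h1 := norm_sub_norm_le (1 : ℂ) (cexp (I * a * z))
  have h2 : ‖cexp (I * a * z)‖ = Real.exp (-(a * z.im)) := by
    rw [norm_exp]
    simp
  rwa [h2, norm_one] at h1

/-- On ℝ the function is exp(iax/2) times the real function sin(ax/2)/(ax/2), so conjugation only
changes the phase. -/
theorem conj_expQuot_mul (a x : ℝ) :
    (starRingEnd ℂ) (expQuot a x) * cexp (I * a * x) = expQuot a x := by
  rcases eq_or_ne (a * x) 0 with h | h
  · have h' : I * (a : ℂ) * x = 0 := by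
      rw [mul_assoc, ← ofReal_mul, h]
      simp
    simp [expQuot, h']
  · have h' : I * (a : ℂ) * x ≠ 0 := by
      rw [mul_assoc, ← ofReal_mul]
      exact mul_ne_zero I_ne_zero (ofReal_ne_zero.2 h)
    have h1 := mul_expQuot a x
    have h2 := congrArg (starRingEnd ℂ) h1
    simp only [map_mul, map_sub, map_one, conj_I, conj_ofReal, ← exp_conj] at h2
    refine mul_left_cancel₀ h' ?_
    rw [h1]
    have h3 : cexp (-I * a * x) * cexp (I * a * x) = 1 := by
      rw [← Complex.exp_add]
      ring_nf
      simp
    linear_combination (-cexp (I * a * x)) * h2 - h3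

theorem upperBounded_expQuot {a : ℝ} (ha : 0 < a) : UpperBounded (expQuot a) := by
  refine UpperBounded.of_norm_le (R := 1) (C := 2 / a)
    (fun z _ => (differentiable_expQuot a).differentiableAt) fun z hz hR => ?_
  rw [le_div_iff₀ ha]
  refine le_trans ?_ (norm_expQuot_mul_le ha hz)
  exact mul_le_mul_of_nonneg_left (le_mul_of_one_le_right ha.le hR) (norm_nonneg _)

theorem upperDecay_expQuot_sq {a : ℝ} (ha : 0 < a) : UpperDecay fun z => expQuot a z ^ 2 := by
  refine UpperDecay.of_norm_le (R := 0) (C := (2 / a) ^ 2)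
    (fun z _ => (differentiable_expQuot a).differentiableAt.pow 2) fun z hz _ => ?_
  rw [norm_pow, ← mul_pow]
  refine pow_le_pow_left₀ (by positivity) ?_ 2
  rw [le_div_iff₀ ha]
  refine le_of_eq_of_le ?_ (norm_expQuot_mul_le ha hz)
  ring

theorem conj_expQuot_pow_mul (a x : ℝ) (n : ℕ) :
    (starRingEnd ℂ) (expQuot a x ^ n) * cexp (I * (n * a : ℝ) * x) = expQuot a x ^ n := by
  have h : cexp (I * (n * a : ℝ) * x) = cexp (I * a * x) ^ n := by
    rw [← Complex.exp_nat_mul]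
    push_cast
    ring_nf
  rw [h, map_pow, ← mul_pow, conj_expQuot_mul]

theorem fourierHat_exp_mul (ψ : ℝ → ℂ) (η x : ℝ) :
    fourierHat (fun t => (Real.exp (η * t) : ℂ) * ψ t) x =
      ∫ t : ℝ, ψ t * cexp (-(I * t * (x + η * I))) := by
  rw [fourierHat_eq_integral]
  refine integral_congr_ae (Eventually.of_forall fun t => ?_)
  simp only [ofReal_exp]
  rw [← mul_assoc, ← Complex.exp_add, mul_comm]
  congr 2
  push_cast
  linear_combination ((t : ℂ) * η) * I_mul_I

/-- The Poisson extension of `e^{isx}` times the transform of a function supported in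
`(-∞, s]`. -/
theorem integral_poissonKer_mul_fourierHat {ψ : ℝ → ℂ} (hψ : Integrable ψ) {s : ℝ}
    (hs : ∀ t, s < t → ψ t = 0) {z : ℂ} (hz : 0 < z.im) :
    ∫ x : ℝ, (poissonKer z x : ℂ) * (cexp (I * s * x) * fourierHat ψ x) =
      cexp (I * s * z) * ∫ t : ℝ, ψ t * cexp (-(I * t * z)) := by
  have h1 : ∀ x : ℝ, (poissonKer z x : ℂ) * (cexp (I * s * x) * fourierHat ψ x) =
      ∫ t : ℝ, (poissonKer z x : ℂ) * (cexp (I * (s - t : ℝ) * x) * ψ t) := by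
    intro x
    rw [fourierHat_eq_integral, ← integral_const_mul, ← integral_const_mul]
    refine integral_congr_ae (Eventually.of_forall fun t => ?_)
    simp only
    rw [← mul_assoc (cexp (I * s * x)), ← Complex.exp_add]
    congr 3
    push_cast
    ring
  simp only [h1]
  have hint : Integrable (fun q : ℝ × ℝ =>
      (poissonKer z q.1 : ℂ) * (cexp (I * (s - q.2 : ℝ) * q.1) * ψ q.2))
      (volume.prod volume) := by
    have h2 : Integrable (fun q : ℝ × ℝ => (poissonKer z q.1 : ℂ) * ψ q.2)
        (volume.prod volume) := (integrable_poissonKer hz).ofReal.mul_prod hψ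
    have h3 : Continuous fun q : ℝ × ℝ => cexp (I * (s - q.2 : ℝ) * q.1) := by fun_prop
    have h4 := h2.bdd_mul (c := 1) h3.aestronglyMeasurable
      (Eventually.of_forall fun q => (norm_cexp_I_mul_real _ _).le)
    refine h4.congr (Eventually.of_forall fun q => ?_)
    simp only
    ring
  rw [integral_integral_swap hint, ← integral_const_mul]
  refine integral_congr_ae (Eventually.of_forall fun t => ?_)
  simp only
  rcases lt_or_ge s t with h | h
  · simp [hs t h]
  · have h5 := integral_poissonKer_mul_upperBounded
      (UpperBounded.exp_I_mul (sub_nonneg.2 h)) hz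
    have h6 : cexp (I * (s - t : ℝ) * z) = cexp (I * s * z) * cexp (-(I * t * z)) := by
      rw [← Complex.exp_add]
      congr 1
      push_cast
      ring
    have h7 : ∀ x : ℝ, (poissonKer z x : ℂ) * (cexp (I * (s - t : ℝ) * x) * ψ t) =
        (poissonKer z x : ℂ) * cexp (I * (s - t : ℝ) * x) * ψ t := fun x => by ring
    simp only [h7]
    rw [integral_mul_const, h5, h6]
    ring

/-! ### The multiplier theorem. -/

/-- The reflection `z ↦ conj (W (conj z))`. -/
noncomputable def reflection (W : ℂ → ℂ) (z : ℂ) : ℂ := (starRingEnd ℂ) (W ((starRingEnd ℂ) z))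

theorem differentiable_reflection {W : ℂ → ℂ} (hW : Differentiable ℂ W) :
    Differentiable ℂ (reflection W) := fun _ =>
  (differentiableAt_conj_conj_iff (f := W)).2 (hW _)

theorem reflection_real (W : ℂ → ℂ) (x : ℝ) : reflection W x = (starRingEnd ℂ) (W x) := by
  simp [reflection]

theorem upperBounded_exp_neg {W : ℂ → ℂ} (hW : Differentiable ℂ W) {B : ℝ}
    (hB : ∀ z : ℂ, 0 ≤ z.im → ‖W z‖ ≤ B) : UpperBounded fun z => cexp (-W z) := by
  refine ⟨fun z _ => (hW z).neg.cexp, Real.exp B, fun z hz => ?_⟩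
  rw [norm_exp]
  refine Real.exp_le_exp.2 (((re_le_norm _).trans ?_).trans (hB z hz))
  rw [norm_neg]

section Multiplier

variable {W : ℂ → ℂ} {s η B : ℝ} {g : ℝ → ℂ}

/-- Boundary values whose transform is the multiplier. -/
noncomputable def multiplierBoundary (W : ℂ → ℂ) (s : ℝ) (g : ℝ → ℂ) (x : ℝ) : ℂ :=
  cexp (-(I * s * x)) * (cexp (-W x) * expQuot (s / 10) x ^ 10 * g x)

theorem memLp_multiplierBoundary (hs : 0 < s) (hW : Differentiable ℂ W)
    (hB : ∀ z : ℂ, 0 ≤ z.im → ‖W z‖ ≤ B) (hg : MemLp g 2) :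
    MemLp (multiplierBoundary W s g) 2 := by
  have hφ := (upperBounded_exp_neg hW hB).mul ((upperBounded_expQuot (div_pos hs (by norm_num :
    (0 : ℝ) < 10))).pow 10)
  obtain ⟨C, hC⟩ := hφ.bound
  have hc1 : Continuous fun x : ℝ => cexp (-(I * s * x)) * (cexp (-W x) * expQuot (s / 10) x ^ 10) := by
    have h1 := hW.continuous
    have h2 := (differentiable_expQuot (s / 10)).continuous
    have h3 : Continuous fun x : ℝ => W x := h1.comp continuous_ofReal
    have h4 : Continuous fun x : ℝ => expQuot (s / 10) x := h2.comp continuous_ofReal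
    exact (by fun_prop : Continuous fun x : ℝ => cexp (-(I * s * x))).mul
      ((continuous_exp.comp h3.neg).mul (h4.pow 10))
  refine (hg.const_mul (C : ℂ)).of_le (f := multiplierBoundary W s g) ?_
    (Eventually.of_forall fun x => ?_)
  · refine (hc1.aestronglyMeasurable.mul hg.1).congr (Eventually.of_forall fun x => ?_)
    simp only [multiplierBoundary, Pi.mul_apply]
    ring
  · have h1 : ‖cexp (-(I * s * x))‖ = 1 := by
      have := norm_cexp_I_mul_real (-s) x
      simpa using this
    rw [multiplierBoundary, norm_mul, h1, one_mul, norm_mul, norm_mul (C : ℂ)]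
    refine mul_le_mul_of_nonneg_right ((hC x (by simp)).trans ?_) (norm_nonneg _)
    simpa using le_abs_self C

theorem hasCompactSupport_comp_add_right {α : ℝ → ℝ} (hc : HasCompactSupport α) (s : ℝ) :
    HasCompactSupport fun t => α (t + s) :=
  hc.comp_homeomorph (Homeomorph.addRight s)

/-- Translating the test function by s cancels the factor exp(-isx). What remains is g times a
decaying holomorphic function, which g annihilates. -/
theorem multiplierBoundary_test_right (hs : 0 < s) (hW : Differentiable ℂ W)
    (hB : ∀ z : ℂ, 0 ≤ z.im → ‖W z‖ ≤ B)
    (hg1 : ∀ p, UpperDecay p → ∫ x : ℝ, g x * p x = 0) {α : ℝ → ℝ} (hα : ContDiff ℝ ∞ α)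
    (hc : HasCompactSupport α) (hsupp : tsupport α ⊆ Ioi s) :
    ∫ x : ℝ, multiplierBoundary W s g x * ∫ t : ℝ, (α t : ℂ) * cexp (I * t * x) = 0 := by
  have hφ := (upperBounded_exp_neg hW hB).mul ((upperBounded_expQuot (div_pos hs (by norm_num :
    (0 : ℝ) < 10))).pow 10)
  have hβ : UpperDecay fun z => ∫ t : ℝ, ((α (t + s) : ℝ) : ℂ) * cexp (I * t * z) := by
    refine upperDecay_integral_mul_cexp (β := fun t => α (t + s)) (hα.comp (by fun_prop))
      (hasCompactSupport_comp_add_right hc s) ?_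
    have h1 := tsupport_comp_eq_preimage α (Homeomorph.addRight s)
    intro t ht
    have h2 : t ∈ tsupport (α ∘ Homeomorph.addRight s) := ht
    rw [h1] at h2
    have h3 : s < t + s := hsupp h2
    simpa using h3
  rw [← hg1 _ (UpperDecay.bounded_mul hφ hβ)]
  refine integral_congr_ae (Eventually.of_forall fun x => ?_)
  simp only
  have h2 : ∫ t : ℝ, (α t : ℂ) * cexp (I * t * x) =
      cexp (I * s * x) * ∫ t : ℝ, ((α (t + s) : ℝ) : ℂ) * cexp (I * t * x) := by
    rw [← integral_add_right_eq_self (fun t : ℝ => (α t : ℂ) * cexp (I * t * x)) s,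
      ← integral_const_mul]
    refine integral_congr_ae (Eventually.of_forall fun t => ?_)
    simp only
    rw [mul_left_comm, ← Complex.exp_add]
    congr 2
    push_cast
    ring
  rw [h2, multiplierBoundary]
  have h3 : cexp (-(I * s * x)) * cexp (I * s * x) = 1 := by
    rw [← Complex.exp_add]
    simp
  linear_combination (cexp (-W x) * expQuot (s / 10) x ^ 10 * g x *
    ∫ t : ℝ, ((α (t + s) : ℝ) : ℂ) * cexp (I * t * x)) * h3

/-- After reflection and translation by 2s the integrand is g times the conjugate of an element of Θ
H²: on ℝ, conj Θ turns exp(-conj W) into exp(-W). -/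
theorem multiplierBoundary_test_left (hs : 0 < s) (hW : Differentiable ℂ W)
    (hB : ∀ z : ℂ, 0 ≤ z.im → ‖W z‖ ≤ B)
    (hg2 : ∀ q, UpperDecay q → ∫ x : ℝ, g x * (starRingEnd ℂ)
      (cexp (I * s * x) * (cexp (I * s * x) * cexp (W x - reflection W x)) * q x) = 0)
    {α : ℝ → ℝ} (hα : ContDiff ℝ ∞ α) (hc : HasCompactSupport α)
    (hsupp : tsupport α ⊆ Iio (-(2 * s))) :
    ∫ x : ℝ, multiplierBoundary W s g x * ∫ t : ℝ, (α t : ℂ) * cexp (I * t * x) = 0 := by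
  have hφ := (upperBounded_exp_neg hW hB).mul ((upperBounded_expQuot (div_pos hs (by norm_num :
    (0 : ℝ) < 10))).pow 10)
  have hβ : UpperDecay fun z => ∫ t : ℝ, ((α (-(t + 2 * s)) : ℝ) : ℂ) * cexp (I * t * z) := by
    refine upperDecay_integral_mul_cexp (β := fun t => α (-(t + 2 * s))) (hα.comp (by fun_prop))
      (hc.comp_homeomorph ((Homeomorph.addRight (2 * s)).trans (Homeomorph.neg ℝ))) ?_
    have h1 := tsupport_comp_eq_preimage α ((Homeomorph.addRight (2 * s)).trans (Homeomorph.neg ℝ))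
    intro t ht
    have h2 : t ∈ tsupport (α ∘ ((Homeomorph.addRight (2 * s)).trans (Homeomorph.neg ℝ))) := ht
    rw [h1] at h2
    have h3 : -(t + 2 * s) < -(2 * s) := hsupp h2
    simp only [mem_Ioi]
    linarith
  rw [← hg2 _ (UpperDecay.bounded_mul hφ hβ)]
  refine integral_congr_ae (Eventually.of_forall fun x => ?_)
  simp only
  have h2 : ∫ t : ℝ, (α t : ℂ) * cexp (I * t * x) = cexp (-(2 * (I * s * x))) *
      (starRingEnd ℂ) (∫ t : ℝ, ((α (-(t + 2 * s)) : ℝ) : ℂ) * cexp (I * t * x)) := by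
    rw [← integral_neg_eq_self (fun t : ℝ => (α t : ℂ) * cexp (I * t * x)),
      ← integral_add_right_eq_self
        (fun t : ℝ => (α (-t) : ℂ) * cexp (I * ((-t : ℝ) : ℂ) * x)) (2 * s), ← integral_conj,
      ← integral_const_mul]
    refine integral_congr_ae (Eventually.of_forall fun t => ?_)
    simp only [map_mul, conj_ofReal, ← exp_conj, conj_I]
    rw [mul_left_comm, ← Complex.exp_add]
    congr 2
    push_cast
    ring
  rw [h2, multiplierBoundary]
  -- Of the phase 3s, two units come from Θ and one from conjugating the tenth power, since 10 ·
  -- s/10 = s.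
  have h3 : cexp (-W x) * expQuot (s / 10) x ^ 10 * cexp (-(3 * (I * s * x))) =
      (starRingEnd ℂ) (cexp (I * s * x) * (cexp (I * s * x) * cexp (W x - reflection W x)) *
        (cexp (-W x) * expQuot (s / 10) x ^ 10)) := by
    have h4 := conj_expQuot_pow_mul (s / 10) x 10
    have h5 : ((10 : ℕ) : ℝ) * (s / 10) = s := by push_cast; ring
    rw [h5] at h4
    simp only [map_mul, map_sub, map_neg, ← exp_conj, conj_I, conj_ofReal, reflection_real,
      conj_conj]
    have h6 : cexp (-W x) * cexp (I * s * x) * cexp (-(3 * (I * s * x))) =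
        cexp (-I * s * x) * (cexp (-I * s * x) * cexp ((starRingEnd ℂ) (W x) - W x)) *
          cexp (-(starRingEnd ℂ) (W x)) := by
      simp only [← Complex.exp_add]
      congr 1
      ring
    simp only [map_pow] at h4 ⊢
    linear_combination ((starRingEnd ℂ) (expQuot (s / 10) x) ^ 10) * h6 -
      (cexp (-W x) * cexp (-(3 * (I * s * x)))) * h4
  have h7 : cexp (-(I * s * x)) * cexp (-(2 * (I * s * x))) = cexp (-(3 * (I * s * x))) := by
    rw [← Complex.exp_add]
    congr 1
    ring
  simp only [map_mul] at h3 ⊢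
  linear_combination (cexp (-W x) * expQuot (s / 10) x ^ 10 * g x *
    (starRingEnd ℂ) (∫ t : ℝ, ((α (-(t + 2 * s)) : ℝ) : ℂ) * cexp (I * t * x))) * h7 +
    (g x * (starRingEnd ℂ) (∫ t : ℝ, ((α (-(t + 2 * s)) : ℝ) : ℂ) * cexp (I * t * x))) * h3

/-- Multiplier theorem: if `exp (W - W^#)` grows slowly off the real axis, there is a compactly
supported function whose transform on `Im z = η` is `exp (-W)` times a bounded factor close to a
fixed one. -/
theorem exists_multiplier (hs : 0 < s) (hη : 0 < η) (hW : Differentiable ℂ W)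
    (hB : ∀ z : ℂ, -η ≤ z.im → ‖W z‖ ≤ B)
    (hgrow : ∀ x : ℝ, (W (x + η * I) - reflection W (x + η * I)).re ≤ s * η / 2)
    (hε : Real.exp (-(s * η / 2)) ≤ 1 / 2) :
    ∃ (ψ : ℝ → ℂ) (g : ℝ → ℂ), MemLp ψ 2 ∧ tsupport ψ ⊆ Icc (-(2 * s)) s ∧ MemLp g 2 ∧
      √(∫ x : ℝ, ‖expQuot (s / 2) x ^ 2 - g x‖ ^ 2) ≤
        2 * Real.exp (-(s * η / 2)) * √(∫ x : ℝ, ‖expQuot (s / 2) x ^ 2‖ ^ 2) ∧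
      ∀ x : ℝ, ‖fourierHat ψ x‖ = Real.exp (s * η) * (Real.exp (-(W (x + η * I)).re) *
        ‖expQuot (s / 10) (x + η * I)‖ ^ 10 *
        ‖∫ t : ℝ, (poissonKer (x + η * I) t : ℂ) * g t‖) := by
  have hB0 : ∀ z : ℂ, 0 ≤ z.im → ‖W z‖ ≤ B := fun z hz => hB z (by linarith)
  have hrefl := differentiable_reflection hW
  obtain ⟨g, hgL, hg1, hg2, hgU⟩ := exists_hardySpan_orthogonal
    (H := fun z => cexp (I * s * z) * cexp (W z - reflection W z))
    (upperDecay_expQuot_sq (half_pos hs)) (s := s) (η := η) (ε := Real.exp (-(s * η / 2)))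
    (B := Real.exp (B + B)) hs.le hη (Real.exp_pos _).le hε
    (fun z _ _ => by
      have h1 := hW z
      have h2 := hrefl z
      fun_prop)
    (fun z h0 h1 => by
      rw [norm_mul, ← one_mul (Real.exp (B + B))]
      refine mul_le_mul ?_ ?_ (norm_nonneg _) zero_le_one
      · rw [norm_exp, Real.exp_le_one_iff]
        simpa using mul_nonneg hs.le h0
      · rw [norm_exp]
        refine Real.exp_le_exp.2 ((re_le_norm _).trans ((norm_sub_le _ _).trans ?_))
        refine add_le_add (hB0 z h0) ?_
        -- The reflection evaluates W at conj z, with imaginary part as low as -η; this is why `hB`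
        -- extends below the real axis.
        rw [reflection, RCLike.norm_conj]
        exact hB _ (by simpa using h1))
    (fun x => by
      rw [← Complex.exp_add, norm_exp]
      refine Real.exp_le_exp.2 ?_
      have h1 : (I * s * (x + η * I)).re = -(s * η) := by simp
      rw [add_re, h1]
      linarith [hgrow x])
    (fun x => by
      rw [norm_mul, norm_cexp_I_mul_real, one_mul, reflection_real, norm_exp]
      simp)
    (fun x => by
      have := conj_expQuot_pow_mul (s / 2) x 2
      have h5 : ((2 : ℕ) : ℝ) * (s / 2) = s := by push_cast; ring
      rwa [h5] at this)
  obtain ⟨ψ₁, hψL, hψi, hψs, hψF⟩ := exists_fourierHat_eq_of_integral_eq_zero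
    (memLp_multiplierBoundary hs hW hB0 hgL) (a := -(2 * s)) (b := s)
    (fun α hα hc h => multiplierBoundary_test_right hs hW hB0 hg1 hα hc h)
    (fun α hα hc h => multiplierBoundary_test_left hs hW hB0 hg2 hα hc h)
  have hφ := (upperBounded_exp_neg hW hB0).mul ((upperBounded_expQuot (div_pos hs (by norm_num :
    (0 : ℝ) < 10))).pow 10)
  -- Multiplication by exp(ηt) evaluates the transform on Im z = η without enlarging the support.
  refine ⟨fun t => (Real.exp (η * t) : ℂ) * ψ₁ t, g, ?_, ?_, hgL, hgU, fun x => ?_⟩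
  · refine (hψL.const_mul (Real.exp (η * s) : ℂ)).of_le
      ((by fun_prop : Continuous fun t : ℝ => (Real.exp (η * t) : ℂ)).aestronglyMeasurable.mul hψL.1)
      (Eventually.of_forall fun t => ?_)
    by_cases ht : t ∈ Icc (-(2 * s)) s
    · rw [norm_mul, norm_mul]
      refine mul_le_mul_of_nonneg_right ?_ (norm_nonneg _)
      rw [norm_real, norm_real, Real.norm_of_nonneg (Real.exp_pos _).le,
        Real.norm_of_nonneg (Real.exp_pos _).le]
      exact Real.exp_le_exp.2 (mul_le_mul_of_nonneg_left ht.2 hη.le)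
    · simp [hψs t ht]
  · refine closure_minimal (fun t ht => ?_) isClosed_Icc
    by_contra h
    exact ht (by simp [hψs t h])
  · have him : 0 < ((x : ℂ) + η * I).im := by simpa
    rw [fourierHat_exp_mul]
    have h1 := integral_poissonKer_mul_fourierHat hψi (s := s)
      (fun t ht => hψs t fun h => absurd h.2 (not_le.2 ht)) him
    have h2 := integral_poissonKer_mul hφ (g := g)
      (fun p hp => hgL.integrable_mul_two hp.memLp_real) hg1 him (hgL.integrable_poissonKer_mul him)
    have h3 : ∫ t : ℝ, (poissonKer (x + η * I) t : ℂ) * (cexp (I * s * t) * fourierHat ψ₁ t) =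
        ∫ t : ℝ, (poissonKer (x + η * I) t : ℂ) *
          (cexp (-W t) * expQuot (s / 10) t ^ 10 * g t) := by
      refine integral_congr_ae ?_
      filter_upwards [hψF] with t ht
      rw [ht, multiplierBoundary, ← mul_assoc (cexp (I * s * t)), ← Complex.exp_add]
      simp
    rw [h1, h2] at h3
    have h4 := congrArg norm h3
    simp only [norm_mul, norm_pow] at h4
    have h5 : ‖cexp (I * s * (x + η * I))‖ = Real.exp (-(s * η)) := by
      rw [norm_exp]
      simp
    have h6 : ‖cexp (-W (x + η * I))‖ = Real.exp (-(W (x + η * I)).re) := by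
      rw [norm_exp, neg_re]
    rw [h5, h6, Real.exp_neg] at h4
    rw [inv_mul_eq_iff_eq_mul₀ (Real.exp_pos _).ne'] at h4
    exact h4

end Multiplier

/-- Exponential decay in η beats (η + 1)². Here (1 / (s(η+1)))² will be a lower bound for U at
height η near the origin, and the correction must be at most half of it. -/
theorem exists_height (s N : ℝ) (hs : 0 < s) (hN : 0 ≤ N) :
    ∃ η : ℝ, 1 ≤ η ∧ Real.exp (-(s * η / 2)) ≤ 1 / 2 ∧
      2 * Real.exp (-(s * η / 2)) * N ≤ 1 / 2 * (1 / (s * (η + 1))) ^ 2 := by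
  have hc : 0 < 1 / (16 * N * s ^ 2 + 1) := by positivity
  have h1 := (isLittleO_pow_exp_pos_mul_atTop 2 (half_pos hs)).bound hc
  have h2 := (isLittleO_pow_exp_pos_mul_atTop 1 (half_pos hs)).bound (by norm_num : (0:ℝ) < 1 / 2)
  obtain ⟨η, h1, h2, h3⟩ := (h1.and (h2.and (eventually_ge_atTop 1))).exists
  have he : Real.exp (-(s * η / 2)) * Real.exp (s / 2 * η) = 1 := by
    rw [← Real.exp_add]
    ring_nf
    simp
  have hp := Real.exp_pos (s / 2 * η)
  have hq := Real.exp_pos (-(s * η / 2))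
  rw [Real.norm_of_nonneg (by positivity), Real.norm_of_nonneg hp.le] at h1 h2
  refine ⟨η, h3, ?_, ?_⟩
  · have h4 : 1 ≤ 1 / 2 * Real.exp (s / 2 * η) := by linarith
    nlinarith
  · have h4 : η ^ 2 * Real.exp (-(s * η / 2)) ≤ 1 / (16 * N * s ^ 2 + 1) := by
      calc _ ≤ 1 / (16 * N * s ^ 2 + 1) * Real.exp (s / 2 * η) * Real.exp (-(s * η / 2)) := by gcongr
        _ = _ := by rw [mul_assoc, mul_comm (Real.exp (s / 2 * η)), he, mul_one]
    rw [le_div_iff₀ (by positivity)] at h4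
    have h5 : (η + 1) ^ 2 ≤ 4 * η ^ 2 := by nlinarith
    rw [div_pow, one_pow, mul_one_div, le_div_iff₀ (by positivity)]
    have h6 : 0 ≤ N * s ^ 2 * Real.exp (-(s * η / 2)) := by positivity
    nlinarith [mul_le_mul_of_nonneg_left h5 h6, mul_nonneg (sq_nonneg η) hq.le]

theorem norm_add_mul_I_le {x η : ℝ} (hx : |x| ≤ 1 / 2) (hη : 0 ≤ η) :
    ‖(x : ℂ) + η * I‖ ≤ η + 1 := by
  refine (norm_add_le _ _).trans ?_
  rw [norm_mul, norm_I, mul_one, norm_real, norm_real, Real.norm_eq_abs, Real.norm_of_nonneg hη]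
  linarith

theorem one_add_abs_le_two_mul_norm {x η : ℝ} (hη : 1 ≤ η) :
    1 + |x| ≤ 2 * ‖(x : ℂ) + η * I‖ := by
  have h1 := abs_re_le_norm ((x : ℂ) + η * I)
  have h2 := abs_im_le_norm ((x : ℂ) + η * I)
  simp only [add_re, ofReal_re, mul_re, I_re, mul_zero, ofReal_im, I_im, mul_one, sub_self,
    add_zero, add_im, mul_im, zero_add] at h1 h2
  rw [abs_of_nonneg (by linarith)] at h2
  linarith

/-- Uniform bounds in the multiplier theorem. -/
theorem exists_multiplier_bounds {s : ℝ} (hs : 0 < s) :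
    ∃ η A b : ℝ, 1 ≤ η ∧ 0 < A ∧ 0 < b ∧ ∀ (W : ℂ → ℂ) (B : ℝ), Differentiable ℂ W →
      (∀ z : ℂ, -η ≤ z.im → ‖W z‖ ≤ B) →
      (∀ x : ℝ, (W (x + η * I) - reflection W (x + η * I)).re ≤ s * η / 2) →
      ∃ ψ : ℝ → ℂ, MemLp ψ 2 ∧ tsupport ψ ⊆ Icc (-(2 * s)) s ∧
        (∀ x : ℝ, ‖fourierHat ψ x‖ ≤
          A * ((1 + |x|) ^ 10)⁻¹ * Real.exp (-(W (x + η * I)).re)) ∧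
        ∀ x : ℝ, |x| ≤ 1 / 2 → b * Real.exp (-(W (x + η * I)).re) ≤ ‖fourierHat ψ x‖ := by
  have hUd := upperDecay_expQuot_sq (half_pos hs)
  obtain ⟨C, hC⟩ := hUd.upperBounded.bound
  set N := √(∫ x : ℝ, ‖expQuot (s / 2) x ^ 2‖ ^ 2)
  obtain ⟨η, hη1, hη2, hη3⟩ := exists_height s N hs (Real.sqrt_nonneg _)
  have hη : 0 < η := by linarith
  have hC0 : 0 ≤ C := (norm_nonneg _).trans (hC 0 le_rfl)
  have hs10 : 0 < s / 10 := by positivity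
  have hqpos : 0 < 1 - Real.exp (-(s / 10 * η)) := by
    rw [sub_pos, Real.exp_lt_one_iff]
    have := mul_pos hs10 hη
    linarith
  refine ⟨η, Real.exp (s * η) * ((40 / s) ^ 10 * (C + 1 / 2 * (1 / (s * (η + 1))) ^ 2)),
    Real.exp (s * η) * (((1 - Real.exp (-(s / 10 * η))) / (s / 10 * (η + 1))) ^ 10 *
      (1 / 2 * (1 / (s * (η + 1))) ^ 2)), hη1, by positivity, by positivity,
    fun W B hW hB hgrow => ?_⟩
  obtain ⟨ψ, g, hψ, hψs, hg, hgU, hψF⟩ := exists_multiplier hs hη hW hB hgrow hη2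
  -- Poisson extension at height η is bounded from L² to sup norm by (πη)^(-1/2) ≤ 1, so closeness
  -- in L² becomes closeness at every point of the line.
  have hPois : ∀ x : ℝ, ‖expQuot (s / 2) (x + η * I) ^ 2 -
      ∫ t : ℝ, (poissonKer (x + η * I) t : ℂ) * g t‖ ≤ 1 / 2 * (1 / (s * (η + 1))) ^ 2 := by
    intro x
    have him : 0 < ((x : ℂ) + η * I).im := by simpa
    have h1 := norm_integral_poissonKer_mul_le (hUd.memLp_real.sub hg) him
    have h2 : ∫ t : ℝ, (poissonKer (x + η * I) t : ℂ) *
        ((fun t : ℝ => expQuot (s / 2) t ^ 2) - g) t = expQuot (s / 2) (x + η * I) ^ 2 -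
        ∫ t : ℝ, (poissonKer (x + η * I) t : ℂ) * g t := by
      simp only [Pi.sub_apply, mul_sub]
      rw [integral_sub (hUd.memLp_real.integrable_poissonKer_mul him)
        (hg.integrable_poissonKer_mul him),
        integral_poissonKer_mul_upperBounded hUd.upperBounded him]
    rw [h2] at h1
    refine h1.trans (le_trans ?_ ((hgU).trans hη3))
    simp only [Pi.sub_apply]
    refine mul_le_of_le_one_left (Real.sqrt_nonneg _) ?_
    rw [Real.sqrt_le_one]
    refine inv_le_one_of_one_le₀ ?_
    have h3 : ((x : ℂ) + η * I).im = η := by simp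
    rw [h3]
    nlinarith [Real.pi_gt_three]
  refine ⟨ψ, hψ, hψs, fun x => ?_, fun x hx => ?_⟩
  · have him : 0 ≤ ((x : ℂ) + η * I).im := by simpa using hη.le
    have h1 : ‖expQuot (s / 10) (x + η * I)‖ * (1 + |x|) ≤ 40 / s := by
      have h2 := norm_expQuot_mul_le hs10 him
      rw [le_div_iff₀ hs]
      calc _ ≤ ‖expQuot (s / 10) (x + η * I)‖ * (2 * ‖(x : ℂ) + η * I‖) * s := by
            gcongr; exact one_add_abs_le_two_mul_norm hη1
        _ = 20 * (‖expQuot (s / 10) (x + η * I)‖ * (s / 10 * ‖(x : ℂ) + η * I‖)) := by ring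
        _ ≤ 20 * 2 := by gcongr
        _ = 40 := by norm_num
    have h2 : ‖expQuot (s / 10) (x + η * I)‖ ^ 10 ≤ (40 / s) ^ 10 * ((1 + |x|) ^ 10)⁻¹ := by
      rw [← div_eq_mul_inv, ← div_pow]
      refine pow_le_pow_left₀ (norm_nonneg _) ?_ 10
      rwa [le_div_iff₀ (by positivity)]
    have h3 : ‖∫ t : ℝ, (poissonKer (x + η * I) t : ℂ) * g t‖ ≤
        C + 1 / 2 * (1 / (s * (η + 1))) ^ 2 := by
      have h4 := norm_sub_norm_le (∫ t : ℝ, (poissonKer (x + η * I) t : ℂ) * g t)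
        (expQuot (s / 2) (x + η * I) ^ 2)
      rw [norm_sub_rev] at h4
      have h5 := hC _ him
      linarith [hPois x]
    rw [hψF]
    calc _ ≤ Real.exp (s * η) * (Real.exp (-(W (x + η * I)).re) *
          ((40 / s) ^ 10 * ((1 + |x|) ^ 10)⁻¹) * (C + 1 / 2 * (1 / (s * (η + 1))) ^ 2)) := by
          gcongr
      _ = _ := by ring
  · have hz := norm_add_mul_I_le hx hη.le
    have h1 : (1 - Real.exp (-(s / 10 * η))) / (s / 10 * (η + 1)) ≤
        ‖expQuot (s / 10) (x + η * I)‖ := by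
      rw [div_le_iff₀ (by positivity)]
      have h2 := le_norm_expQuot_mul hs10 (x + η * I)
      simp only [add_im, ofReal_im, mul_im, ofReal_re, I_im, mul_one, I_re, mul_zero, add_zero,
        zero_add] at h2
      refine h2.trans ?_
      gcongr
    have h3 : 1 / (s * (η + 1)) ≤ ‖expQuot (s / 2) (x + η * I)‖ := by
      rw [div_le_iff₀ (by positivity)]
      have h2 := le_norm_expQuot_mul (half_pos hs) (x + η * I)
      simp only [add_im, ofReal_im, mul_im, ofReal_re, I_im, mul_one, I_re, mul_zero, add_zero,
        zero_add] at h2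
      have h4 : Real.exp (-(s / 2 * η)) ≤ 1 / 2 := by
        convert hη2 using 3
        ring
      have h5 : ‖expQuot (s / 2) (x + η * I)‖ * (s / 2 * ‖(x : ℂ) + η * I‖) ≤
        ‖expQuot (s / 2) (x + η * I)‖ * (s / 2 * (η + 1)) := by gcongr
      linarith
    have h4 : 1 / 2 * (1 / (s * (η + 1))) ^ 2 ≤
        ‖∫ t : ℝ, (poissonKer (x + η * I) t : ℂ) * g t‖ := by
      have h5 := norm_sub_norm_le (expQuot (s / 2) (x + η * I) ^ 2)
        (∫ t : ℝ, (poissonKer (x + η * I) t : ℂ) * g t)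
      rw [norm_pow] at h5
      have h6 := pow_le_pow_left₀ (by positivity) h3 2
      linarith [hPois x]
    rw [hψF]
    calc _ = Real.exp (s * η) * (Real.exp (-(W (x + η * I)).re) *
          ((1 - Real.exp (-(s / 10 * η))) / (s / 10 * (η + 1))) ^ 10 *
          (1 / 2 * (1 / (s * (η + 1))) ^ 2)) := by ring
      _ ≤ _ := by gcongr

/-! ### The Gaussian profile. -/

theorem integrable_exp_neg_sq_mul_exp (R : ℝ) :
    Integrable fun t : ℝ => Real.exp (-t ^ 2) * Real.exp (R * |t|) := by
  refine ((integrable_exp_neg_mul_sq (by norm_num : (0 : ℝ) < 1 / 2)).const_mul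
    (Real.exp (R ^ 2 / 2))).mono' (Continuous.aestronglyMeasurable (by fun_prop))
    (Eventually.of_forall fun t => ?_)
  rw [Real.norm_of_nonneg (by positivity), ← Real.exp_add, ← Real.exp_add]
  refine Real.exp_le_exp.2 ?_
  nlinarith [sq_nonneg (R - |t|), sq_abs t]

/-- The Gaussian on the positive half-line. -/
noncomputable def halfGauss (t : ℝ) : ℂ := (Ioi (0 : ℝ)).indicator (fun t => (Real.exp (-t ^ 2) : ℂ)) t

theorem aestronglyMeasurable_halfGauss : AEStronglyMeasurable halfGauss :=
  (Continuous.aestronglyMeasurable (by fun_prop)).indicator measurableSet_Ioi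

theorem norm_halfGauss_le (t : ℝ) : ‖halfGauss t‖ ≤ Real.exp (-t ^ 2) := by
  refine (norm_indicator_le_norm_self _ _).trans ?_
  rw [norm_real, Real.norm_of_nonneg (Real.exp_pos _).le]

theorem conj_halfGauss (t : ℝ) : (starRingEnd ℂ) (halfGauss t) = halfGauss t := by
  by_cases h : 0 < t
  · simp only [halfGauss, mem_Ioi, h, indicator_of_mem, conj_ofReal]
  · simp [halfGauss, h]

theorem integrable_halfGauss_mul_exp (R : ℝ) :
    Integrable fun t => ‖halfGauss t‖ * Real.exp (R * |t|) := by
  refine (integrable_exp_neg_sq_mul_exp R).mono'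
    (aestronglyMeasurable_halfGauss.norm.mul (Continuous.aestronglyMeasurable (by fun_prop)))
    (Eventually.of_forall fun t => ?_)
  rw [Real.norm_of_nonneg (by positivity)]
  exact mul_le_mul_of_nonneg_right (norm_halfGauss_le t) (Real.exp_pos _).le

/-- An entire function whose real part on `ℝ` is a Gaussian. -/
noncomputable def gaussProfile (z : ℂ) : ℂ := ∫ t : ℝ, halfGauss t * cexp (I * t * z)

theorem differentiable_gaussProfile : Differentiable ℂ gaussProfile :=
  differentiable_integral_mul_cexp aestronglyMeasurable_halfGauss integrable_halfGauss_mul_exp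

theorem integrable_halfGauss_mul_cexp (z : ℂ) :
    Integrable fun t : ℝ => halfGauss t * cexp (I * t * z) := by
  refine (integrable_halfGauss_mul_exp |z.im|).mono'
    (aestronglyMeasurable_halfGauss.mul (Continuous.aestronglyMeasurable (by fun_prop)))
    (Eventually.of_forall fun t => ?_)
  rw [norm_mul, norm_exp]
  refine mul_le_mul_of_nonneg_left (Real.exp_le_exp.2 ?_) (norm_nonneg _)
  have h : (I * t * z).re = -(t * z.im) := by simp
  rw [h, mul_comm |z.im|, ← abs_mul]
  exact neg_le_abs _

theorem norm_gaussProfile_le {Y : ℝ} {z : ℂ} (hz : -Y ≤ z.im) :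
    ‖gaussProfile z‖ ≤ ∫ t, ‖halfGauss t‖ * Real.exp (Y * |t|) := by
  refine norm_integral_le_of_norm_le (integrable_halfGauss_mul_exp Y)
    (Eventually.of_forall fun t => ?_)
  by_cases h : 0 < t
  · rw [norm_mul, norm_exp]
    refine mul_le_mul_of_nonneg_left (Real.exp_le_exp.2 ?_) (norm_nonneg _)
    have h1 : (I * t * z).re = -(t * z.im) := by simp
    rw [h1, abs_of_pos h]
    nlinarith
  · simp [halfGauss, h]

theorem reflection_gaussProfile (z : ℂ) :
    reflection gaussProfile z = ∫ t : ℝ, halfGauss t * cexp (-(I * t * z)) := by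
  rw [reflection, gaussProfile, ← integral_conj]
  refine integral_congr_ae (Eventually.of_forall fun t => ?_)
  simp only [map_mul, conj_halfGauss, ← exp_conj, conj_I, conj_ofReal, conj_conj]
  ring_nf

theorem integrable_halfGauss_mul_cexp_neg (z : ℂ) :
    Integrable fun t : ℝ => halfGauss t * cexp (-(I * t * z)) := by
  simpa using integrable_halfGauss_mul_cexp (-z)

/-- The two terms are the integrals over t > 0 and t < 0 that make up the Fourier integral of the
full Gaussian. -/
theorem gaussProfile_add_reflection (z : ℂ) :
    gaussProfile z + reflection gaussProfile z = (√Real.pi : ℝ) * cexp (-z ^ 2 / 4) := by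
  have h := fourierIntegral_gaussian (b := 1) (by simp) z
  have h1 : ((Real.pi : ℂ) / 1) ^ (1 / 2 : ℂ) = ((√Real.pi : ℝ) : ℂ) := by
    rw [div_one, Real.sqrt_eq_rpow, ofReal_cpow Real.pi_pos.le]
    simp
  rw [h1, mul_one] at h
  rw [← h, reflection_gaussProfile, gaussProfile,
    ← integral_neg_eq_self (fun t : ℝ => halfGauss t * cexp (-(I * t * z))),
    ← integral_add (integrable_halfGauss_mul_cexp z) (by
      simpa using (integrable_halfGauss_mul_cexp_neg z).comp_neg)]
  refine integral_congr_ae ?_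
  filter_upwards [Measure.ae_ne (volume : Measure ℝ) 0] with t ht
  rcases lt_or_gt_of_ne ht with h | h
  · simp [halfGauss, h, h.le, mul_comm, mul_left_comm]
  · simp [halfGauss, h, h.le, mul_comm, mul_left_comm]

theorem re_gaussProfile_real (x : ℝ) :
    (gaussProfile x).re = √Real.pi / 2 * Real.exp (-x ^ 2 / 4) := by
  have h := congrArg Complex.re (gaussProfile_add_reflection x)
  rw [reflection_real, add_re, conj_re, re_ofReal_mul] at h
  have h1 : (cexp (-(x : ℂ) ^ 2 / 4)).re = Real.exp (-x ^ 2 / 4) := by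
    rw [← exp_ofReal_re]
    congr 2
    push_cast
    ring
  rw [h1] at h
  linarith

theorem upperBounded_gaussProfile : UpperBounded gaussProfile :=
  ⟨fun _ _ => differentiable_gaussProfile.differentiableAt, _,
    fun z hz => norm_gaussProfile_le (Y := 0) (by simpa using hz)⟩

theorem integrable_poissonKer_mul_re_gaussProfile {z : ℂ} (hz : 0 < z.im) :
    Integrable fun t : ℝ => poissonKer z t * (√Real.pi / 2 * Real.exp (-t ^ 2 / 4)) := by
  refine ((integrable_poissonKer hz).mul_const (√Real.pi / 2)).mono'
    ((continuous_poissonKer hz).mul (by fun_prop)).aestronglyMeasurable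
    (Eventually.of_forall fun t => ?_)
  have hP := poissonKer_nonneg hz t
  rw [Real.norm_of_nonneg (by positivity)]
  refine mul_le_mul_of_nonneg_left (mul_le_of_le_one_right (by positivity) ?_) hP
  rw [Real.exp_le_one_iff]
  nlinarith [sq_nonneg t]

/-- Positivity and lower bounds off the axis are inherited from the Gaussian boundary values. -/
theorem re_gaussProfile_eq {z : ℂ} (hz : 0 < z.im) :
    (gaussProfile z).re = ∫ t : ℝ, poissonKer z t * (√Real.pi / 2 * Real.exp (-t ^ 2 / 4)) := by
  rw [← integral_poissonKer_mul_upperBounded upperBounded_gaussProfile hz]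
  have hi : Integrable fun t : ℝ => (poissonKer z t : ℂ) * gaussProfile t := by
    obtain ⟨C, hC⟩ := upperBounded_gaussProfile.bound
    refine (integrable_poissonKer hz).ofReal.mul_bdd (c := C)
      (differentiable_gaussProfile.continuous.comp continuous_ofReal).aestronglyMeasurable
      (Eventually.of_forall fun t => hC _ (by simp))
  have h := integral_re hi
  simp only [RCLike.re_to_complex] at h
  rw [← h]
  refine integral_congr_ae (Eventually.of_forall fun t => ?_)
  simp only [re_ofReal_mul, re_gaussProfile_real]

theorem re_gaussProfile_nonneg {z : ℂ} (hz : 0 < z.im) : 0 ≤ (gaussProfile z).re := by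
  rw [re_gaussProfile_eq hz]
  exact integral_nonneg fun t => mul_nonneg (poissonKer_nonneg hz t) (by positivity)

/-- On |t - x| ≤ y the kernel is at least 1/(2πy), hence has mass at least 1/π there, and |t| ≤ 2
gives a boundary value of at least √π/2 · exp(-1). -/
theorem exists_le_re_gaussProfile : ∃ c : ℝ, 0 < c ∧ ∀ x y : ℝ, |x| ≤ 1 → 0 < y → y ≤ 1 →
    c ≤ (gaussProfile (x + y * I)).re := by
  refine ⟨Real.pi⁻¹ * (√Real.pi / 2 * Real.exp (-1)), by have := Real.pi_pos; positivity,
    fun x y hx hy hy1 => ?_⟩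
  have hz : 0 < ((x : ℂ) + y * I).im := by simpa
  rw [re_gaussProfile_eq hz]
  have hpi := Real.pi_pos
  have hvol : (volume : Measure ℝ).real (Icc (x - y) (x + y)) = 2 * y := by
    rw [Real.volume_real_Icc_of_le (by linarith)]
    ring
  have h1 : ∫ t in Icc (x - y) (x + y), ((2 * Real.pi * y)⁻¹ * (√Real.pi / 2 * Real.exp (-1))) =
      Real.pi⁻¹ * (√Real.pi / 2 * Real.exp (-1)) := by
    rw [setIntegral_const, hvol, smul_eq_mul]
    field_simp
  rw [← h1]
  refine le_trans ?_ (setIntegral_le_integral (s := Icc (x - y) (x + y))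
    (integrable_poissonKer_mul_re_gaussProfile hz) (Eventually.of_forall fun t =>
      mul_nonneg (poissonKer_nonneg hz t) (by positivity)))
  refine setIntegral_mono_on (integrableOn_const (by simp)) (integrable_poissonKer_mul_re_gaussProfile hz).integrableOn
    measurableSet_Icc fun t ht => ?_
  have hty : (t - x) ^ 2 ≤ y ^ 2 := by
    rw [sq_le_sq, abs_of_pos hy, abs_le]
    exact ⟨by linarith [ht.1], by linarith [ht.2]⟩
  have ht2 : t ^ 2 ≤ 4 := by
    have := abs_le.1 hx
    nlinarith [ht.1, ht.2]
  refine mul_le_mul ?_ ?_ (by positivity) (poissonKer_nonneg hz t)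
  · rw [poissonKer, norm_ofReal_sub_sq]
    simp only [add_im, ofReal_im, mul_im, ofReal_re, I_im, mul_one, I_re, mul_zero, add_zero,
      zero_add, add_re, mul_re, sub_self]
    rw [div_mul_eq_mul_div, inv_eq_one_div, div_le_div_iff₀ (by positivity) hpi, ← div_eq_mul_inv,
      div_mul_eq_mul_div, le_div_iff₀ (by positivity)]
    nlinarith
  · gcongr
    linarith

/-! ### Quadratic decay of the growth term. -/

theorem Real.sinh_le_mul_exp (u : ℝ) : Real.sinh u ≤ u * Real.exp u := by
  have h1 := Real.add_one_le_exp (-(2 * u))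
  have h2 : Real.exp (-u) = Real.exp u * Real.exp (-(2 * u)) := by
    rw [← Real.exp_add]
    ring_nf
  rw [Real.sinh_eq, h2]
  have h3 := mul_le_mul_of_nonneg_left h1 (Real.exp_pos u).le
  linarith

theorem Real.cosh_le_exp {u : ℝ} (hu : 0 ≤ u) : Real.cosh u ≤ Real.exp u := by
  have : Real.exp (-u) ≤ Real.exp u := Real.exp_le_exp.2 (by linarith)
  rw [Real.cosh_eq]
  linarith

section CosineIntegral

variable {x y t : ℝ}

theorem exp_neg_sq_mul_sinh_le (ht : 0 ≤ t) (hy : 0 ≤ y) (hy1 : y ≤ 1) :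
    Real.sinh (y * t) ≤ y * (t * Real.exp t) := by
  have h1 := Real.sinh_le_mul_exp (y * t)
  have h2 : Real.exp (y * t) ≤ Real.exp t :=
    Real.exp_le_exp.2 (mul_le_of_le_one_left ht hy1)
  have h3 : y * t * Real.exp (y * t) ≤ y * t * Real.exp t :=
    mul_le_mul_of_nonneg_left h2 (mul_nonneg hy ht)
  linarith

theorem cosh_mul_le_exp (ht : 0 ≤ t) (hy : 0 ≤ y) (hy1 : y ≤ 1) :
    Real.cosh (y * t) ≤ Real.exp t :=
  (Real.cosh_le_exp (mul_nonneg hy ht)).trans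
    (Real.exp_le_exp.2 (mul_le_of_le_one_left ht hy1))

/-- One polynomial dominates those arising from f(t) = exp(-t²) sinh(yt), f' and f''. The constants
are 37 = 4·6 + 2·2 + 8 + 1, from tⁿ ≤ n! exp t, and exp(9/4), from 3t - t² ≤ 9/4. -/
theorem poly_mul_exp_le (ht : 0 ≤ t) :
    (4 * t ^ 3 + 2 * t ^ 2 + 8 * t + 1) * (Real.exp t * Real.exp (-t ^ 2)) ≤
      37 * Real.exp (9 / 4) * Real.exp (-t) := by
  have h1 : t ≤ Real.exp t := by linarith [Real.add_one_le_exp t]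
  have h2 : t ^ 2 ≤ 2 * Real.exp t := by
    have := Real.pow_div_factorial_le_exp t ht 2
    norm_num [Nat.factorial] at this
    linarith
  have h3 : t ^ 3 ≤ 6 * Real.exp t := by
    have := Real.pow_div_factorial_le_exp t ht 3
    norm_num [Nat.factorial] at this
    linarith
  have h4 : 1 ≤ Real.exp t := Real.one_le_exp ht
  have h5 : Real.exp t * (Real.exp t * Real.exp (-t ^ 2)) ≤ Real.exp (9 / 4) * Real.exp (-t) := by
    rw [← Real.exp_add, ← Real.exp_add, ← Real.exp_add]
    exact Real.exp_le_exp.2 (by nlinarith [sq_nonneg (t - 3 / 2)])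
  calc _ ≤ 37 * Real.exp t * (Real.exp t * Real.exp (-t ^ 2)) := by gcongr; linarith
    _ = 37 * (Real.exp t * (Real.exp t * Real.exp (-t ^ 2))) := by ring
    _ ≤ 37 * (Real.exp (9 / 4) * Real.exp (-t)) := by gcongr
    _ = _ := by ring

theorem abs_sinhGauss_le (ht : 0 ≤ t) (hy : 0 ≤ y) (hy1 : y ≤ 1) :
    |Real.exp (-t ^ 2) * Real.sinh (y * t)| ≤ y * (37 * Real.exp (9 / 4) * Real.exp (-t)) := by
  have h0 : 0 ≤ Real.sinh (y * t) := Real.sinh_nonneg_iff.2 (mul_nonneg hy ht)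
  rw [abs_of_nonneg (by positivity)]
  have h1 := exp_neg_sq_mul_sinh_le ht hy hy1
  calc _ ≤ Real.exp (-t ^ 2) * (y * (t * Real.exp t)) := by gcongr
    _ = y * (t * (Real.exp t * Real.exp (-t ^ 2))) := by ring
    _ ≤ y * ((4 * t ^ 3 + 2 * t ^ 2 + 8 * t + 1) * (Real.exp t * Real.exp (-t ^ 2))) := by
      gcongr
      nlinarith [pow_nonneg ht 3, sq_nonneg t]
    _ ≤ _ := mul_le_mul_of_nonneg_left (poly_mul_exp_le ht) hy

theorem abs_deriv_sinhGauss_le (ht : 0 ≤ t) (hy : 0 ≤ y) (hy1 : y ≤ 1) :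
    |Real.exp (-t ^ 2) * (y * Real.cosh (y * t) - 2 * t * Real.sinh (y * t))| ≤
      y * (37 * Real.exp (9 / 4) * Real.exp (-t)) := by
  have h0 : 0 ≤ Real.sinh (y * t) := Real.sinh_nonneg_iff.2 (mul_nonneg hy ht)
  have h1 := exp_neg_sq_mul_sinh_le ht hy hy1
  have h2 := cosh_mul_le_exp ht hy hy1
  have h3 := Real.cosh_pos (y * t)
  have h4 : |y * Real.cosh (y * t) - 2 * t * Real.sinh (y * t)| ≤
      y * ((2 * t ^ 2 + 1) * Real.exp t) := by
    refine (abs_sub _ _).trans ?_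
    rw [abs_of_nonneg (by positivity), abs_of_nonneg (by positivity)]
    calc _ ≤ y * Real.exp t + 2 * t * (y * (t * Real.exp t)) := by gcongr
      _ = _ := by ring
  rw [abs_mul, abs_of_pos (Real.exp_pos _)]
  calc _ ≤ Real.exp (-t ^ 2) * (y * ((2 * t ^ 2 + 1) * Real.exp t)) := by gcongr
    _ = y * ((2 * t ^ 2 + 1) * (Real.exp t * Real.exp (-t ^ 2))) := by ring
    _ ≤ y * ((4 * t ^ 3 + 2 * t ^ 2 + 8 * t + 1) * (Real.exp t * Real.exp (-t ^ 2))) := by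
      gcongr
      nlinarith [pow_nonneg ht 3]
    _ ≤ _ := mul_le_mul_of_nonneg_left (poly_mul_exp_le ht) hy

theorem abs_deriv_deriv_sinhGauss_le (ht : 0 ≤ t) (hy : 0 ≤ y) (hy1 : y ≤ 1) :
    |Real.exp (-t ^ 2) * ((y ^ 2 + 4 * t ^ 2 - 2) * Real.sinh (y * t) -
      4 * t * y * Real.cosh (y * t))| ≤ y * (37 * Real.exp (9 / 4) * Real.exp (-t)) := by
  have h0 : 0 ≤ Real.sinh (y * t) := Real.sinh_nonneg_iff.2 (mul_nonneg hy ht)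
  have h1 := exp_neg_sq_mul_sinh_le ht hy hy1
  have h2 := cosh_mul_le_exp ht hy hy1
  have h3 := Real.cosh_pos (y * t)
  have h5 : |y ^ 2 + 4 * t ^ 2 - 2| ≤ 4 * t ^ 2 + 2 := by
    rw [abs_le]
    constructor <;> nlinarith
  have h4 : |(y ^ 2 + 4 * t ^ 2 - 2) * Real.sinh (y * t) - 4 * t * y * Real.cosh (y * t)| ≤
      y * ((4 * t ^ 3 + 6 * t) * Real.exp t) := by
    refine (abs_sub _ _).trans ?_
    rw [abs_mul, abs_of_nonneg h0, abs_of_nonneg (by positivity : 0 ≤ 4 * t * y * Real.cosh (y * t))]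
    calc _ ≤ (4 * t ^ 2 + 2) * (y * (t * Real.exp t)) + 4 * t * y * Real.exp t := by gcongr
      _ = _ := by ring
  rw [abs_mul, abs_of_pos (Real.exp_pos _)]
  calc _ ≤ Real.exp (-t ^ 2) * (y * ((4 * t ^ 3 + 6 * t) * Real.exp t)) := by gcongr
    _ = y * ((4 * t ^ 3 + 6 * t) * (Real.exp t * Real.exp (-t ^ 2))) := by ring
    _ ≤ y * ((4 * t ^ 3 + 2 * t ^ 2 + 8 * t + 1) * (Real.exp t * Real.exp (-t ^ 2))) := by
      refine mul_le_mul_of_nonneg_left (mul_le_mul_of_nonneg_right ?_ (by positivity)) hy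
      nlinarith [sq_nonneg t]
    _ ≤ _ := mul_le_mul_of_nonneg_left (poly_mul_exp_le ht) hy

/-- With f(t) = exp(-t²) sinh(yt) the primitive is f' cos(xt) + x f sin(xt), whose derivative is
(f'' + x² f) cos(xt): two integrations by parts in one identity. -/
theorem hasDerivAt_sinhGauss_primitive (x y t : ℝ) : HasDerivAt
    (fun t => Real.exp (-t ^ 2) * (y * Real.cosh (y * t) - 2 * t * Real.sinh (y * t)) *
      Real.cos (x * t) + x * (Real.exp (-t ^ 2) * Real.sinh (y * t)) * Real.sin (x * t))
    (Real.exp (-t ^ 2) * ((y ^ 2 + 4 * t ^ 2 - 2) * Real.sinh (y * t) -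
      4 * t * y * Real.cosh (y * t)) * Real.cos (x * t) +
      x ^ 2 * (Real.exp (-t ^ 2) * Real.sinh (y * t) * Real.cos (x * t))) t := by
  have hE : HasDerivAt (fun t : ℝ => Real.exp (-t ^ 2)) (Real.exp (-t ^ 2) * (-(2 * t))) t := by
    have := ((hasDerivAt_id t).pow 2).neg.exp
    simpa using this
  have hyt : HasDerivAt (fun t : ℝ => y * t) y t := by
    simpa using (hasDerivAt_id t).const_mul y
  have hxt : HasDerivAt (fun t : ℝ => x * t) x t := by
    simpa using (hasDerivAt_id t).const_mul x
  have h2t : HasDerivAt (fun t : ℝ => 2 * t) 2 t := by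
    simpa using (hasDerivAt_id t).const_mul (2 : ℝ)
  have hS := hyt.sinh
  have hC := hyt.cosh
  have h1 := ((hE.mul ((hC.const_mul y).sub (h2t.mul hS))).mul hxt.cos).add
    (((hE.mul hS).const_mul x).mul hxt.sin)
  refine h1.congr_deriv ?_
  simp only [Pi.mul_apply, Pi.sub_apply]
  ring

theorem integrableOn_exp_neg_Ioi_const_mul (c : ℝ) :
    IntegrableOn (fun t : ℝ => c * Real.exp (-t)) (Ioi 0) :=
  (integrableOn_exp_neg_Ioi 0).const_mul c

theorem integrableOn_of_abs_le_exp_neg {f : ℝ → ℝ} (hf : Continuous f) {c : ℝ}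
    (hb : ∀ t, 0 ≤ t → |f t| ≤ c * Real.exp (-t)) : IntegrableOn f (Ioi 0) := by
  refine (integrableOn_exp_neg_Ioi_const_mul c).mono' hf.aestronglyMeasurable ?_
  filter_upwards [ae_restrict_mem measurableSet_Ioi] with t ht
  exact hb t (le_of_lt ht)

theorem abs_integral_Ioi_le_of_abs_le_exp_neg {f : ℝ → ℝ} {c : ℝ}
    (hb : ∀ t, 0 ≤ t → |f t| ≤ c * Real.exp (-t)) : |∫ t in Ioi (0 : ℝ), f t| ≤ c := by
  have h := norm_integral_le_of_norm_le (integrableOn_exp_neg_Ioi_const_mul c)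
    (f := f) (by
      filter_upwards [ae_restrict_mem measurableSet_Ioi] with t ht
      exact hb t (le_of_lt ht))
  rwa [integral_const_mul, integral_exp_neg_Ioi_zero, mul_one] at h

/-- Two integrations by parts give the factor x²; the boundary term is f'(0) = y, and f and f'' are
both O(y exp(-t)), so every contribution is linear in y. -/
theorem abs_integral_sinhGauss_mul_cos_le (x : ℝ) (hy : 0 ≤ y) (hy1 : y ≤ 1) :
    (1 + x ^ 2) * |∫ t in Ioi (0 : ℝ), Real.exp (-t ^ 2) * Real.sinh (y * t) * Real.cos (x * t)| ≤
      (1 + 74 * Real.exp (9 / 4)) * y := by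
  set K := y * (37 * Real.exp (9 / 4)) with hK
  have hK0 : 0 ≤ K := by positivity
  have hmulcos : ∀ (a θ c : ℝ), |a| ≤ c → |a * Real.cos θ| ≤ c := fun a θ c h => by
    rw [abs_mul]
    exact (mul_le_of_le_one_right (abs_nonneg _) (Real.abs_cos_le_one _)).trans h
  have hmulsin : ∀ (a θ c : ℝ), |a| ≤ c → |a * Real.sin θ| ≤ c := fun a θ c h => by
    rw [abs_mul]
    exact (mul_le_of_le_one_right (abs_nonneg _) (Real.abs_sin_le_one _)).trans h
  have b0 : ∀ t, 0 ≤ t → |Real.exp (-t ^ 2) * Real.sinh (y * t) * Real.cos (x * t)| ≤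
      K * Real.exp (-t) := fun t ht =>
    hmulcos _ _ _ ((abs_sinhGauss_le ht hy hy1).trans_eq (by rw [hK]; ring))
  have b2 : ∀ t, 0 ≤ t → |Real.exp (-t ^ 2) * ((y ^ 2 + 4 * t ^ 2 - 2) * Real.sinh (y * t) -
      4 * t * y * Real.cosh (y * t)) * Real.cos (x * t)| ≤ K * Real.exp (-t) := fun t ht =>
    hmulcos _ _ _ ((abs_deriv_deriv_sinhGauss_le ht hy hy1).trans_eq (by rw [hK]; ring))
  have i0 := integrableOn_of_abs_le_exp_neg (by fun_prop) b0
  have i2 := integrableOn_of_abs_le_exp_neg (by fun_prop) b2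
  have hlim : Tendsto (fun t => Real.exp (-t ^ 2) *
      (y * Real.cosh (y * t) - 2 * t * Real.sinh (y * t)) * Real.cos (x * t) +
      x * (Real.exp (-t ^ 2) * Real.sinh (y * t)) * Real.sin (x * t)) atTop (𝓝 0) := by
    have hl : Tendsto (fun t : ℝ => (K + |x| * K) * Real.exp (-t)) atTop (𝓝 0) := by
      simpa using (Real.tendsto_exp_neg_atTop_nhds_zero).const_mul (K + |x| * K)
    refine squeeze_zero_norm' ?_ hl
    filter_upwards [eventually_ge_atTop 0] with t ht
    rw [Real.norm_eq_abs, add_mul]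
    refine (abs_add_le _ _).trans (add_le_add ?_ ?_)
    · exact hmulcos _ _ _ ((abs_deriv_sinhGauss_le ht hy hy1).trans_eq (by rw [hK]; ring))
    · refine hmulsin _ _ _ ?_
      rw [abs_mul, mul_assoc]
      refine mul_le_mul_of_nonneg_left ?_ (abs_nonneg _)
      exact (abs_sinhGauss_le ht hy hy1).trans_eq (by rw [hK]; ring)
  have hFTC := integral_Ioi_of_hasDerivAt_of_tendsto'
    (fun t _ => hasDerivAt_sinhGauss_primitive x y t) (i2.add (i0.const_mul (x ^ 2))) hlim
  rw [integral_add i2 (i0.const_mul _), integral_const_mul] at hFTC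
  have a0 := abs_integral_Ioi_le_of_abs_le_exp_neg b0
  have a2 := abs_integral_Ioi_le_of_abs_le_exp_neg b2
  set J := ∫ t in Ioi (0 : ℝ), Real.exp (-t ^ 2) * Real.sinh (y * t) * Real.cos (x * t)
  simp only [ne_eq, OfNat.ofNat_ne_zero, not_false_eq_true, zero_pow, neg_zero, Real.exp_zero,
    mul_zero, Real.cosh_zero, mul_one, Real.sinh_zero, sub_zero, one_mul, Real.cos_zero,
    Real.sin_zero, add_zero, zero_sub] at hFTC
  have h1 : x ^ 2 * |J| = |x ^ 2 * J| := by rw [abs_mul, abs_of_nonneg (sq_nonneg x)]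
  have h2 : |x ^ 2 * J| ≤ K + y := by
    rw [eq_sub_of_add_eq' hFTC]
    refine (abs_sub _ _).trans ?_
    rw [abs_neg, abs_of_nonneg hy]
    linarith
  rw [add_mul, h1, one_mul]
  calc _ ≤ K + (K + y) := add_le_add a0 h2
    _ = _ := by rw [hK]; ring

end CosineIntegral

theorem re_gaussProfile_sub_reflection (x y : ℝ) :
    (gaussProfile (x + y * I) - reflection gaussProfile (x + y * I)).re =
      -2 * ∫ t in Ioi (0 : ℝ), Real.exp (-t ^ 2) * Real.sinh (y * t) * Real.cos (x * t) := by
  have hi := (integrable_halfGauss_mul_cexp (x + y * I)).sub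
    (integrable_halfGauss_mul_cexp_neg (x + y * I))
  rw [reflection_gaussProfile, gaussProfile, ← integral_sub (integrable_halfGauss_mul_cexp _)
    (integrable_halfGauss_mul_cexp_neg _)]
  have h := integral_re hi
  simp only [RCLike.re_to_complex, Pi.sub_apply] at h
  rw [← h, ← integral_const_mul, ← integral_indicator measurableSet_Ioi]
  refine integral_congr_ae (Eventually.of_forall fun t => ?_)
  by_cases ht : 0 < t
  · have h1 : I * t * (x + y * I) = ((-(y * t) : ℝ) : ℂ) + ((x * t : ℝ) : ℂ) * I := by
      push_cast
      linear_combination (t * y : ℂ) * I_mul_I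
    have h2 : -(I * t * (x + y * I)) = ((y * t : ℝ) : ℂ) + ((-(x * t) : ℝ) : ℂ) * I := by
      rw [h1]
      push_cast
      ring
    simp only [halfGauss, mem_Ioi, ht, indicator_of_mem]
    rw [h2, h1, sub_re, re_ofReal_mul, re_ofReal_mul, Complex.exp_add, Complex.exp_add,
      ← ofReal_exp, ← ofReal_exp, re_ofReal_mul, re_ofReal_mul, exp_ofReal_mul_I_re,
      exp_ofReal_mul_I_re, Real.cos_neg, Real.sinh_eq]
    ring
  · simp [halfGauss, ht]

/-- The imaginary part of the profile has derivative of quadratic decay. -/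
theorem exists_re_gaussProfile_sub_reflection_le : ∃ C : ℝ, 0 < C ∧ ∀ x y : ℝ, 0 ≤ y → y ≤ 1 →
    (gaussProfile (x + y * I) - reflection gaussProfile (x + y * I)).re ≤ C * y / (1 + x ^ 2) := by
  refine ⟨2 * (1 + 74 * Real.exp (9 / 4)), by positivity, fun x y hy hy1 => ?_⟩
  rw [re_gaussProfile_sub_reflection, le_div_iff₀ (by positivity)]
  have h := abs_integral_sinhGauss_mul_cos_le x hy hy1
  set J := ∫ t in Ioi (0 : ℝ), Real.exp (-t ^ 2) * Real.sinh (y * t) * Real.cos (x * t)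
  have h1 : -J ≤ |J| := neg_le_abs J
  have h2 : (1 + x ^ 2) * -J ≤ (1 + x ^ 2) * |J| := mul_le_mul_of_nonneg_left h1 (by positivity)
  linarith

/-- Half the sum of Γ + Γ^# and Γ - Γ^#: the first is an explicit Gaussian and the second has
quadratic tails of size y. -/
theorem exists_re_gaussProfile_le : ∃ C : ℝ, 0 < C ∧ ∀ x y : ℝ, 0 ≤ y → y ≤ 1 →
    (gaussProfile (x + y * I)).re ≤ C * (Real.exp (-x ^ 2 / 4) + y / (1 + x ^ 2)) := by
  obtain ⟨C, hC, hC'⟩ := exists_re_gaussProfile_sub_reflection_le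
  refine ⟨max C (√Real.pi * Real.exp 1), by positivity, fun x y hy hy1 => ?_⟩
  have h1 := hC' x y hy hy1
  have h2 := congrArg Complex.re (gaussProfile_add_reflection (x + y * I))
  have h3 : (cexp (-((x : ℂ) + y * I) ^ 2 / 4)).re ≤ Real.exp 1 * Real.exp (-x ^ 2 / 4) := by
    refine (re_le_norm _).trans ?_
    rw [norm_exp, ← Real.exp_add]
    refine Real.exp_le_exp.2 ?_
    have h4 : (-((x : ℂ) + y * I) ^ 2 / 4) =
        (((y ^ 2 - x ^ 2) / 4 : ℝ) : ℂ) + ((-(x * y) / 2 : ℝ) : ℂ) * I := by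
      push_cast
      linear_combination (-(y : ℂ) ^ 2 / 4) * I_mul_I
    rw [h4]
    simp only [add_re, ofReal_re, re_ofReal_mul, I_re, mul_zero, add_zero]
    nlinarith
  rw [add_re, re_ofReal_mul] at h2
  rw [sub_re] at h1
  have h5 : C * y / (1 + x ^ 2) ≤ max C (√Real.pi * Real.exp 1) * (y / (1 + x ^ 2)) := by
    rw [mul_div_assoc]
    gcongr
    exact le_max_left _ _
  have h6 : √Real.pi * (cexp (-((x : ℂ) + y * I) ^ 2 / 4)).re ≤
      max C (√Real.pi * Real.exp 1) * Real.exp (-x ^ 2 / 4) := by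
    calc _ ≤ √Real.pi * (Real.exp 1 * Real.exp (-x ^ 2 / 4)) := by gcongr
      _ = (√Real.pi * Real.exp 1) * Real.exp (-x ^ 2 / 4) := by ring
      _ ≤ _ := by gcongr; exact le_max_right _ _
  have h7 : 0 ≤ max C (√Real.pi * Real.exp 1) * (y / (1 + x ^ 2)) := by positivity
  have h8 : 0 ≤ max C (√Real.pi * Real.exp 1) * Real.exp (-x ^ 2 / 4) := by positivity
  linarith

/-! ### Superpositions of rescaled profiles. -/

section Family

variable {ι : Type*} (S : Finset ι) (ξ ℓ : ι → ℝ) (c : ℝ)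

/-- A superposition of rescaled profiles. -/
noncomputable def profileSum (z : ℂ) : ℂ :=
  ∑ i ∈ S, ((c * ℓ i : ℝ) : ℂ) * gaussProfile ((z - ξ i) / ℓ i)

theorem differentiable_profileSum : Differentiable ℂ (profileSum S ξ ℓ c) := by
  unfold profileSum
  refine Differentiable.fun_sum fun i _ => ?_
  refine Differentiable.const_mul (differentiable_gaussProfile.comp ?_) _
  fun_prop

theorem reflection_profileSum (z : ℂ) : reflection (profileSum S ξ ℓ c) z =
    ∑ i ∈ S, ((c * ℓ i : ℝ) : ℂ) * reflection gaussProfile ((z - ξ i) / ℓ i) := by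
  simp only [reflection, profileSum, map_sum, map_mul, conj_ofReal, map_div₀, map_sub]

theorem sub_div_eq_add_mul_I (x η a l : ℝ) :
    ((x : ℂ) + η * I - a) / l = (((x - a) / l : ℝ) : ℂ) + ((η / l : ℝ) : ℂ) * I := by
  push_cast
  ring

theorem re_profileSum (x η : ℝ) : (profileSum S ξ ℓ c (x + η * I)).re =
    ∑ i ∈ S, c * ℓ i *
      (gaussProfile ((((x - ξ i) / ℓ i : ℝ) : ℂ) + ((η / ℓ i : ℝ) : ℂ) * I)).re := by
  simp only [profileSum, re_sum, re_ofReal_mul, sub_div_eq_add_mul_I]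

theorem re_profileSum_sub_reflection (x η : ℝ) :
    (profileSum S ξ ℓ c (x + η * I) - reflection (profileSum S ξ ℓ c) (x + η * I)).re =
    ∑ i ∈ S, c * ℓ i *
      (gaussProfile ((((x - ξ i) / ℓ i : ℝ) : ℂ) + ((η / ℓ i : ℝ) : ℂ) * I) -
        reflection gaussProfile ((((x - ξ i) / ℓ i : ℝ) : ℂ) + ((η / ℓ i : ℝ) : ℂ) * I)).re := by
  rw [reflection_profileSum, profileSum, ← Finset.sum_sub_distrib, re_sum]
  simp only [← mul_sub, re_ofReal_mul, sub_div_eq_add_mul_I]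

theorem exists_norm_profileSum_le {η : ℝ} (hη : 0 < η) (hℓ : ∀ i ∈ S, η ≤ ℓ i) :
    ∃ B : ℝ, ∀ z : ℂ, -η ≤ z.im → ‖profileSum S ξ ℓ c z‖ ≤ B := by
  refine ⟨∑ i ∈ S, ‖((c * ℓ i : ℝ) : ℂ)‖ * ∫ t, ‖halfGauss t‖ * Real.exp (1 * |t|),
    fun z hz => (norm_sum_le _ _).trans (Finset.sum_le_sum fun i hi => ?_)⟩
  rw [norm_mul]
  refine mul_le_mul_of_nonneg_left (norm_gaussProfile_le ?_) (norm_nonneg _)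
  have hpos : 0 < ℓ i := hη.trans_le (hℓ i hi)
  have h1 : ((z - ξ i) / ℓ i).im = z.im / ℓ i := by
    rw [div_ofReal_im]
    simp
  rw [h1, le_div_iff₀ hpos]
  linarith [hℓ i hi]

end Family

/-- For a sparse finite family of intervals there is a compactly supported function whose
transform is exponentially small, in terms of their lengths, on all the intervals. -/
theorem exists_multiplier_of_family {s C₀ C₁ : ℝ} (hs : 0 < s) (hC₀ : 0 < C₀) :
    ∃ η A b κ : ℝ, 1 ≤ η ∧ 0 < A ∧ 0 < b ∧ 0 < κ ∧ ∀ {ι : Type} (S : Finset ι) (ξ ℓ : ι → ℝ),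
      (∀ i ∈ S, η ≤ ℓ i) →
      (∀ x : ℝ, ∑ i ∈ S, 1 / (1 + ((x - ξ i) / ℓ i) ^ 2) ≤ C₀) →
      (∀ x : ℝ, |x| ≤ 1 / 2 → ∑ i ∈ S, ℓ i * Real.exp (-((x - ξ i) / ℓ i) ^ 2 / 4) ≤ C₁) →
      ∃ ψ : ℝ → ℂ, MemLp ψ 2 ∧ tsupport ψ ⊆ Icc (-(2 * s)) s ∧
        (∀ x : ℝ, ‖fourierHat ψ x‖ ≤ A * ((1 + |x|) ^ 10)⁻¹) ∧
        (∀ x : ℝ, ∀ i ∈ S, |x - ξ i| ≤ ℓ i →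
          ‖fourierHat ψ x‖ ≤ A * ((1 + |x|) ^ 10)⁻¹ * Real.exp (-(κ * ℓ i))) ∧
        ∀ x : ℝ, |x| ≤ 1 / 2 → b ≤ ‖fourierHat ψ x‖ := by
  obtain ⟨η, A, b, hη, hA, hb, hmult⟩ := exists_multiplier_bounds hs
  obtain ⟨K, hK, hK'⟩ := exists_re_gaussProfile_sub_reflection_le
  obtain ⟨D, hD, hD'⟩ := exists_re_gaussProfile_le
  obtain ⟨e, he, he'⟩ := exists_le_re_gaussProfile
  -- The total growth c K η C₀ then equals the allowed sη/2. In each term the factor ℓ cancels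
  -- against the height η/ℓ seen by the rescaled profile.
  set c := s / (2 * K * C₀) with hc
  have hc0 : 0 < c := by positivity
  have hη0 : 0 < η := by linarith
  -- The exponent bounds Re W above |x| ≤ 1/2: C₁ accounts for the Gaussian parts and η C₀ for the
  -- quadratic tails.
  refine ⟨η, A, b * Real.exp (-(c * D * (C₁ + η * C₀))), c * e, hη, hA, by positivity,
    by positivity, fun {ι} S ξ ℓ hℓ hsum0 hsum1 => ?_⟩
  have hpos : ∀ i ∈ S, 0 < ℓ i := fun i hi => hη0.trans_le (hℓ i hi)
  have hy1 : ∀ i ∈ S, η / ℓ i ≤ 1 := fun i hi => (div_le_one (hpos i hi)).2 (hℓ i hi)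
  have hy0 : ∀ i ∈ S, 0 < η / ℓ i := fun i hi => div_pos hη0 (hpos i hi)
  obtain ⟨B, hB⟩ := exists_norm_profileSum_le S ξ ℓ c hη0 hℓ
  obtain ⟨ψ, hψ, hψs, hup, hlow⟩ := hmult (profileSum S ξ ℓ c) B
    (differentiable_profileSum S ξ ℓ c) hB (fun x => by
      rw [re_profileSum_sub_reflection]
      calc _ ≤ ∑ i ∈ S, c * K * η * (1 / (1 + ((x - ξ i) / ℓ i) ^ 2)) := by
            refine Finset.sum_le_sum fun i hi => ?_
            have h1 := hK' ((x - ξ i) / ℓ i) (η / ℓ i) (hy0 i hi).le (hy1 i hi)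
            have hl := hpos i hi
            refine (mul_le_mul_of_nonneg_left h1 (by positivity)).trans_eq ?_
            have : 0 < 1 + ((x - ξ i) / ℓ i) ^ 2 := by positivity
            generalize 1 + ((x - ξ i) / ℓ i) ^ 2 = q at *
            field_simp
        _ = c * K * η * ∑ i ∈ S, 1 / (1 + ((x - ξ i) / ℓ i) ^ 2) := by rw [Finset.mul_sum]
        _ ≤ c * K * η * C₀ := by
            refine mul_le_mul_of_nonneg_left (hsum0 x) (by positivity)
        _ = s * η / 2 := by
            rw [hc]
            field_simp)
  have hnonneg : ∀ x : ℝ, ∀ i ∈ S, 0 ≤ c * ℓ i *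
      (gaussProfile ((((x - ξ i) / ℓ i : ℝ) : ℂ) + ((η / ℓ i : ℝ) : ℂ) * I)).re := by
    intro x i hi
    have hl := hpos i hi
    refine mul_nonneg (by positivity) (re_gaussProfile_nonneg ?_)
    simpa using hy0 i hi
  refine ⟨ψ, hψ, hψs, fun x => ?_, fun x i hi hx => ?_, fun x hx => ?_⟩
  · refine (hup x).trans (mul_le_of_le_one_right (by positivity) ?_)
    rw [Real.exp_le_one_iff, neg_nonpos, re_profileSum]
    exact Finset.sum_nonneg (hnonneg x)
  · refine (hup x).trans (mul_le_mul_of_nonneg_left (Real.exp_le_exp.2 ?_) (by positivity))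
    rw [re_profileSum, neg_le_neg_iff]
    refine le_trans ?_ (Finset.single_le_sum (hnonneg x) hi)
    have hl := hpos i hi
    have h1 := he' ((x - ξ i) / ℓ i) (η / ℓ i) (by
      rwa [abs_div, abs_of_pos hl, div_le_one hl]) (hy0 i hi) (hy1 i hi)
    calc c * e * ℓ i = c * ℓ i * e := by ring
      _ ≤ _ := by gcongr
  · refine le_trans ?_ (hlow x hx)
    refine mul_le_mul_of_nonneg_left (Real.exp_le_exp.2 ?_) hb.le
    rw [re_profileSum, neg_le_neg_iff]
    calc _ ≤ ∑ i ∈ S, (c * D * (ℓ i * Real.exp (-((x - ξ i) / ℓ i) ^ 2 / 4)) +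
          c * D * η * (1 / (1 + ((x - ξ i) / ℓ i) ^ 2))) := by
          refine Finset.sum_le_sum fun i hi => ?_
          have h1 := hD' ((x - ξ i) / ℓ i) (η / ℓ i) (hy0 i hi).le (hy1 i hi)
          have hl := hpos i hi
          refine (mul_le_mul_of_nonneg_left h1 (by positivity)).trans_eq ?_
          have : 0 < 1 + ((x - ξ i) / ℓ i) ^ 2 := by positivity
          generalize 1 + ((x - ξ i) / ℓ i) ^ 2 = q at *
          field_simp
      _ = c * D * ∑ i ∈ S, ℓ i * Real.exp (-((x - ξ i) / ℓ i) ^ 2 / 4) +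
          c * D * η * ∑ i ∈ S, 1 / (1 + ((x - ξ i) / ℓ i) ^ 2) := by
          rw [Finset.sum_add_distrib, Finset.mul_sum, Finset.mul_sum]
      _ ≤ c * D * C₁ + c * D * η * C₀ := by
          gcongr
          · exact hsum1 x hx
          · exact hsum0 x
      _ = _ := by ring

/-! ### Covering a porous set by few cells. -/

theorem exists_nat_lt_mem_Icc {M : ℕ} (hM : 0 < M) {y : ℝ} (h0 : 0 ≤ y) (h1 : y ≤ M) :
    ∃ i < M, (i : ℝ) ≤ y ∧ y ≤ i + 1 := by
  rcases h1.eq_or_lt with h | h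
  · refine ⟨M - 1, by omega, ?_⟩
    rw [Nat.cast_pred hM]
    constructor <;> linarith
  · exact ⟨⌊y⌋₊, (Nat.floor_lt h0).2 h, Nat.floor_le h0, (Nat.lt_floor_add_one y).le⟩

/-- A set with a hole in every subdivision into `M` pieces meets few cells of an iterated
subdivision. -/
theorem exists_cover_of_holes {M : ℕ} (hM : 0 < M) {Z : Set ℝ} {L₀ L₁ : ℝ} (hL₀ : 0 < L₀)
    (hZ : ∀ a L : ℝ, L₀ ≤ L → L ≤ L₁ →
      ∃ i < M, Disjoint (Icc (a + i * (L / M)) (a + (i + 1) * (L / M))) Z) (j : ℕ) :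
    ∀ a L : ℝ, L₀ * M ^ j ≤ L → L ≤ L₁ → ∃ T : Finset ℕ, T ⊆ Finset.range (M ^ j) ∧
      T.card ≤ (M - 1) ^ j ∧ ∀ z ∈ Z, a ≤ z → z ≤ a + L →
        ∃ i ∈ T, a + i * (L / M ^ j) ≤ z ∧ z ≤ a + (i + 1) * (L / M ^ j) := by
  have hMr : (0 : ℝ) < M := by exact_mod_cast hM
  have hM1 : (1 : ℝ) ≤ M := by exact_mod_cast hM
  induction j with
  | zero =>
    intro a L _ _
    exact ⟨{0}, by simp, by simp, fun z _ h1 h2 => ⟨0, by simp, by simpa using h1, by simpa using h2⟩⟩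
  | succ j ih =>
    intro a L hL0 hL1
    have hL : 0 < L := lt_of_lt_of_le (by positivity) hL0
    have hstep : L₀ * M ^ j ≤ L / M := by
      rw [le_div_iff₀ hMr]
      calc _ = L₀ * M ^ (j + 1) := by ring
        _ ≤ L := hL0
    have hstep1 : L / M ≤ L₁ := (div_le_self hL.le hM1).trans hL1
    obtain ⟨i₀, hi₀, hdisj⟩ := hZ a L ((le_mul_of_one_le_right hL₀.le (one_le_pow₀ hM1)).trans hL0) hL1
    choose T hTr hTc hT using fun i : ℕ => ih (a + i * (L / M)) (L / M) hstep hstep1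
    -- Cell m inside child i is cell i M^j + m of the refined subdivision; the empty child i₀ is
    -- dropped.
    refine ⟨((Finset.range M).erase i₀).biUnion fun i => (T i).image fun m => i * M ^ j + m,
      ?_, ?_, ?_⟩
    · intro n hn
      simp only [Finset.mem_biUnion, Finset.mem_erase, Finset.mem_range, Finset.mem_image] at hn
      obtain ⟨i, ⟨-, hi⟩, m, hm, rfl⟩ := hn
      have h1 := Finset.mem_range.1 (hTr i hm)
      rw [Finset.mem_range, pow_succ']
      calc i * M ^ j + m < i * M ^ j + M ^ j := by omega
        _ = (i + 1) * M ^ j := by ring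
        _ ≤ M * M ^ j := Nat.mul_le_mul_right _ hi
    · refine Finset.card_biUnion_le.trans ?_
      calc _ ≤ ∑ _i ∈ (Finset.range M).erase i₀, (M - 1) ^ j :=
            Finset.sum_le_sum fun i _ => Finset.card_image_le.trans (hTc i)
        _ = (M - 1) ^ (j + 1) := by
            rw [Finset.sum_const, Finset.card_erase_of_mem (Finset.mem_range.2 hi₀),
              Finset.card_range, smul_eq_mul, pow_succ']
    · intro z hz h1 h2
      obtain ⟨i, hi, hi1, hi2⟩ := exists_nat_lt_mem_Icc hM (y := (z - a) / (L / M))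
        (div_nonneg (by linarith) (by positivity)) (by
          rw [div_le_iff₀ (by positivity)]
          field_simp
          linarith)
      rw [le_div_iff₀ (by positivity)] at hi1
      rw [div_le_iff₀ (by positivity)] at hi2
      have hne : i ≠ i₀ := by
        rintro rfl
        exact disjoint_left.1 hdisj ⟨by linarith, by linarith⟩ hz
      obtain ⟨m, hm, hm1, hm2⟩ := hT i z hz (by linarith) (by linarith)
      refine ⟨i * M ^ j + m, ?_, ?_⟩
      · simp only [Finset.mem_biUnion, Finset.mem_erase, Finset.mem_range, Finset.mem_image]
        exact ⟨i, ⟨hne, hi⟩, m, hm, rfl⟩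
      · have h3 : L / M / M ^ j = L / (M : ℝ) ^ (j + 1) := by
          rw [div_div, pow_succ']
        have h4 : L / M = M ^ j * (L / (M : ℝ) ^ (j + 1)) := by
          rw [← h3]
          field_simp
        rw [h3, h4] at hm1 hm2
        push_cast
        constructor <;> nlinarith

/-- The rescaled and thickened porous set has a hole in every subdivision. -/
theorem IsPorous.exists_hole_thickened {ν h : ℝ} {Y : Set ℝ} (hY : IsPorous ν h 1 Y) (hν : 0 < ν)
    (hν1 : ν < 1) (hh : 0 < h) {M : ℕ} (hM : 12 / ν ≤ M) (a L : ℝ) (hL0 : 16 / ν ≤ L)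
    (hL1 : L ≤ 2 / h) :
    ∃ i < M, Disjoint (Icc (a + i * (L / M)) (a + (i + 1) * (L / M)))
      (h⁻¹ • Y + Icc (-2 : ℝ) 2) := by
  have hMr : (0 : ℝ) < M := lt_of_lt_of_le (by positivity) hM
  have h16 : 16 ≤ ν * L := by rwa [div_le_iff₀' hν] at hL0
  have hL : 0 < L := lt_of_lt_of_le (by positivity) hL0
  have hL16 : 16 ≤ L := by nlinarith
  rw [le_div_iff₀ hh] at hL1
  -- Porosity is applied to the left half of the interval only, so that lengths up to 2/h, beyond
  -- the rescaled range 1/h, are allowed.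
  obtain ⟨c, d, hc, hd, hcd, hdisj⟩ := hY.exists_hole (h * a) (h * a + h * L / 2) (by nlinarith)
    (by linarith)
  have hc' : a ≤ c / h := by rw [le_div_iff₀ hh]; linarith
  have hd' : d / h ≤ a + L / 2 := by rw [div_le_iff₀ hh]; linarith
  have hcd' : d / h - c / h = ν * L / 2 := by
    rw [← sub_div, hcd]
    field_simp
    ring
  have hLM : 2 * (L / M) ≤ ν * L / 6 := by
    rw [div_le_iff₀ hν] at hM
    rw [mul_div_assoc', div_le_div_iff₀ hMr (by norm_num)]
    nlinarith
  have hLM0 : 0 < L / M := by positivity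
  -- The rescaled hole has length νL/2. Thickening costs 4 ≤ νL/4 and two cells take at most νL/6,
  -- so the first cell starting beyond c/h + 2 still fits.
  set p := (c / h + 2 - a) / (L / M) with hp
  have hp0 : 0 ≤ p := div_nonneg (by linarith) hLM0.le
  have hpm : p * (L / M) = c / h + 2 - a := div_mul_cancel₀ _ hLM0.ne'
  have hf1 := Nat.lt_floor_add_one p
  have hf2 := Nat.floor_le hp0
  have hi1 : c / h + 2 < a + ((⌊p⌋₊ + 1 : ℕ) : ℝ) * (L / M) := by
    push_cast
    nlinarith
  have hi2 : a + (((⌊p⌋₊ + 1 : ℕ) : ℝ) + 1) * (L / M) < d / h - 2 := by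
    push_cast
    nlinarith
  refine ⟨⌊p⌋₊ + 1, ?_, ?_⟩
  · have h1 : (((⌊p⌋₊ + 1 : ℕ) : ℝ) + 1) * (L / M) < L := by linarith
    have h2 : (((⌊p⌋₊ + 1 : ℕ) : ℝ) + 1) * L < M * L := by
      rw [mul_div_assoc', div_lt_iff₀ hMr] at h1
      linarith
    have h3 := lt_of_mul_lt_mul_right h2 hL.le
    have h4 : ((⌊p⌋₊ + 1 : ℕ) : ℝ) < M := by linarith
    exact_mod_cast h4
  · refine disjoint_left.2 fun z hz hzY => ?_
    obtain ⟨w, hw, t, ht, rfl⟩ := mem_add.1 hzY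
    obtain ⟨y, hy, rfl⟩ := mem_smul_set.1 hw
    rw [smul_eq_mul, inv_mul_eq_div] at hz
    refine disjoint_left.1 hdisj ⟨?_, ?_⟩ hy
    · have : c / h < y / h := by linarith [hz.1, ht.2]
      exact (div_lt_div_iff_of_pos_right hh).1 this
    · have : y / h < d / h := by linarith [hz.2, ht.1]
      exact (div_lt_div_iff_of_pos_right hh).1 this

/-! ### Lattice sums and the choice of subdivision depth. -/

theorem inv_one_add_sq_le_arctan (a : ℝ) :
    1 / (1 + a ^ 2) ≤ 3 * (Real.arctan (a + 1) - Real.arctan a) := by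
  obtain ⟨b, hb, hb'⟩ := exists_deriv_eq_slope Real.arctan (lt_add_one a)
    Real.continuous_arctan.continuousOn Real.differentiable_arctan.differentiableOn
  rw [Real.deriv_arctan, add_sub_cancel_left, div_one] at hb'
  rw [← hb', mul_one_div, div_le_div_iff₀ (by positivity) (by positivity)]
  have h1 : b ^ 2 ≤ 2 * a ^ 2 + 2 := by
    have := hb.1
    have := hb.2
    nlinarith [sq_nonneg (b - a), sq_nonneg (b - 2 * a)]
  nlinarith

/-- Comparison with increments of arctan, which telescope to at most π. -/
theorem sum_inv_one_add_sq_le (T : Finset ℕ) (y : ℝ) :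
    ∑ i ∈ T, 1 / (1 + (y - i) ^ 2) ≤ 3 * Real.pi := by
  obtain ⟨N, hN⟩ := T.exists_nat_subset_range
  have h0 : ∀ i : ℕ, 1 / (1 + (y - i) ^ 2) ≤
      3 * (Real.arctan (((i + 1 : ℕ) : ℝ) - y) - Real.arctan (i - y)) := fun i => by
    have h := inv_one_add_sq_le_arctan (i - y)
    have h1 : (y - i) ^ 2 = ((i : ℝ) - y) ^ 2 := by ring
    have h2 : ((i + 1 : ℕ) : ℝ) - y = i - y + 1 := by push_cast; ring
    rwa [h1, h2]
  calc _ ≤ ∑ i ∈ Finset.range N, 1 / (1 + (y - i) ^ 2) :=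
        Finset.sum_le_sum_of_subset_of_nonneg hN fun i _ _ => by positivity
    _ ≤ ∑ i ∈ Finset.range N,
        3 * (Real.arctan (((i + 1 : ℕ) : ℝ) - y) - Real.arctan (i - y)) :=
        Finset.sum_le_sum fun i _ => h0 i
    _ = 3 * (Real.arctan (N - y) - Real.arctan ((0 : ℕ) - y)) := by
        rw [← Finset.mul_sum, Finset.sum_range_sub (fun i : ℕ => Real.arctan ((i : ℝ) - y))]
    _ ≤ 3 * Real.pi := by
        have h1 := Real.arctan_lt_pi_div_two (N - y)
        have h2 := Real.neg_pi_div_two_lt_arctan (((0 : ℕ) : ℝ) - y)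
        generalize Real.arctan (((0 : ℕ) : ℝ) - y) = u at *
        linarith

/-- Only boundedly many dyadic scales are comparable with a given number. -/
theorem card_filter_dyadic_le (s : Finset ℕ) (x : ℝ) :
    (s.filter fun k => (2 : ℝ) ^ k / 2 < x ∧ x < 4 * 2 ^ k).card ≤ 4 := by
  set F := s.filter fun k => (2 : ℝ) ^ k / 2 < x ∧ x < 4 * 2 ^ k
  rcases F.eq_empty_or_nonempty with h | h
  · simp [h]
  · have hm := (Finset.mem_filter.1 (F.min'_mem h)).2
    have hsub : F ⊆ Finset.Icc (F.min' h) (F.min' h + 3) := by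
      intro k hk
      have hk2 := (Finset.mem_filter.1 hk).2
      refine Finset.mem_Icc.2 ⟨F.min'_le k hk, ?_⟩
      by_contra hlt
      have h1 : (2 : ℝ) ^ (F.min' h + 4) ≤ 2 ^ k := pow_le_pow_right₀ (by norm_num) (by omega)
      rw [pow_add] at h1
      have := hm.2
      have := hk2.1
      norm_num at h1
      have : (0 : ℝ) < 2 ^ (F.min' h) := by positivity
      linarith
    refine (Finset.card_le_card hsub).trans ?_
    rw [Nat.card_Icc]
    omega

theorem summable_two_pow_mul_exp_neg {c p : ℝ} (hc : 0 < c) (hp : 1 < p) :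
    Summable fun k : ℕ => (2 : ℝ) ^ k * Real.exp (-(c * (k : ℝ) ^ p)) := by
  have hgeo : Summable fun k : ℕ => Real.exp (-(k : ℝ)) := by
    simpa using Real.summable_exp_neg_nat
  refine Summable.of_norm_bounded_eventually_nat hgeo ?_
  have ht := ((tendsto_rpow_atTop (sub_pos.2 hp)).comp
    tendsto_natCast_atTop_atTop).eventually_ge_atTop (2 / c)
  filter_upwards [ht, eventually_ge_atTop 1] with k hk hk1
  have hk0 : (0 : ℝ) < k := by exact_mod_cast hk1
  have h1 : 2 * (k : ℝ) ≤ c * (k : ℝ) ^ p := by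
    simp only [Function.comp_apply] at hk
    rw [div_le_iff₀' hc] at hk
    have h2 : (k : ℝ) ^ p = (k : ℝ) ^ (p - 1) * k := by
      rw [← Real.rpow_add_one hk0.ne', sub_add_cancel]
    rw [h2, ← mul_assoc]
    gcongr
  have h3 : (2 : ℝ) ^ k ≤ Real.exp k := by
    rw [← Real.exp_one_pow]
    exact pow_le_pow_left₀ (by norm_num) (by linarith [Real.add_one_le_exp (1 : ℝ)]) k
  rw [Real.norm_of_nonneg (by positivity)]
  calc _ ≤ Real.exp k * Real.exp (-(2 * k)) := by gcongr
    _ = Real.exp (-k) := by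
        rw [← Real.exp_add]
        congr 1
        ring

/-- The dyadic scale `k` is subdivided `j k` times, where `M ^ j k` is comparable to a power of
`k`. -/
theorem exists_subdivision_depth {M : ℕ} (hM : 2 ≤ M) :
    ∃ δ : ℝ, 0 < δ ∧ δ < 1 ∧ ∃ j : ℕ → ℕ, (∀ k, 1 ≤ k → (M : ℝ) ^ j k ≤ (k : ℝ) ^ δ) ∧
      Summable (fun k => (((M : ℝ) - 1) / M ^ 2) ^ j k) ∧
      Summable fun k => (2 : ℝ) ^ k * Real.exp (-((M : ℝ) ^ j k) ^ 2 / 16) := by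
  have hM2 : (2 : ℝ) ≤ M := by exact_mod_cast hM
  have hM0 : (0 : ℝ) < M := by linarith
  have hlog : 0 < Real.log M := Real.log_pos (by linarith)
  set r : ℝ := ((M : ℝ) - 1) / M ^ 2 with hr
  have hr0 : 0 < r := div_pos (by linarith) (by positivity)
  -- This strict inequality is the gain from porosity: it makes β > 1 and so leaves room for δ < 1.
  have hrM : r < (M : ℝ)⁻¹ := by
    rw [hr, div_lt_iff₀ (by positivity)]
    field_simp
    linarith
  set β := -Real.log r / Real.log M with hβ
  have hβ1 : 1 < β := by
    rw [hβ, one_lt_div hlog]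
    have := Real.log_lt_log hr0 hrM
    rw [Real.log_inv] at this
    linarith
  have hrβ : r = (M : ℝ) ^ (-β) := by
    rw [Real.rpow_def_of_pos hM0, hβ, show Real.log M * -(-Real.log r / Real.log M) = Real.log r by
      field_simp, Real.exp_log hr0]
  -- δ > 1/β gives the first series, with terms O(k^(-δβ)); δ > 1/2 gives the second, since k^(2δ)
  -- outgrows k.
  obtain ⟨δ, hδ1, hδ⟩ := exists_between (max_lt (inv_lt_one_of_one_lt₀ hβ1)
    (by norm_num : (1 / 2 : ℝ) < 1))
  have hδ2 : 1 / 2 < δ := (le_max_right _ _).trans_lt hδ1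
  have hδ0 : 0 < δ := by linarith
  have hδβ : 1 < δ * β := by
    have h1 := (le_max_left _ _).trans_lt hδ1
    rwa [inv_lt_iff_one_lt_mul₀ (by linarith)] at h1
  have hex : ∀ k : ℕ, ∃ m : ℕ, 1 ≤ k → (M : ℝ) ^ m ≤ (k : ℝ) ^ δ ∧ (k : ℝ) ^ δ < M ^ (m + 1) := by
    intro k
    by_cases hk : 1 ≤ k
    · obtain ⟨m, hm⟩ := exists_nat_pow_near (Real.one_le_rpow (by exact_mod_cast hk) hδ0.le :
        1 ≤ (k : ℝ) ^ δ) (by linarith : (1 : ℝ) < M)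
      exact ⟨m, fun _ => hm⟩
    · exact ⟨0, fun h => absurd h hk⟩
  choose j hj using hex
  have hlow : ∀ k : ℕ, 1 ≤ k → (k : ℝ) ^ δ / M ≤ (M : ℝ) ^ j k := fun k hk => by
    rw [div_le_iff₀ hM0, ← pow_succ]
    exact (hj k hk).2.le
  refine ⟨δ, hδ0, hδ, j, fun k hk => (hj k hk).1, ?_, ?_⟩
  · refine Summable.of_norm_bounded_eventually_nat
      (g := fun k : ℕ => (M : ℝ) ^ β * (k : ℝ) ^ (-(δ * β)))
      ((Real.summable_nat_rpow.2 (by linarith)).mul_left _) ?_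
    filter_upwards [eventually_ge_atTop 1] with k hk
    have hk0 : (0 : ℝ) < k := by exact_mod_cast hk
    rw [Real.norm_of_nonneg (by positivity)]
    calc r ^ j k = ((M : ℝ) ^ j k) ^ (-β) := by
          rw [hrβ, ← Real.rpow_mul_natCast hM0.le, ← Real.rpow_natCast_mul hM0.le, mul_comm]
      _ ≤ ((k : ℝ) ^ δ / M) ^ (-β) :=
          Real.rpow_le_rpow_of_nonpos (by positivity) (hlow k hk) (by linarith)
      _ = _ := by
          rw [Real.div_rpow (by positivity) hM0.le, ← Real.rpow_mul hk0.le, Real.rpow_neg hM0.le,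
            div_inv_eq_mul, mul_comm, mul_neg]
  · refine Summable.of_norm_bounded_eventually_nat (summable_two_pow_mul_exp_neg
      (c := 1 / (16 * M ^ 2)) (p := 2 * δ) (by positivity) (by linarith)) ?_
    filter_upwards [eventually_ge_atTop 1] with k hk
    have hk0 : (0 : ℝ) < k := by exact_mod_cast hk
    rw [Real.norm_of_nonneg (by positivity)]
    refine mul_le_mul_of_nonneg_left (Real.exp_le_exp.2 ?_) (by positivity)
    have h1 : (k : ℝ) ^ (2 * δ) = ((k : ℝ) ^ δ) ^ 2 := by
      rw [← Real.rpow_mul_natCast hk0.le, mul_comm]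
      norm_num
    have h2 : ((k : ℝ) ^ δ / M) ^ 2 ≤ ((M : ℝ) ^ j k) ^ 2 :=
      pow_le_pow_left₀ (by positivity) (hlow k hk) 2
    rw [h1, show -(1 / (16 * (M : ℝ) ^ 2) * ((k : ℝ) ^ δ) ^ 2) = -((k : ℝ) ^ δ / M) ^ 2 / 16 by
      field_simp]
    linarith

section DyadicCells

variable {M m k : ℕ} {T : Finset ℕ}

theorem dyadicCell_mem_Icc (hM : 0 < M) (hT : T ⊆ Finset.range (M ^ m)) {i : ℕ} (hi : i ∈ T) :
    (2 : ℝ) ^ k + i * ((2 : ℝ) ^ k / M ^ m) ∈ Icc ((2 : ℝ) ^ k) (2 * 2 ^ k) := by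
  have hMr : (0 : ℝ) < M := by exact_mod_cast hM
  have hi' : (i : ℝ) ≤ (M : ℝ) ^ m := by exact_mod_cast (Finset.mem_range.1 (hT hi)).le
  constructor
  · have : 0 ≤ (i : ℝ) * ((2 : ℝ) ^ k / M ^ m) := by positivity
    linarith
  · have : (i : ℝ) * ((2 : ℝ) ^ k / M ^ m) ≤ (M : ℝ) ^ m * ((2 : ℝ) ^ k / M ^ m) := by gcongr
    rw [mul_div_cancel₀ _ (by positivity)] at this
    linarith

theorem sq_div_dyadicCell_ge (hM : 0 < M) {y : ℝ} (hy : (2 : ℝ) ^ k / 2 ≤ |y|) :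
    ((M : ℝ) ^ m) ^ 2 / 4 ≤ (y / ((2 : ℝ) ^ k / M ^ m)) ^ 2 := by
  have hMr : (0 : ℝ) < M := by exact_mod_cast hM
  have h1 : (M : ℝ) ^ m / 2 ≤ |y / ((2 : ℝ) ^ k / M ^ m)| := by
    rw [abs_div, abs_of_pos (by positivity : (0 : ℝ) < (2 : ℝ) ^ k / M ^ m), le_div_iff₀
      (by positivity)]
    calc _ = (2 : ℝ) ^ k / 2 := by field_simp
      _ ≤ _ := hy
  rw [← sq_abs (y / _)]
  calc _ = ((M : ℝ) ^ m / 2) ^ 2 := by ring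
    _ ≤ _ := pow_le_pow_left₀ (by positivity) h1 2

/-- Near the block the centres form part of a lattice whose step is the cell length, so the lattice
sum applies. Elsewhere x is at least M^m / 2 cell lengths from every centre, and the count (M-1)^m
decides. -/
theorem sum_dyadicCells_inv_le (hM : 0 < M) (hT : T ⊆ Finset.range (M ^ m))
    (hc : T.card ≤ (M - 1) ^ m) (x : ℝ) :
    ∑ i ∈ T, 1 / (1 + ((x - ((2 : ℝ) ^ k + i * ((2 : ℝ) ^ k / M ^ m))) /
      ((2 : ℝ) ^ k / M ^ m)) ^ 2) ≤ 4 * (((M : ℝ) - 1) / M ^ 2) ^ m +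
        if (2 : ℝ) ^ k / 2 < x ∧ x < 4 * 2 ^ k then 3 * Real.pi else 0 := by
  have hMr : (0 : ℝ) < M := by exact_mod_cast hM
  have hM1 : (0 : ℝ) ≤ (M : ℝ) - 1 := sub_nonneg.2 (by exact_mod_cast hM)
  have hl : (0 : ℝ) < (2 : ℝ) ^ k / M ^ m := by positivity
  split_ifs with hx
  · have h1 := sum_inv_one_add_sq_le T ((x - 2 ^ k) / ((2 : ℝ) ^ k / M ^ m))
    have h2 : 0 ≤ 4 * (((M : ℝ) - 1) / M ^ 2) ^ m := by positivity
    refine le_trans (le_of_eq (Finset.sum_congr rfl fun i _ => ?_)) (h1.trans (by linarith))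
    rw [← sub_sub, sub_div _ ((i : ℝ) * _), mul_div_cancel_right₀ _ hl.ne']
  · have hcr : (T.card : ℝ) ≤ ((M : ℝ) - 1) ^ m := by
      rw [← Nat.cast_pred hM]
      exact_mod_cast hc
    calc _ ≤ ∑ _i ∈ T, 4 / ((M : ℝ) ^ m) ^ 2 := by
          refine Finset.sum_le_sum fun i hi => ?_
          have h1 := dyadicCell_mem_Icc (k := k) hM hT hi
          have h2 : (2 : ℝ) ^ k / 2 ≤ |x - ((2 : ℝ) ^ k + i * ((2 : ℝ) ^ k / M ^ m))| := by
            have h0 : (0 : ℝ) < 2 ^ k := by positivity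
            rcases not_and_or.1 hx with h | h
            · rw [abs_sub_comm]
              exact le_trans (by linarith [h1.1]) (le_abs_self _)
            · exact le_trans (by linarith [h1.2]) (le_abs_self _)
          have h3 := sq_div_dyadicCell_ge (m := m) hM h2
          rw [div_le_div_iff₀ (by positivity) (by positivity)]
          linarith
      _ = T.card * (4 / ((M : ℝ) ^ m) ^ 2) := by rw [Finset.sum_const, nsmul_eq_mul]
      _ ≤ ((M : ℝ) - 1) ^ m * (4 / ((M : ℝ) ^ m) ^ 2) := by gcongr
      _ = _ := by
          rw [div_pow, add_zero, ← pow_mul, ← pow_mul, mul_comm m 2]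
          ring

/-- Points with |x| ≤ 1/2 are at distance at least 2^k / 2 from the block, and even the trivial
count M^m suffices because total length is at most 2^k. -/
theorem sum_dyadicCells_exp_le (hM : 0 < M) (hT : T ⊆ Finset.range (M ^ m)) {x : ℝ}
    (hx : |x| ≤ 1 / 2) :
    ∑ i ∈ T, (2 : ℝ) ^ k / M ^ m * Real.exp (-((x - ((2 : ℝ) ^ k + i * ((2 : ℝ) ^ k / M ^ m))) /
      ((2 : ℝ) ^ k / M ^ m)) ^ 2 / 4) ≤ (2 : ℝ) ^ k * Real.exp (-((M : ℝ) ^ m) ^ 2 / 16) := by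
  have hMr : (0 : ℝ) < M := by exact_mod_cast hM
  have hc : (T.card : ℝ) ≤ (M : ℝ) ^ m := by
    have := Finset.card_le_card hT
    rw [Finset.card_range] at this
    exact_mod_cast this
  calc _ ≤ ∑ _i ∈ T, (2 : ℝ) ^ k / M ^ m * Real.exp (-((M : ℝ) ^ m) ^ 2 / 16) := by
        refine Finset.sum_le_sum fun i hi => ?_
        have h1 := dyadicCell_mem_Icc (k := k) hM hT hi
        have h2 : (2 : ℝ) ^ k / 2 ≤ |x - ((2 : ℝ) ^ k + i * ((2 : ℝ) ^ k / M ^ m))| := by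
          have h0 : (1 : ℝ) ≤ 2 ^ k := one_le_pow₀ (by norm_num)
          rw [abs_sub_comm]
          exact le_trans (by linarith [h1.1, (abs_le.1 hx).2]) (le_abs_self _)
        have h3 := sq_div_dyadicCell_ge (m := m) hM h2
        refine mul_le_mul_of_nonneg_left (Real.exp_le_exp.2 ?_) (by positivity)
        linarith
    _ = T.card * ((2 : ℝ) ^ k / M ^ m * Real.exp (-((M : ℝ) ^ m) ^ 2 / 16)) := by
        rw [Finset.sum_const, nsmul_eq_mul]
    _ ≤ (M : ℝ) ^ m * ((2 : ℝ) ^ k / M ^ m * Real.exp (-((M : ℝ) ^ m) ^ 2 / 16)) := by gcongr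
    _ = _ := by field_simp

end DyadicCells

/-! ### Dyadic covers, the logarithmic weight, and assembly. -/

theorem IsPorous.exists_dyadicCover {ν h : ℝ} {Y : Set ℝ} (hY : IsPorous ν h 1 Y) (hν : 0 < ν)
    (hν1 : ν < 1) (hh : 0 < h) {M : ℕ} (hM : 12 / ν ≤ M) (k m : ℕ)
    (hk : 16 / ν * (M : ℝ) ^ m ≤ 2 ^ k) :
    ∃ T : Finset ℕ, T ⊆ Finset.range (M ^ m) ∧ T.card ≤ (M - 1) ^ m ∧ ((2 : ℝ) ^ k ≤ 2 / h →
      ∀ z ∈ h⁻¹ • Y + Icc (-2 : ℝ) 2, (2 : ℝ) ^ k ≤ z → z ≤ 2 * 2 ^ k →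
        ∃ i ∈ T, |z - ((2 : ℝ) ^ k + i * ((2 : ℝ) ^ k / M ^ m))| ≤ (2 : ℝ) ^ k / M ^ m) := by
  by_cases h2 : (2 : ℝ) ^ k ≤ 2 / h
  · have hM0 : 0 < M := by
      have : (0 : ℝ) < M := lt_of_lt_of_le (by positivity) hM
      exact_mod_cast this
    obtain ⟨T, hT, hc, hcov⟩ := exists_cover_of_holes hM0 (by positivity : 0 < 16 / ν)
      (fun a L => hY.exists_hole_thickened hν hν1 hh hM a L) m ((2 : ℝ) ^ k) (2 ^ k) hk h2
    refine ⟨T, hT, hc, fun _ z hz hz1 hz2 => ?_⟩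
    obtain ⟨i, hi, h3, h4⟩ := hcov z hz hz1 (by linarith)
    refine ⟨i, hi, ?_⟩
    rw [abs_of_nonneg (by linarith)]
    linarith
  · exact ⟨∅, by simp, by simp, fun h => absurd h h2⟩

theorem exists_forall_mul_le_two_pow (R : ℝ) (n : ℕ) :
    ∃ N, n ≤ N ∧ ∀ k : ℕ, N ≤ k → R * k ≤ (2 : ℝ) ^ k := by
  have h1 := tendsto_pow_const_div_const_pow_of_one_lt 1 (by norm_num : (1 : ℝ) < 2)
  have h2 := (h1.const_mul R).eventually_le_const (by simp : R * 0 < 1)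
  obtain ⟨N, hN⟩ := eventually_atTop.1 h2
  refine ⟨max n N, le_max_left _ _, fun k hk => ?_⟩
  have := hN k ((le_max_right _ _).trans hk)
  rwa [pow_one, mul_div_assoc', div_le_one (by positivity)] at this

theorem logWeight_nonneg (δ ξ : ℝ) : 0 ≤ logWeight δ ξ :=
  Real.rpow_nonneg (Real.log_nonneg (by linarith [abs_nonneg ξ])) _

theorem logWeight_le_one {δ : ℝ} (hδ : 0 ≤ δ) (ξ : ℝ) : logWeight δ ξ ≤ 1 := by
  refine Real.rpow_le_one_of_one_le_of_nonpos ?_ (by linarith)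
  rw [Real.le_log_iff_exp_le (by positivity)]
  linarith [Real.exp_one_lt_d9, abs_nonneg ξ]

/-- Since log 2 > 1/2, log(10 + z) ≥ k/2, so the weight is at most 2^δ k^(-δ) ≤ 2/p; the other
factor 2 comes from z ≤ 2 · 2^k. -/
theorem mul_logWeight_le {δ : ℝ} (hδ : 0 < δ) (hδ1 : δ < 1) {k : ℕ} (hk : 1 ≤ k) {z : ℝ}
    (h1 : (2 : ℝ) ^ k ≤ z) (h2 : z ≤ 2 * 2 ^ k) {p : ℝ} (hp : 0 < p) (hpk : p ≤ (k : ℝ) ^ δ) :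
    |z| * logWeight δ z ≤ 4 * (2 ^ k / p) := by
  have hk0 : (0 : ℝ) < k := by exact_mod_cast hk
  have hz : 0 < z := lt_of_lt_of_le (by positivity) h1
  have hlog : (k : ℝ) / 2 ≤ Real.log (10 + |z|) := by
    rw [abs_of_pos hz]
    have h3 : Real.log ((2 : ℝ) ^ k) ≤ Real.log (10 + z) :=
      Real.log_le_log (by positivity) (by linarith)
    rw [Real.log_pow] at h3
    nlinarith [Real.log_two_gt_d9]
  have hw : logWeight δ z ≤ 2 * (1 / p) := by
    calc logWeight δ z ≤ ((k : ℝ) / 2) ^ (-δ) :=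
          Real.rpow_le_rpow_of_nonpos (by positivity) hlog (by linarith)
      _ = (2 : ℝ) ^ δ * (1 / (k : ℝ) ^ δ) := by
          rw [Real.rpow_neg (by positivity), Real.div_rpow hk0.le (by norm_num), inv_div]
          ring
      _ ≤ 2 * (1 / p) := by
          gcongr
          exact (Real.rpow_le_rpow_of_exponent_le (by norm_num) hδ1.le).trans_eq (Real.rpow_one 2)
  rw [abs_of_pos hz]
  calc z * logWeight δ z ≤ 2 * 2 ^ k * (2 * (1 / p)) :=
        mul_le_mul h2 hw (logWeight_nonneg _ _) (by positivity)
    _ = _ := by ring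

theorem mem_thickened_bounds {h : ℝ} (hh : 0 < h) {Y : Set ℝ} (hY : Y ⊆ Icc 0 1) {z : ℝ}
    (hz : z ∈ h⁻¹ • Y + Icc (-2 : ℝ) 2) : -2 ≤ z ∧ z ≤ 1 / h + 2 := by
  obtain ⟨w, hw, t, ht, rfl⟩ := mem_add.1 hz
  obtain ⟨y, hy, rfl⟩ := mem_smul_set.1 hw
  have h1 := (hY hy).1
  have h2 := (hY hy).2
  have hi : 0 < h⁻¹ := inv_pos.2 hh
  simp only [smul_eq_mul, one_div]
  constructor
  · nlinarith [ht.1]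
  · nlinarith [ht.2]

/-- For z ≥ 4 the bound z ≤ 1/h + 2 forces 2 ≤ 1/h, hence z ≤ 2/h. -/
theorem exists_dyadic_scale {h z : ℝ} (hz4 : 4 ≤ z) (hz : z ≤ 1 / h + 2) :
    ∃ k : ℕ, (2 : ℝ) ^ k ≤ z ∧ z < 2 * 2 ^ k ∧ (2 : ℝ) ^ k ≤ 2 / h := by
  obtain ⟨k, hk1, hk2⟩ := exists_nat_pow_near (by linarith : 1 ≤ z) (by norm_num : (1 : ℝ) < 2)
  refine ⟨k, hk1, by rwa [pow_succ'] at hk2, ?_⟩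
  have : (2 : ℝ) / h = 2 * (1 / h) := by ring
  linarith

/-- The multiplier before normalization. -/
theorem exists_multiplier_of_isPorous {ν : ℝ} (hν : 0 < ν) (hν1 : ν < 1) :
    ∃ A b κ δ : ℝ, 0 < A ∧ 0 < b ∧ 0 < κ ∧ δ < 1 ∧ ∀ (h : ℝ) (Y : Set ℝ), 0 < h →
      Y ⊆ Icc 0 1 → IsPorous ν h 1 Y → ∃ ψ : ℝ → ℂ, MemLp ψ 2 ∧
        tsupport ψ ⊆ Icc (-(ν / 10)) (ν / 10) ∧
        (∀ x : ℝ, |x| ≤ 1 / 2 → b ≤ ‖fourierHat ψ x‖) ∧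
        (∀ z ∈ h⁻¹ • Y + Icc (-2 : ℝ) 2, ‖fourierHat ψ z‖ ≤
          A * (((1 + |z|) ^ 10)⁻¹ * Real.exp (-(κ * |z| * logWeight δ z)))) ∧
        ∀ x : ℝ, ‖fourierHat ψ x‖ ≤ A * ((1 + |x|) ^ 10)⁻¹ := by
  obtain ⟨M, hM⟩ := exists_nat_ge (12 / ν)
  have hM12 : (12 : ℝ) < M := lt_of_lt_of_le ((lt_div_iff₀ hν).2 (by linarith)) hM
  have hM2 : 2 ≤ M := by
    have : (2 : ℝ) ≤ M := by linarith
    exact_mod_cast this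
  have hM0 : 0 < M := by omega
  have hMr : (0 : ℝ) < M := by linarith
  obtain ⟨δ, hδ0, hδ1, j, hj, hs0, hs1⟩ := exists_subdivision_depth hM2
  have hr0 : 0 ≤ ((M : ℝ) - 1) / M ^ 2 := div_nonneg (by linarith) (by positivity)
  obtain ⟨η, A, b, κ, hη, hA, hb, hκ, hfam⟩ := exists_multiplier_of_family (s := ν / 20)
    (C₀ := 4 * (∑' k, (((M : ℝ) - 1) / M ^ 2) ^ j k) + 4 * (3 * Real.pi))
    (C₁ := ∑' k, (2 : ℝ) ^ k * Real.exp (-((M : ℝ) ^ j k) ^ 2 / 16)) (by positivity)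
    (by
      have : 0 ≤ ∑' k, (((M : ℝ) - 1) / M ^ 2) ^ j k := tsum_nonneg fun k => by positivity
      positivity)
  -- As M^(j k) ≤ k, cells at scales k ≥ N have length at least η and at least 16/ν. The bound N ≥ 2
  -- puts the part z ≥ -2 below 2^N inside |z| ≤ 2^N.
  obtain ⟨N, hN2, hN⟩ := exists_forall_mul_le_two_pow (max η (16 / ν)) 2
  have hMk : ∀ k, N ≤ k → max η (16 / ν) * (M : ℝ) ^ j k ≤ 2 ^ k := fun k hk => by
    have hk1 : (1 : ℝ) ≤ k := by exact_mod_cast (by omega : 1 ≤ k)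
    refine le_trans ?_ (hN k hk)
    gcongr
    calc (M : ℝ) ^ j k ≤ (k : ℝ) ^ δ := hj k (by omega)
      _ ≤ (k : ℝ) ^ (1 : ℝ) := Real.rpow_le_rpow_of_exponent_le hk1 hδ1.le
      _ = k := Real.rpow_one _
  -- The enlarged constant absorbs the required decay on |z| ≤ 2^N, where no cells are placed; κ/4
  -- matches the factor 4 in `mul_logWeight_le`.
  refine ⟨A * Real.exp (κ / 4 * 2 ^ N), b, κ / 4, δ, by positivity, hb, by positivity, hδ1,
    fun h Y hh hY01 hY => ?_⟩
  have hcov : ∀ k : ℕ, ∃ T : Finset ℕ, N ≤ k → T ⊆ Finset.range (M ^ j k) ∧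
      T.card ≤ (M - 1) ^ j k ∧ ((2 : ℝ) ^ k ≤ 2 / h →
        ∀ z ∈ h⁻¹ • Y + Icc (-2 : ℝ) 2, (2 : ℝ) ^ k ≤ z → z ≤ 2 * 2 ^ k →
          ∃ i ∈ T, |z - ((2 : ℝ) ^ k + i * ((2 : ℝ) ^ k / M ^ j k))| ≤ (2 : ℝ) ^ k / M ^ j k) := by
    intro k
    by_cases hk : N ≤ k
    · obtain ⟨T, hT⟩ := hY.exists_dyadicCover hν hν1 hh hM k (j k)
        ((mul_le_mul_of_nonneg_right (le_max_right _ _) (by positivity)).trans (hMk k hk))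
      exact ⟨T, fun _ => hT⟩
    · exact ⟨∅, fun h => absurd h hk⟩
  choose T hT using hcov
  -- Relevant scales satisfy k < 2^k ≤ 2/h ≤ K, so the family is finite; all constants are
  -- independent of K.
  obtain ⟨K, hK⟩ := exists_nat_ge (2 / h)
  have hmem : ∀ {k : ℕ}, k ∈ Finset.Ico N K → N ≤ k := fun hk => (Finset.mem_Ico.1 hk).1
  obtain ⟨ψ, hψ, hψs, hup, hdec, hlow⟩ := hfam ((Finset.Ico N K).sigma T)
    (fun p => (2 : ℝ) ^ p.1 + p.2 * ((2 : ℝ) ^ p.1 / M ^ j p.1)) (fun p => (2 : ℝ) ^ p.1 / M ^ j p.1)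
    (fun p hp => by
      rw [le_div_iff₀ (by positivity)]
      have hk := hmem (Finset.mem_sigma.1 hp).1
      exact (mul_le_mul_of_nonneg_right (le_max_left _ _) (by positivity)).trans (hMk _ hk))
    (fun x => by
      rw [Finset.sum_sigma]
      calc _ ≤ ∑ k ∈ Finset.Ico N K, (4 * (((M : ℝ) - 1) / M ^ 2) ^ j k +
            if (2 : ℝ) ^ k / 2 < x ∧ x < 4 * 2 ^ k then 3 * Real.pi else 0) :=
            Finset.sum_le_sum fun k hk =>
              sum_dyadicCells_inv_le hM0 (hT k (hmem hk)).1 (hT k (hmem hk)).2.1 x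
        _ = 4 * ∑ k ∈ Finset.Ico N K, (((M : ℝ) - 1) / M ^ 2) ^ j k +
            (((Finset.Ico N K).filter fun k => (2 : ℝ) ^ k / 2 < x ∧ x < 4 * 2 ^ k).card : ℝ) *
              (3 * Real.pi) := by
            rw [Finset.sum_add_distrib, ← Finset.mul_sum, ← Finset.sum_filter, Finset.sum_const,
              nsmul_eq_mul]
        _ ≤ _ := by
            have h1 := hs0.sum_le_tsum (Finset.Ico N K) fun k _ => by positivity
            have h2 : (((Finset.Ico N K).filter fun k => (2 : ℝ) ^ k / 2 < x ∧ x < 4 * 2 ^ k).card :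
              ℝ) ≤ 4 := by exact_mod_cast card_filter_dyadic_le (Finset.Ico N K) x
            gcongr)
    (fun x hx => by
      rw [Finset.sum_sigma]
      calc _ ≤ ∑ k ∈ Finset.Ico N K, (2 : ℝ) ^ k * Real.exp (-((M : ℝ) ^ j k) ^ 2 / 16) :=
            Finset.sum_le_sum fun k hk => sum_dyadicCells_exp_le hM0 (hT k (hmem hk)).1 hx
        _ ≤ _ := hs1.sum_le_tsum _ fun k _ => by positivity)
  refine ⟨ψ, hψ, hψs.trans (Icc_subset_Icc (by linarith) (by linarith)), hlow, fun z hz => ?_,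
    fun x => (hup x).trans ?_⟩
  · obtain ⟨hz1, hz2⟩ := mem_thickened_bounds hh hY01 hz
    have hNexp : 1 ≤ Real.exp (κ / 4 * 2 ^ N) := Real.one_le_exp (by positivity)
    rcases lt_or_ge z (2 ^ N) with hzN | hzN
    · refine (hup z).trans ?_
      have h4 : (4 : ℝ) ≤ 2 ^ N := by
        calc (4 : ℝ) = 2 ^ 2 := by norm_num
          _ ≤ 2 ^ N := pow_le_pow_right₀ (by norm_num) hN2
      have hzabs : |z| ≤ 2 ^ N := abs_le.2 ⟨by linarith, hzN.le⟩
      have hw : |z| * logWeight δ z ≤ 2 ^ N * 1 :=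
        mul_le_mul hzabs (logWeight_le_one hδ0.le z) (logWeight_nonneg _ _) (by positivity)
      have hexp : 1 ≤ Real.exp (κ / 4 * 2 ^ N) * Real.exp (-(κ / 4 * |z| * logWeight δ z)) := by
        rw [← Real.exp_add]
        refine Real.one_le_exp ?_
        nlinarith
      calc A * ((1 + |z|) ^ 10)⁻¹ ≤ A * ((1 + |z|) ^ 10)⁻¹ *
            (Real.exp (κ / 4 * 2 ^ N) * Real.exp (-(κ / 4 * |z| * logWeight δ z))) :=
            le_mul_of_one_le_right (by positivity) hexp
        _ = _ := by ring
    · have h4 : (4 : ℝ) ≤ z := by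
        calc (4 : ℝ) = 2 ^ 2 := by norm_num
          _ ≤ 2 ^ N := pow_le_pow_right₀ (by norm_num) hN2
          _ ≤ z := hzN
      obtain ⟨k, hk1, hk2, hk3⟩ := exists_dyadic_scale h4 hz2
      have hNk : N ≤ k := by
        have : (2 : ℝ) ^ N < 2 ^ (k + 1) := by
          rw [pow_succ']
          linarith
        have := (pow_lt_pow_iff_right₀ (by norm_num : (1 : ℝ) < 2)).1 this
        omega
      have hkK : k < K := by
        have h5 : (k : ℝ) < 2 ^ k := by exact_mod_cast Nat.lt_two_pow_self
        have : (k : ℝ) < K := by linarith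
        exact_mod_cast this
      obtain ⟨i, hi, hzi⟩ := (hT k hNk).2.2 hk3 z hz hk1 hk2.le
      have h6 := hdec z ⟨k, i⟩ (Finset.mem_sigma.2 ⟨Finset.mem_Ico.2 ⟨hNk, hkK⟩, hi⟩) hzi
      refine h6.trans ?_
      have h7 := mul_logWeight_le hδ0 hδ1 (by omega : 1 ≤ k) hk1 hk2.le
        (by positivity : (0 : ℝ) < M ^ j k) (hj k (by omega))
      have h8 : Real.exp (-(κ * ((2 : ℝ) ^ k / M ^ j k))) ≤
          Real.exp (-(κ / 4 * |z| * logWeight δ z)) := by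
        refine Real.exp_le_exp.2 ?_
        nlinarith
      calc A * ((1 + |z|) ^ 10)⁻¹ * Real.exp (-(κ * ((2 : ℝ) ^ k / M ^ j k))) ≤
            A * ((1 + |z|) ^ 10)⁻¹ * Real.exp (-(κ / 4 * |z| * logWeight δ z)) := by gcongr
        _ ≤ A * ((1 + |z|) ^ 10)⁻¹ * Real.exp (-(κ / 4 * |z| * logWeight δ z)) *
            Real.exp (κ / 4 * 2 ^ N) := le_mul_of_one_le_right (by positivity) hNexp
        _ = _ := by ring
  · rw [mul_right_comm]
    exact le_mul_of_one_le_right (by positivity) (Real.one_le_exp (by positivity))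

/-! ### Normalization. -/

theorem fourierHat_const_mul (c : ℂ) (f : ℝ → ℂ) (ξ : ℝ) :
    fourierHat (fun x => c * f x) ξ = c * fourierHat f ξ := by
  rw [fourierHat_eq_integral, fourierHat_eq_integral, ← integral_const_mul]
  congr 1
  ext x
  ring

theorem ofReal_le_eLpNorm_Ioo {f : ℝ → ℂ} {b : ℝ} (hf : ∀ x : ℝ, |x| ≤ 1 / 2 → b ≤ ‖f x‖) :
    ENNReal.ofReal b ≤ eLpNorm f 2 (volume.restrict (Ioo (-(1 / 2) : ℝ) (1 / 2))) := by
  have h1 : eLpNorm (fun _ : ℝ => b) 2 (volume.restrict (Ioo (-(1 / 2) : ℝ) (1 / 2))) =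
      ENNReal.ofReal |b| := by
    rw [eLpNorm_const _ (by norm_num) (by
      rw [Ne, Measure.restrict_eq_zero, Real.volume_Ioo]
      norm_num)]
    rw [Measure.restrict_apply_univ, Real.volume_Ioo]
    norm_num [← ofReal_norm]
  rcases le_total b 0 with hb | hb
  · simp [ENNReal.ofReal_of_nonpos hb]
  rw [abs_of_nonneg hb] at h1
  rw [← h1]
  refine eLpNorm_mono_ae ?_
  filter_upwards [ae_restrict_mem measurableSet_Ioo] with x hx
  rw [Real.norm_of_nonneg hb]
  exact hf x (abs_le.2 ⟨hx.1.le, hx.2.le⟩)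

end FourierMultipliers

theorem mainTheorem6 (ν : ℝ) (hν₀ : 0 < ν) (hν₁ : ν < 1) :
    ∃ c₁ δ : ℝ, 0 < c₁ ∧ δ < 1 ∧
      ∀ (h : ℝ) (Y : Set ℝ), 0 < h → h ≤ 1 → Y ⊆ Icc 0 1 → IsPorous ν h 1 Y →
        ∃ ψ : ℝ → ℂ,
          MemLp ψ 2 volume ∧
          tsupport ψ ⊆ Icc (-(ν / 10)) (ν / 10) ∧
          ENNReal.ofReal c₁ ≤
            eLpNorm (fourierHat ψ) 2 (volume.restrict (Ioo (-(1 / 2) : ℝ) (1 / 2))) ∧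
          (∀ ξ ∈ h⁻¹ • Y + Icc (-2 : ℝ) 2,
            ‖fourierHat ψ ξ‖ ≤
              (1 + |ξ|) ^ (-10 : ℤ) * Real.exp (-(c₁ * |ξ| * logWeight δ ξ))) ∧
          (∀ ξ : ℝ, ‖fourierHat ψ ξ‖ ≤ (1 + |ξ|) ^ (-10 : ℤ)) := by
  obtain ⟨A, b, κ, δ, hA, hb, hκ, hδ, hmain⟩ := exists_multiplier_of_isPorous hν₀ hν₁
  -- Dividing the function by A makes the upper bounds exact and lowers the bound from below to b/A.
  refine ⟨min κ (b / A), δ, lt_min hκ (by positivity), hδ, fun h Y hh _ hY01 hY => ?_⟩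
  obtain ⟨ψ, hψ, hψs, hlow, hdec, hup⟩ := hmain h Y hh hY01 hY
  have hnorm : ∀ ξ, ‖fourierHat (fun x => ((A⁻¹ : ℝ) : ℂ) * ψ x) ξ‖ = A⁻¹ * ‖fourierHat ψ ξ‖ :=
    fun ξ => by
      rw [fourierHat_const_mul, norm_mul, Complex.norm_real, Real.norm_of_nonneg (by positivity)]
  have hzpow : ∀ ξ : ℝ, (1 + |ξ|) ^ (-10 : ℤ) = ((1 + |ξ|) ^ 10)⁻¹ := fun ξ => by
    rw [zpow_neg]
    norm_cast
  refine ⟨fun x => ((A⁻¹ : ℝ) : ℂ) * ψ x, hψ.const_mul _,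
    (closure_mono (Function.support_mul_subset_right _ _)).trans hψs, ?_, fun ξ hξ => ?_,
    fun ξ => ?_⟩
  · refine (ENNReal.ofReal_le_ofReal (min_le_right _ _)).trans
      (ofReal_le_eLpNorm_Ioo fun x hx => ?_)
    rw [hnorm, div_eq_inv_mul]
    exact mul_le_mul_of_nonneg_left (hlow x hx) (by positivity)
  · rw [hnorm, hzpow, inv_mul_le_iff₀ hA]
    refine (hdec ξ hξ).trans ?_
    have : min κ (b / A) * |ξ| * logWeight δ ξ ≤ κ * |ξ| * logWeight δ ξ := by
      have := logWeight_nonneg δ ξ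
      gcongr
      exact min_le_left _ _
    gcongr
  · rw [hnorm, hzpow, inv_mul_le_iff₀ hA]
    exact hup ξ
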